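/- Let $-\infty\le a<b\le\infty$, let $J$ be a constant invertible skew-Hermitian $2\times2$ matrix, and let $q$ and $w$ be $2\times 2$ matrices whose entries are complex distributions of order $0$ on $(a,b)$ (locally, complex measures), $q$ Hermitian and $w$ non-negative. For a matrix $r$ of such distributions let $\Delta_r(x)=R^+(x)-R^-(x)$ be the jump at $x$ of an antiderivative $R\in BV_{\rm loc}$ of $r$, i.e. the mass of $r$ at $\{x\}$. Assume that $2J\pm\Delta_q(x)$ are invertible for all $x\in(a,b)$, and that $J$, $q$ and $w$ are real. Let $\tilde W$ be the matrix of Radon–Nikodym derivatives of $w$ with respect to $\operatorname{tr}w$, let $\mathcal L^2(w)$ be the space of functions $f:(a,b)\to\mathbb C^2$ with $\int f^*\tilde Wf\,\operatorname{tr}w<\infty$, with the semi-scalar product $\langle f,g\rangle=\int f^*\tilde Wg\,\operatorname{tr}w$, and let $L^2(w)$ be the Hilbert space obtained by identifying functions whose difference has norm $0$; the class of $f$ is denoted by $[f]$. Let $BV^\#_{\rm loc}((a,b))^2$ be the space of functions $u:(a,b)\to\mathbb C^2$ of locally bounded variation which are balanced, i.e. $u=(u^++u^-)/2$, where $u^\pm$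 are the one-sided limits. Put $$T_{\max}=\{([u],[f]):u,f\in\mathcal L^2(w),\ u\in BV^\#_{\rm loc}((a,b))^2,\ Ju'+qu=wf\}\subset L^2(w)\times L^2(w),$$ $$\mathcal L_0=\{u\in BV^\#_{\rm loc}((a,b))^2: Ju'+qu=0,\ wu=0\},$$ where the equations are understood in the sense of distributions, and let $n_\pm=\dim\{([u],\pm i[u])\in T_{\max}\}$. The adjoint of a linear relation $T\subset L^2(w)\times L^2(w)$ is $T^*=\{(v,g):\langle g,u\rangle=\langle v,f\rangle\text{ for all }(u,f)\in T\}$. Theorem. Assume that $\dim\mathcal L_0=1$, that $n_+=n_-=0$, and that $\ker\Delta_w(x)\subset\ker\bigl(\Delta_w(x)J^{-1}\Delta_q(x)\bigr)$ for all $x\in(a,b)$. Then $$T_{\max}=T_{\max}^*=\{0\}\times L^2(w).$$ -/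

import Mathlib

open MeasureTheory Set Filter Topology TopologicalSpace
open scoped Distributions Matrix ComplexConjugate ComplexOrder

namespace FirstOrderSystem

noncomputable section

/-- The open interval `(a, b)` of the real line, `-∞ ≤ a`, `b ≤ ∞`. -/
def openInterval (a b : EReal) : Opens ℝ where
  carrier := {x : ℝ | a < (x : EReal) ∧ (x : EReal) < b}
  is_open' := by
    have h : Continuous fun x : ℝ => (x : EReal) := continuous_coe_real_ereal
    exact (isOpen_lt continuous_const h).inter (isOpen_lt h continuous_const)

/-! ### Functions of locally bounded variation

A function on `Ω` is represented by the function on `ℝ` that extends it by zero. -/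

/-- The space `BV_loc^#(Ω)^n` of balanced functions of locally bounded variation: at each point of
`Ω` the value is the mean of the two one-sided limits. -/
def balancedBV (Ω : Opens ℝ) (n : ℕ) : Submodule ℂ (ℝ → Fin n → ℂ) where
  carrier := {u | LocallyBoundedVariationOn u (Ω : Set ℝ) ∧
    (∀ x ∈ Ω, ∃ l r : Fin n → ℂ, Tendsto u (𝓝[<] x) (𝓝 l) ∧ Tendsto u (𝓝[>] x) (𝓝 r) ∧
      u x = (1 / 2 : ℂ) • (l + r)) ∧
    ∀ x, x ∉ Ω → u x = 0}
  add_mem' := by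
    rintro u v ⟨hu1, hu2, hu3⟩ ⟨hv1, hv2, hv3⟩
    refine ⟨?_, ?_, ?_⟩
    · intro a b ha hb
      have h1 := hu1 a b ha hb
      have h2 := hv1 a b ha hb
      refine ne_top_of_le_ne_top (ENNReal.add_ne_top.2 ⟨h1, h2⟩) ?_
      refine iSup_le fun p => ?_
      refine le_trans ?_ (add_le_add
        (eVariationOn.sum_le (n := p.1) p.2.2.1 p.2.2.2)
        (eVariationOn.sum_le (n := p.1) p.2.2.1 p.2.2.2))
      rw [← Finset.sum_add_distrib]
      refine Finset.sum_le_sum fun i _ => ?_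
      exact edist_add_add_le _ _ _ _
    · intro x hx
      obtain ⟨l, r, hl, hr, h⟩ := hu2 x hx
      obtain ⟨l', r', hl', hr', h'⟩ := hv2 x hx
      refine ⟨l + l', r + r', hl.add hl', hr.add hr', ?_⟩
      rw [Pi.add_apply, h, h', ← smul_add]
      congr 1
      abel
    · intro x hx
      simp [hu3 x hx, hv3 x hx]
  zero_mem' := by
    refine ⟨?_, ?_, ?_⟩
    · intro a b _ _
      have h : eVariationOn (0 : ℝ → Fin n → ℂ) ((Ω : Set ℝ) ∩ Icc a b) = 0 :=
        eVariationOn.constant_on (by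
          rintro _ ⟨x, _, rfl⟩ _ ⟨y, _, rfl⟩
          rfl)
      simp [BoundedVariationOn, h]
    · intro x _
      refine ⟨0, 0, tendsto_const_nhds, tendsto_const_nhds, by simp⟩
    · intro x _
      rfl
  smul_mem' := by
    rintro c u ⟨hu1, hu2, hu3⟩
    refine ⟨?_, ?_, ?_⟩
    · have hL : LipschitzWith ‖c‖₊ fun y : Fin n → ℂ => c • y := lipschitzWith_smul c
      exact hL.comp_locallyBoundedVariationOn hu1
    · intro x hx
      obtain ⟨l, r, hl, hr, h⟩ := hu2 x hx
      refine ⟨c • l, c • r, hl.const_smul c, hr.const_smul c, ?_⟩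
      rw [Pi.smul_apply, h, ← smul_add, smul_comm]
    · intro x hx
      simp [hu3 x hx]

/-! ### Distributions of order zero

`𝓓'^{0}(Ω, ℂ)` is Mathlib's space of complex distributions of order at most zero on `Ω`
(tested against real functions). By Riesz's theorem each of them is locally a complex measure. -/

/-- A set function on `Ω` that is locally a complex measure, in polar form: `dm = phase · d|m|`,
where the total variation measure `|m|` is finite on compact subsets of `Ω` and `|phase| = 1`. -/
structure LocalMeasure (Ω : Opens ℝ) where
  variation : Measure ℝ
  phase : ℝ → ℂ
  finite_of_isCompact : ∀ K : Set ℝ, IsCompact K → K ⊆ (Ω : Set ℝ) → variation K < ⊤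
  null_compl : variation (Ω : Set ℝ)ᶜ = 0
  measurable_phase : Measurable phase
  norm_phase : ∀ x, ‖phase x‖ = 1

instance (Ω : Opens ℝ) : Nonempty (LocalMeasure Ω) :=
  ⟨⟨0, fun _ => 1, by simp, by simp, measurable_const, by simp⟩⟩

/-- The integral `∫ g dm`. -/
def LocalMeasure.integral {Ω : Opens ℝ} (m : LocalMeasure Ω) (g : ℝ → ℂ) : ℂ :=
  ∫ x, g x * m.phase x ∂m.variation

/-- The set function that corresponds to a distribution of order zero: `q(φ) = ∫ φ dm` for all
test functions `φ`. This determines `dm`. -/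
def toMeasure {Ω : Opens ℝ} (q : 𝓓'^{0}(Ω, ℂ)) : LocalMeasure Ω :=
  Classical.epsilon fun m => ∀ φ : 𝓓^{0}(Ω, ℝ), q φ = m.integral fun x => (φ x : ℂ)

variable {Ω : Opens ℝ} {n : ℕ}

/-- The matrix `Δ_q(x) = Q⁺(x) - Q⁻(x)`, where `Q` is an antiderivative of `q`; this is the value
of the measure `dQ` on the singleton `{x}`. -/
def jump (q : Matrix (Fin n) (Fin n) 𝓓'^{0}(Ω, ℂ)) (x : ℝ) : Matrix (Fin n) (Fin n) ℂ :=
  Matrix.of fun j k =>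
    (((toMeasure (q j k)).variation.real {x} : ℝ) : ℂ) * (toMeasure (q j k)).phase x

/-- `q` is Hermitian: `q_{kj}` is the conjugate of `q_{jk}`. -/
def IsHermitianDist (q : Matrix (Fin n) (Fin n) 𝓓'^{0}(Ω, ℂ)) : Prop :=
  ∀ j k, ∀ φ : 𝓓^{0}(Ω, ℝ), q k j φ = conj (q j k φ)

/-- `q` is real: every entry takes real values on real test functions. -/
def IsRealDist (q : Matrix (Fin n) (Fin n) 𝓓'^{0}(Ω, ℂ)) : Prop :=
  ∀ j k, ∀ φ : 𝓓^{0}(Ω, ℝ), conj (q j k φ) = q j k φ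

/-- `w` is non-negative: for each `c ∈ ℂⁿ` the distribution `c^* w c` takes non-negative real
values on non-negative test functions. -/
def IsNonnegDist (w : Matrix (Fin n) (Fin n) 𝓓'^{0}(Ω, ℂ)) : Prop :=
  ∀ c : Fin n → ℂ, ∀ φ : 𝓓^{0}(Ω, ℝ), (∀ x, 0 ≤ φ x) →
    0 ≤ (∑ j, ∑ k, conj (c j) * w j k φ * c k).re ∧
      (∑ j, ∑ k, conj (c j) * w j k φ * c k).im = 0

/-! ### The space `L²(w)` -/

/-- A non-negative matrix measure `density · d(base)` on `Ω` whose trace is `base`. -/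
structure MatrixMeasure (Ω : Opens ℝ) (n : ℕ) where
  base : Measure ℝ
  density : ℝ → Matrix (Fin n) (Fin n) ℂ
  finite_of_isCompact : ∀ K : Set ℝ, IsCompact K → K ⊆ (Ω : Set ℝ) → base K < ⊤
  null_compl : base (Ω : Set ℝ)ᶜ = 0
  measurable_density : ∀ j k, Measurable fun x => density x j k
  posSemidef : ∀ x, (density x).PosSemidef
  trace_density : ∀ᵐ x ∂base, (density x).trace = 1

instance (Ω : Opens ℝ) (n : ℕ) : Nonempty (MatrixMeasure Ω n) :=
  ⟨⟨0, 0, by simp, by simp, by simp, fun _ => Matrix.PosSemidef.zero, by simp⟩⟩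

/-- The matrix measure that corresponds to a non-negative matrix distribution `w`: its base is the
measure `tr w`, and its density is the matrix of Radon–Nikodym derivatives of `w` with respect
to `tr w`. -/
def toMatrixMeasure (w : Matrix (Fin n) (Fin n) 𝓓'^{0}(Ω, ℂ)) : MatrixMeasure Ω n :=
  Classical.epsilon fun M =>
    ∀ j k, ∀ φ : 𝓓^{0}(Ω, ℝ), w j k φ = ∫ x, (φ x : ℂ) * M.density x j k ∂M.base

theorem re_dotProduct_bound {A : Matrix (Fin n) (Fin n) ℂ} (hA : A.PosSemidef)
    (f g : Fin n → ℂ) :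
    ‖star f ⬝ᵥ A *ᵥ g‖ ≤ (star f ⬝ᵥ A *ᵥ f).re + (star g ⬝ᵥ A *ᵥ g).re := by
  have hsymm : star g ⬝ᵥ A *ᵥ f = conj (star f ⬝ᵥ A *ᵥ g) := by
    have h : star (star f ⬝ᵥ A *ᵥ g) = star g ⬝ᵥ A *ᵥ f := by
      rw [Matrix.star_dotProduct, star_star, Matrix.star_mulVec, hA.1.eq,
        ← Matrix.dotProduct_mulVec]
    exact h.symm
  have key : ∀ c : ℂ, 0 ≤ (star f ⬝ᵥ A *ᵥ f).re + Complex.normSq c * (star g ⬝ᵥ A *ᵥ g).re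
      + 2 * (c * (star f ⬝ᵥ A *ᵥ g)).re := by
    intro c
    have h := hA.re_dotProduct_nonneg (f + c • g)
    have e : star (f + c • g) ⬝ᵥ A *ᵥ (f + c • g) = (star f ⬝ᵥ A *ᵥ f)
        + (conj c * c) * (star g ⬝ᵥ A *ᵥ g) + (c * (star f ⬝ᵥ A *ᵥ g)
        + conj (c * (star f ⬝ᵥ A *ᵥ g))) := by
      rw [map_mul, ← hsymm]
      simp only [star_add, star_smul, Matrix.mulVec_add, Matrix.mulVec_smul, add_dotProduct,
        dotProduct_add, smul_dotProduct, dotProduct_smul, smul_eq_mul, RCLike.star_def]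
      ring
    rw [e, Complex.add_conj, ← Complex.normSq_eq_conj_mul_self] at h
    simpa using h
  have h1 := key 1
  have h2 := key (-1)
  have h3 := key Complex.I
  have h4 := key (-Complex.I)
  simp at h1 h2 h3 h4
  refine (Complex.norm_le_abs_re_add_abs_im _).trans ?_
  have h5 : |(star f ⬝ᵥ A *ᵥ g).re| ≤
      ((star f ⬝ᵥ A *ᵥ f).re + (star g ⬝ᵥ A *ᵥ g).re) / 2 := by
    rw [abs_le]; constructor <;> linarith
  have h6 : |(star f ⬝ᵥ A *ᵥ g).im| ≤
      ((star f ⬝ᵥ A *ᵥ f).re + (star g ⬝ᵥ A *ᵥ g).re) / 2 := by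
    rw [abs_le]; constructor <;> linarith
  linarith

namespace MatrixMeasure

variable (M : MatrixMeasure Ω n)

/-- `f` is measurable and `∫ f^* W f < ∞`, where `W` is the density. (A function for which only
`W f` is measurable has the same product `W f` as a measurable one, so the space of classes does
not change if such functions are admitted.) -/
def IsSqIntegrable (f : ℝ → Fin n → ℂ) : Prop :=
  (∀ j, AEStronglyMeasurable (fun x => f x j) M.base) ∧
    Integrable (fun x => star (f x) ⬝ᵥ M.density x *ᵥ f x) M.base

theorem aestronglyMeasurable_mulVec {g : ℝ → Fin n → ℂ}
    (hg : ∀ j, AEStronglyMeasurable (fun x => g x j) M.base) (j : Fin n) :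
    AEStronglyMeasurable (fun x => (M.density x *ᵥ g x) j) M.base := by
  simp only [Matrix.mulVec, dotProduct]
  exact Finset.aestronglyMeasurable_fun_sum _ fun k _ =>
    (M.measurable_density j k).aestronglyMeasurable.mul (hg k)

variable {M}

theorem IsSqIntegrable.integrable_inner {f g : ℝ → Fin n → ℂ} (hf : M.IsSqIntegrable f)
    (hg : M.IsSqIntegrable g) :
    Integrable (fun x => star (f x) ⬝ᵥ M.density x *ᵥ g x) M.base := by
  refine Integrable.mono' (hf.2.re.add hg.2.re) ?_ ?_
  · have h : ∀ j ∈ Finset.univ, AEStronglyMeasurable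
        (fun x => star (f x j) * (M.density x *ᵥ g x) j) M.base := fun j _ =>
      (hf.1 j).star.mul (M.aestronglyMeasurable_mulVec hg.1 j)
    exact Finset.aestronglyMeasurable_fun_sum _ h
  · exact Eventually.of_forall fun x => re_dotProduct_bound (M.posSemidef x) _ _

variable (M)

/-- The space of representatives of the elements of `L²`. -/
def sqIntegrable : Submodule ℂ (ℝ → Fin n → ℂ) where
  carrier := {f | M.IsSqIntegrable f}
  add_mem' := by
    intro f g hf hg
    refine ⟨fun j => (hf.1 j).add (hg.1 j), ?_⟩
    have h := ((hf.integrable_inner hf).add (hf.integrable_inner hg)).add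
      ((hg.integrable_inner hf).add (hg.integrable_inner hg))
    refine h.congr (Eventually.of_forall fun x => ?_)
    simp only [Pi.add_apply, star_add, Matrix.mulVec_add, add_dotProduct, dotProduct_add]
    ring
  zero_mem' := by
    refine ⟨fun j => ?_, ?_⟩
    · exact aestronglyMeasurable_const
    · simp
  smul_mem' := by
    intro c f hf
    refine ⟨fun j => (hf.1 j).const_mul c, ?_⟩
    refine (hf.2.const_mul (conj c * c)).congr (Eventually.of_forall fun x => ?_)
    simp only [Pi.smul_apply, star_smul, Matrix.mulVec_smul, smul_dotProduct, dotProduct_smul,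
      smul_eq_mul, RCLike.star_def]
    ring

/-- The space of representatives, carrying only the topology of the semi-norm below. -/
def PreLTwo : Type := M.sqIntegrable

instance : AddCommGroup M.PreLTwo := inferInstanceAs (AddCommGroup M.sqIntegrable)

instance : Module ℂ M.PreLTwo := inferInstanceAs (Module ℂ M.sqIntegrable)

/-- The semi-scalar product `⟨f, g⟩ = ∫ f^* W g`, linear in the second entry. -/
@[reducible] def preInner : PreInnerProductSpace.Core ℂ M.PreLTwo where
  inner f g := ∫ x, star (f.1 x) ⬝ᵥ M.density x *ᵥ g.1 x ∂M.base
  conj_inner_symm f g := by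
    rw [← integral_conj]
    refine integral_congr_ae (Eventually.of_forall fun x => ?_)
    change star (star (g.1 x) ⬝ᵥ M.density x *ᵥ f.1 x) = _
    rw [Matrix.star_dotProduct, star_star, Matrix.star_mulVec, ← Matrix.dotProduct_mulVec,
      (M.posSemidef x).1.eq]
  re_inner_nonneg f := by
    have h := integral_re (f.2.integrable_inner f.2)
    rw [← h]
    exact integral_nonneg fun x => (M.posSemidef x).re_dotProduct_nonneg _
  add_left f g h := by
    rw [← integral_add (f.2.integrable_inner h.2) (g.2.integrable_inner h.2)]
    refine integral_congr_ae (Eventually.of_forall fun x => ?_)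
    change star (f.1 x + g.1 x) ⬝ᵥ _ = _
    rw [star_add, add_dotProduct]
  smul_left f g c := by
    rw [← integral_const_mul]
    refine integral_congr_ae (Eventually.of_forall fun x => ?_)
    change star (c • f.1 x) ⬝ᵥ _ = _
    rw [star_smul, smul_dotProduct, smul_eq_mul, RCLike.star_def]

instance : SeminormedAddCommGroup M.PreLTwo :=
  @InnerProductSpace.Core.toSeminormedAddCommGroup ℂ M.PreLTwo _ _ _ M.preInner

instance : InnerProductSpace ℂ M.PreLTwo := InnerProductSpace.ofCore M.preInner

end MatrixMeasure

/-- The space of representatives `𝓛²(w)`. -/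
abbrev PreLTwo (w : Matrix (Fin n) (Fin n) 𝓓'^{0}(Ω, ℂ)) : Type :=
  (toMatrixMeasure w).PreLTwo

/-- The space `L²(w)`: functions in `𝓛²(w)` are identified if the norm of their difference
is zero. -/
abbrev LTwo (w : Matrix (Fin n) (Fin n) 𝓓'^{0}(Ω, ℂ)) : Type :=
  SeparationQuotient (PreLTwo w)

/-! ### The differential equation -/

/-- The distributional derivative `u'`. -/
def derivDist (u : ℝ → Fin n → ℂ) (φ : 𝓓(Ω, ℝ)) : Fin n → ℂ :=
  fun j => -∫ x, ((deriv φ x : ℝ) : ℂ) * u x j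

/-- The distribution `q u`, that is `φ ↦ ∫ φ dQ u`. -/
def mulDist (q : Matrix (Fin n) (Fin n) 𝓓'^{0}(Ω, ℂ)) (u : ℝ → Fin n → ℂ) (φ : 𝓓(Ω, ℝ)) :
    Fin n → ℂ :=
  fun j => ∑ k, (toMeasure (q j k)).integral fun x => (φ x : ℂ) * u x k

/-- The distribution `w f`, that is `φ ↦ ∫ φ W f d(tr w)`. -/
def weightDist (w : Matrix (Fin n) (Fin n) 𝓓'^{0}(Ω, ℂ)) (f : ℝ → Fin n → ℂ) (φ : 𝓓(Ω, ℝ)) :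
    Fin n → ℂ :=
  fun j => ∫ x, (φ x : ℂ) * ((toMatrixMeasure w).density x *ᵥ f x) j ∂(toMatrixMeasure w).base

theorem integrable_mul_balancedBV {u : ℝ → Fin n → ℂ} (hu : u ∈ balancedBV Ω n)
    {ψ : ℝ → ℝ} (hψ : Continuous ψ) (hc : HasCompactSupport ψ) (hs : tsupport ψ ⊆ (Ω : Set ℝ))
    {ν : Measure ℝ} (hν : ∀ K : Set ℝ, IsCompact K → K ⊆ (Ω : Set ℝ) → ν K < ⊤) (k : Fin n) :
    Integrable (fun x => (ψ x : ℂ) * u x k) ν := by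
  have hK : IsCompact (tsupport ψ) := hc
  have hfin : IsFiniteMeasure (ν.restrict (tsupport ψ)) :=
    ⟨by simpa using hν _ hK hs⟩
  have hsupp : Function.support (fun x => (ψ x : ℂ) * u x k) ⊆ tsupport ψ := by
    intro x hx
    refine subset_tsupport ψ ?_
    intro h
    exact hx (by simp [h])
  rw [← integrableOn_iff_integrable_of_support_subset hsupp]
  obtain ⟨C, hC⟩ := hψ.bounded_above_of_compact_support hc
  have hmeas : AEStronglyMeasurable (fun x => u x k) (ν.restrict (tsupport ψ)) := by
    have hre : LocallyBoundedVariationOn (fun x => (u x k).re) (Ω : Set ℝ) :=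
      LipschitzWith.comp_locallyBoundedVariationOn (C := 1) (f := fun y : Fin n → ℂ => (y k).re)
        (LipschitzWith.mk_one fun y z => by
          rw [Real.dist_eq, ← Complex.sub_re]
          refine (Complex.abs_re_le_norm _).trans ?_
          rw [← dist_eq_norm]
          exact dist_le_pi_dist y z k) hu.1
    have him : LocallyBoundedVariationOn (fun x => (u x k).im) (Ω : Set ℝ) :=
      LipschitzWith.comp_locallyBoundedVariationOn (C := 1) (f := fun y : Fin n → ℂ => (y k).im)
        (LipschitzWith.mk_one fun y z => by
          rw [Real.dist_eq, ← Complex.sub_im]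
          refine (Complex.abs_im_le_norm _).trans ?_
          rw [← dist_eq_norm]
          exact dist_le_pi_dist y z k) hu.1
    have real : ∀ g : ℝ → ℝ, LocallyBoundedVariationOn g (Ω : Set ℝ) →
        AEMeasurable g (ν.restrict (tsupport ψ)) := by
      intro g hg
      obtain ⟨p, r, hp, hr, rfl⟩ := hg.exists_monotoneOn_sub_monotoneOn
      exact ((aemeasurable_restrict_of_monotoneOn Ω.isOpen.measurableSet hp).sub
        (aemeasurable_restrict_of_monotoneOn Ω.isOpen.measurableSet hr)).mono_measure
          (Measure.restrict_mono hs le_rfl)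
    have h : AEMeasurable (fun x => ((u x k).re : ℂ) + ((u x k).im : ℂ) * Complex.I)
        (ν.restrict (tsupport ψ)) :=
      (Complex.measurable_ofReal.comp_aemeasurable (real _ hre)).add
        ((Complex.measurable_ofReal.comp_aemeasurable (real _ him)).mul_const _)
    simpa only [Complex.re_add_im] using h.aestronglyMeasurable
  obtain ⟨B, hB⟩ : ∃ B : ℝ, ∀ x ∈ tsupport ψ, ‖u x k‖ ≤ B := by
    rcases (tsupport ψ).eq_empty_or_nonempty with h0 | h0
    · exact ⟨0, fun x hx => by simp [h0] at hx⟩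
    · obtain ⟨c, hcK, hcle⟩ := hK.exists_isLeast h0
      obtain ⟨d, hdK, hdle⟩ := hK.exists_isGreatest h0
      have hbv := hu.1 c d (hs hcK) (hs hdK)
      refine ⟨‖u c‖ + (eVariationOn u ((Ω : Set ℝ) ∩ Icc c d)).toReal, fun x hx => ?_⟩
      have h1 : dist (u x) (u c) ≤ _ := hbv.dist_le
        ⟨hs hx, hcle hx, hdle hx⟩ ⟨hs hcK, le_rfl, hcle hdK⟩
      have h2 := norm_le_pi_norm (u x) k
      have h3 : ‖u x‖ ≤ ‖u c‖ + dist (u x) (u c) := by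
        rw [dist_eq_norm]
        exact norm_le_norm_add_norm_sub' (u x) (u c)
      linarith
  refine Integrable.of_bound (C := C * B) ?_ ?_
  · exact (Complex.continuous_ofReal.comp hψ).aestronglyMeasurable.mul hmeas
  · refine (ae_restrict_mem (isClosed_tsupport ψ).measurableSet).mono fun x hx => ?_
    rw [norm_mul, Complex.norm_real]
    exact mul_le_mul (hC x) (hB x hx) (norm_nonneg _) ((norm_nonneg _).trans (hC x))

theorem integrable_mul_phase {u : ℝ → Fin n → ℂ} (hu : u ∈ balancedBV Ω n) (φ : 𝓓(Ω, ℝ))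
    (m : LocalMeasure Ω) (k : Fin n) :
    Integrable (fun x => (φ x : ℂ) * u x k * m.phase x) m.variation :=
  (integrable_mul_balancedBV hu φ.continuous φ.hasCompactSupport φ.tsupport_subset
    m.finite_of_isCompact k).mul_bdd (c := 1) m.measurable_phase.aestronglyMeasurable
    (Eventually.of_forall fun x => (m.norm_phase x).le)

theorem integrable_deriv_mul {u : ℝ → Fin n → ℂ} (hu : u ∈ balancedBV Ω n) (φ : 𝓓(Ω, ℝ))
    (k : Fin n) : Integrable fun x => ((deriv φ x : ℝ) : ℂ) * u x k := by
  have hφ : ContDiff ℝ 1 φ := φ.contDiff.of_le (by exact_mod_cast le_top)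
  exact integrable_mul_balancedBV hu (hφ.continuous_deriv le_rfl) φ.hasCompactSupport.deriv
    (fun _ hx => φ.tsupport_subset (tsupport_deriv_subset hx)) (fun K hK _ => hK.measure_lt_top) k

theorem integrable_mul_density (M : MatrixMeasure Ω n) {f : ℝ → Fin n → ℂ}
    (hf : M.IsSqIntegrable f) (φ : 𝓓(Ω, ℝ)) (j : Fin n) :
    Integrable (fun x => (φ x : ℂ) * (M.density x *ᵥ f x) j) M.base := by
  obtain ⟨C, hC⟩ := φ.continuous.bounded_above_of_compact_support φ.hasCompactSupport
  have hφ : Integrable (fun x => ‖φ x‖) M.base := by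
    have hfin : IsFiniteMeasure (M.base.restrict (tsupport φ)) :=
      ⟨by simpa using M.finite_of_isCompact _ φ.hasCompactSupport φ.tsupport_subset⟩
    rw [← integrableOn_iff_integrable_of_support_subset (s := tsupport φ)
      (fun x hx => subset_tsupport φ (by simpa using hx))]
    exact Integrable.of_bound (C := C) φ.continuous.norm.aestronglyMeasurable
      (Eventually.of_forall fun x => by simpa using hC x)
  have hmeas := M.aestronglyMeasurable_mulVec hf.1 j
  refine Integrable.mono' (hφ.add (hf.2.re.const_mul C))
    ((Complex.continuous_ofReal.comp φ.continuous).aestronglyMeasurable.mul hmeas) ?_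
  filter_upwards [M.trace_density] with x hx
  have hb := re_dotProduct_bound (M.posSemidef x) (Pi.single j 1) (f x)
  have hs : star (Pi.single j 1 : Fin n → ℂ) = Pi.single j 1 := by
    rw [← Pi.single_star, star_one]
  have hd : (M.density x j j).re ≤ 1 := by
    have h1 : (M.density x j j).re ≤ ∑ k, (M.density x k k).re :=
      Finset.single_le_sum (f := fun k => (M.density x k k).re)
        (fun k _ => (Complex.nonneg_iff.1 ((M.posSemidef x).diag_nonneg (i := k))).1)
        (Finset.mem_univ j)
    have h2 : ∑ k, (M.density x k k).re = 1 := by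
      rw [← Complex.re_sum]
      exact congrArg Complex.re hx
    exact h1.trans h2.le
  have hb' : ‖(M.density x *ᵥ f x) j‖ ≤
      1 + (star (f x) ⬝ᵥ M.density x *ᵥ f x).re := by
    rw [hs, single_one_dotProduct, single_one_dotProduct, Matrix.mulVec_single_one,
      Matrix.col_apply] at hb
    linarith
  have h0 := (M.posSemidef x).re_dotProduct_nonneg (f x)
  rw [norm_mul, Complex.norm_real]
  change _ ≤ ‖φ x‖ + C * (star (f x) ⬝ᵥ M.density x *ᵥ f x).re
  calc ‖φ x‖ * ‖(M.density x *ᵥ f x) j‖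
      ≤ ‖φ x‖ * (1 + (star (f x) ⬝ᵥ M.density x *ᵥ f x).re) :=
        mul_le_mul_of_nonneg_left hb' (norm_nonneg _)
    _ = ‖φ x‖ + ‖φ x‖ * (star (f x) ⬝ᵥ M.density x *ᵥ f x).re := by ring
    _ ≤ _ := by
        have := mul_le_mul_of_nonneg_right (hC x) h0
        simpa using this

theorem derivDist_add {u v : ℝ → Fin n → ℂ} (hu : u ∈ balancedBV Ω n) (hv : v ∈ balancedBV Ω n)
    (φ : 𝓓(Ω, ℝ)) : derivDist (u + v) φ = derivDist u φ + derivDist v φ := by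
  funext j
  simp only [derivDist, Pi.add_apply, mul_add]
  rw [integral_add (integrable_deriv_mul hu φ j) (integrable_deriv_mul hv φ j), neg_add]

theorem derivDist_smul (c : ℂ) (u : ℝ → Fin n → ℂ) (φ : 𝓓(Ω, ℝ)) :
    derivDist (c • u) φ = c • derivDist u φ := by
  funext j
  simp only [derivDist, Pi.smul_apply, smul_eq_mul, mul_left_comm _ c]
  rw [integral_const_mul, mul_neg]

theorem mulDist_add (q : Matrix (Fin n) (Fin n) 𝓓'^{0}(Ω, ℂ)) {u v : ℝ → Fin n → ℂ}
    (hu : u ∈ balancedBV Ω n) (hv : v ∈ balancedBV Ω n) (φ : 𝓓(Ω, ℝ)) :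
    mulDist q (u + v) φ = mulDist q u φ + mulDist q v φ := by
  funext j
  simp only [mulDist, LocalMeasure.integral, Pi.add_apply, mul_add, add_mul]
  rw [← Finset.sum_add_distrib]
  exact Finset.sum_congr rfl fun k _ =>
    integral_add (integrable_mul_phase hu φ _ k) (integrable_mul_phase hv φ _ k)

theorem mulDist_smul (q : Matrix (Fin n) (Fin n) 𝓓'^{0}(Ω, ℂ)) (c : ℂ) (u : ℝ → Fin n → ℂ)
    (φ : 𝓓(Ω, ℝ)) : mulDist q (c • u) φ = c • mulDist q u φ := by
  funext j
  simp only [mulDist, LocalMeasure.integral, Pi.smul_apply, smul_eq_mul, Finset.mul_sum,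
    mul_left_comm _ c, mul_assoc]
  exact Finset.sum_congr rfl fun k _ => integral_const_mul c _

theorem weightDist_add (w : Matrix (Fin n) (Fin n) 𝓓'^{0}(Ω, ℂ)) {f g : ℝ → Fin n → ℂ}
    (hf : (toMatrixMeasure w).IsSqIntegrable f) (hg : (toMatrixMeasure w).IsSqIntegrable g)
    (φ : 𝓓(Ω, ℝ)) : weightDist w (f + g) φ = weightDist w f φ + weightDist w g φ := by
  funext j
  simp only [weightDist, Pi.add_apply, Matrix.mulVec_add, mul_add]
  exact integral_add (integrable_mul_density _ hf φ j) (integrable_mul_density _ hg φ j)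

theorem weightDist_smul (w : Matrix (Fin n) (Fin n) 𝓓'^{0}(Ω, ℂ)) (c : ℂ) (f : ℝ → Fin n → ℂ)
    (φ : 𝓓(Ω, ℝ)) : weightDist w (c • f) φ = c • weightDist w f φ := by
  funext j
  simp only [weightDist, Pi.smul_apply, Matrix.mulVec_smul, smul_eq_mul, mul_left_comm _ c]
  exact integral_const_mul c _

theorem derivDist_zero (φ : 𝓓(Ω, ℝ)) : derivDist (0 : ℝ → Fin n → ℂ) φ = 0 := by
  simpa using derivDist_smul 0 (0 : ℝ → Fin n → ℂ) φ

theorem mulDist_zero (q : Matrix (Fin n) (Fin n) 𝓓'^{0}(Ω, ℂ)) (φ : 𝓓(Ω, ℝ)) :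
    mulDist q 0 φ = 0 := by
  simpa using mulDist_smul q 0 (0 : ℝ → Fin n → ℂ) φ

theorem weightDist_zero (w : Matrix (Fin n) (Fin n) 𝓓'^{0}(Ω, ℂ)) (φ : 𝓓(Ω, ℝ)) :
    weightDist w 0 φ = 0 := by
  simpa using weightDist_smul w 0 (0 : ℝ → Fin n → ℂ) φ

/-- The space `𝓛₀` of all `u ∈ BV_loc^#(Ω)^n` with `J u' + q u = 0` and `w u = 0`. -/
def nullSolutions (J : Matrix (Fin n) (Fin n) ℂ) (q w : Matrix (Fin n) (Fin n) 𝓓'^{0}(Ω, ℂ)) :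
    Submodule ℂ (ℝ → Fin n → ℂ) where
  carrier := {u | u ∈ balancedBV Ω n ∧
    (∀ φ : 𝓓(Ω, ℝ), J *ᵥ derivDist u φ + mulDist q u φ = 0) ∧
    ∀ φ : 𝓓(Ω, ℝ), mulDist w u φ = 0}
  add_mem' := by
    rintro u v ⟨hu, hu1, hu2⟩ ⟨hv, hv1, hv2⟩
    refine ⟨add_mem hu hv, fun φ => ?_, fun φ => ?_⟩
    · rw [derivDist_add hu hv, mulDist_add q hu hv, Matrix.mulVec_add, add_add_add_comm, hu1, hv1,
        add_zero]
    · rw [mulDist_add w hu hv, hu2, hv2, add_zero]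
  zero_mem' := ⟨zero_mem _, fun φ => by rw [derivDist_zero, mulDist_zero]; simp,
    fun φ => mulDist_zero w φ⟩
  smul_mem' := by
    rintro c u ⟨hu, hu1, hu2⟩
    refine ⟨Submodule.smul_mem _ c hu, fun φ => ?_, fun φ => ?_⟩
    · rw [derivDist_smul, mulDist_smul, Matrix.mulVec_smul, ← smul_add, hu1, smul_zero]
    · rw [mulDist_smul, hu2, smul_zero]

/-- The maximal relation `T_max`: all pairs of classes `([u], [f])` of elements of `𝓛²(w)` such
that `u ∈ BV_loc^#(Ω)^n` and `J u' + q u = w f` in the sense of distributions. -/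
def maxRelation (J : Matrix (Fin n) (Fin n) ℂ) (q w : Matrix (Fin n) (Fin n) 𝓓'^{0}(Ω, ℂ)) :
    Submodule ℂ (LTwo w × LTwo w) where
  carrier := {p | ∃ u f : PreLTwo w, u.1 ∈ balancedBV Ω n ∧
    (∀ φ : 𝓓(Ω, ℝ), J *ᵥ derivDist u.1 φ + mulDist q u.1 φ = weightDist w f.1 φ) ∧
    p = (SeparationQuotient.mk u, SeparationQuotient.mk f)}
  add_mem' := by
    rintro _ _ ⟨u, f, hu, he, rfl⟩ ⟨v, g, hv, he', rfl⟩
    refine ⟨u + v, f + g, add_mem hu hv, fun φ => ?_, rfl⟩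
    change J *ᵥ derivDist (u.1 + v.1) φ + mulDist q (u.1 + v.1) φ = weightDist w (f.1 + g.1) φ
    rw [derivDist_add hu hv, mulDist_add q hu hv, Matrix.mulVec_add, add_add_add_comm, he, he',
      weightDist_add w f.2 g.2]
  zero_mem' := by
    refine ⟨0, 0, zero_mem _, fun φ => ?_, rfl⟩
    change J *ᵥ derivDist 0 φ + mulDist q 0 φ = weightDist w 0 φ
    rw [derivDist_zero, mulDist_zero, weightDist_zero]
    simp
  smul_mem' := by
    rintro c _ ⟨u, f, hu, he, rfl⟩
    refine ⟨c • u, c • f, Submodule.smul_mem _ c hu, fun φ => ?_, rfl⟩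
    change J *ᵥ derivDist (c • u.1) φ + mulDist q (c • u.1) φ = weightDist w (c • f.1) φ
    rw [derivDist_smul, mulDist_smul, weightDist_smul, Matrix.mulVec_smul, ← smul_add, he]

/-- The deficiency space `D_z = {([u], z[u]) ∈ T_max}`. -/
def deficiencySpace (J : Matrix (Fin n) (Fin n) ℂ)
    (q w : Matrix (Fin n) (Fin n) 𝓓'^{0}(Ω, ℂ)) (z : ℂ) : Submodule ℂ (LTwo w × LTwo w) :=
  maxRelation J q w ⊓ LinearMap.graph (z • (LinearMap.id : LTwo w →ₗ[ℂ] LTwo w))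

/-- The dimension of `D_z`; the deficiency indices `n_±` are its values at `z = ±i`. -/
def deficiencyIndex (J : Matrix (Fin n) (Fin n) ℂ)
    (q w : Matrix (Fin n) (Fin n) 𝓓'^{0}(Ω, ℂ)) (z : ℂ) : Cardinal :=
  Module.rank ℂ (deficiencySpace J q w z)

end

end FirstOrderSystem

/-! Let `u` be a nonzero element of `𝓛₀`. The whole theorem follows once every pair `(0, [f])` is
known to lie in `T_max`. Indeed, for `([v], [f])` in `T_max` one subtracts `(0, [f] - i[v])` and
obtains `([v], i[v])`, which vanishes because the deficiency space at `i` is trivial; so `T_max =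
{0} × L²(w)`, and this relation is its own adjoint.

To place `(0, [f])` in `T_max` one needs a solution `p` of `J p' + q p = w f` with `w p = 0`. It is
found by reduction of order along `u`. Invertibility of `2J ± Δ_q` makes `u` and its one-sided
limits vanish nowhere (`IsHomogeneousSolution.ne_zero`, `right_ne_zero`, `left_ne_zero`). Since `W`
is real and Hermitian it is symmetric, so `Wu = 0` gives `uᵀ W f = 0`. In dimension two, with `J`
skew-symmetric, this says that `W f` is pointwise a multiple of `J u`. For continuous coefficients
`p = β u` then works, since `J (β u)' + q β u = β' J u`.

Atoms disturb this, because the product of two balanced functions is not balanced: balancing `β u`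
adds a quarter of the product of the jumps, `Δβ Δu / 4`. The kernel condition is what saves the
ansatz. At an atom where `w f ≠ 0` it puts `Δu` into the one-dimensional kernel of `W`, so `Δu = 2κ
u`. The correction is then again along `u`, and it only replaces the jump of `β` by that jump
divided by `1 - κ²`. This number is nonzero since `(1 ± κ) u` are the one-sided limits of `u`. The
construction is `IsHomogeneousSolution.exists_particular`, applied in
`exists_solution_of_nullSolution`.

The measures attached to `q` and `w` are chosen by `Classical.epsilon`, so a Riesz theorem for real
distributions of order zero must first show that they represent `q` and `w` (`toMeasure_spec`,
`toMatrixMeasure_spec`). All of them are then written as densities against one dominating measure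
`ν`. -/

namespace FirstOrderSystem

/-! ### Jordan decomposition of functionals on compactly supported functions -/

section Riesz

open scoped NNReal CompactlySupported

variable {X : Type*} [TopologicalSpace X]

/-- The supremum of `L g` over `0 ≤ g ≤ f`: the positive part of the functional `L`. -/
noncomputable def supBelow (L : C_c(X, ℝ≥0) →ₗ[ℝ≥0] ℝ) (f : C_c(X, ℝ≥0)) : ℝ :=
  sSup (L '' Iic f)

theorem nonneg_supBelow {L : C_c(X, ℝ≥0) →ₗ[ℝ≥0] ℝ} (hL : ∀ f, BddAbove (L '' Iic f))
    (f : C_c(X, ℝ≥0)) : 0 ≤ supBelow L f :=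
  le_csSup (hL f) ⟨0, fun _ => zero_le, map_zero L⟩

theorem le_supBelow {L : C_c(X, ℝ≥0) →ₗ[ℝ≥0] ℝ} (hL : ∀ f, BddAbove (L '' Iic f))
    {f g : C_c(X, ℝ≥0)} (h : g ≤ f) : L g ≤ supBelow L f :=
  le_csSup (hL f) ⟨g, h, rfl⟩

theorem supBelow_le {L : C_c(X, ℝ≥0) →ₗ[ℝ≥0] ℝ} {f : C_c(X, ℝ≥0)} {C : ℝ}
    (h : ∀ g ≤ f, L g ≤ C) : supBelow L f ≤ C :=
  csSup_le ⟨_, mem_image_of_mem _ (mem_Iic.2 le_rfl)⟩ (by rintro _ ⟨g, hg, rfl⟩; exact h g hg)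

/-- The Riesz decomposition property: a function `g ≤ f₁ + f₂` splits as `g ⊓ f₁` plus a remainder,
and the remainder is at most `f₂`. -/
theorem supBelow_add {L : C_c(X, ℝ≥0) →ₗ[ℝ≥0] ℝ} (hL : ∀ f, BddAbove (L '' Iic f))
    (f₁ f₂ : C_c(X, ℝ≥0)) : supBelow L (f₁ + f₂) = supBelow L f₁ + supBelow L f₂ := by
  apply le_antisymm
  · refine supBelow_le fun g hg => ?_
    obtain ⟨h, hh⟩ := CompactlySupportedContinuousMap.exists_add_of_le (inf_le_left : g ⊓ f₁ ≤ g)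
    have h2 : h ≤ f₂ := by
      intro x
      have e : g x ⊓ f₁ x + h x = g x := congrArg (fun k => k x) hh
      have e2 : g x ≤ f₁ x + f₂ x := hg x
      rcases le_total (g x) (f₁ x) with h3 | h3
      · rw [inf_eq_left.2 h3] at e
        have : h x = 0 := by simpa using e
        change h x ≤ f₂ x
        simp [this]
      · rw [inf_eq_right.2 h3] at e
        rw [← e] at e2
        exact le_of_add_le_add_left e2
    rw [← hh, map_add]
    exact add_le_add (le_supBelow hL inf_le_right) (le_supBelow hL h2)
  · rw [← le_sub_iff_add_le]
    refine supBelow_le fun g₁ h₁ => ?_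
    rw [le_sub_comm]
    refine supBelow_le fun g₂ h₂ => ?_
    rw [le_sub_iff_add_le, add_comm, ← map_add]
    exact le_supBelow hL (add_le_add h₁ h₂)

/-- Scaling maps `Iic f` into `Iic (c • f)`, which gives one inequality; the same inequality for
`c⁻¹` gives the other. -/
theorem supBelow_smul {L : C_c(X, ℝ≥0) →ₗ[ℝ≥0] ℝ} (hL : ∀ f, BddAbove (L '' Iic f))
    (c : ℝ≥0) (f : C_c(X, ℝ≥0)) : supBelow L (c • f) = c * supBelow L f := by
  have key : ∀ (c : ℝ≥0) (f : C_c(X, ℝ≥0)), c ≠ 0 → (c : ℝ) * supBelow L f ≤ supBelow L (c • f) := by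
    intro c f hc
    have hc' : (0 : ℝ) < c := by positivity
    rw [← le_div_iff₀' hc']
    refine supBelow_le fun g hg => ?_
    rw [le_div_iff₀' hc']
    have : L (c • g) = c * L g := by rw [map_smul]; rfl
    rw [← this]
    exact le_supBelow hL fun x => mul_le_mul_right (hg x) c
  rcases eq_or_ne c 0 with rfl | hc
  · simp only [zero_smul, NNReal.coe_zero, zero_mul]
    refine le_antisymm (supBelow_le fun g hg => ?_) (nonneg_supBelow hL 0)
    have : g = 0 := by
      ext x
      simpa using hg x
    simp [this]
  · refine le_antisymm ?_ (key c f hc)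
    have h := key c⁻¹ (c • f) (inv_ne_zero hc)
    rw [smul_smul, inv_mul_cancel₀ hc, one_smul, NNReal.coe_inv,
      inv_mul_le_iff₀ (by positivity)] at h
    exact h

/-- The positive part `P` and the difference `N = P - L` are both positive functionals, so the
Riesz–Markov–Kakutani theorem represents each by a measure. -/
theorem exists_eq_integral_sub_integral [T2Space X] [LocallyCompactSpace X] [MeasurableSpace X]
    [BorelSpace X] (L : C_c(X, ℝ≥0) →ₗ[ℝ≥0] ℝ) (hL : ∀ f, BddAbove (L '' Iic f)) :
    ∃ μ₁ μ₂ : Measure X, μ₁.Regular ∧ μ₂.Regular ∧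
      ∀ f : C_c(X, ℝ≥0), L f = ∫ x, (f x : ℝ) ∂μ₁ - ∫ x, (f x : ℝ) ∂μ₂ := by
  let P : C_c(X, ℝ≥0) →ₗ[ℝ≥0] ℝ≥0 :=
    { toFun := fun f => ⟨supBelow L f, nonneg_supBelow hL f⟩
      map_add' := fun f g => NNReal.eq (supBelow_add hL f g)
      map_smul' := fun c f => NNReal.eq (supBelow_smul hL c f) }
  let N : C_c(X, ℝ≥0) →ₗ[ℝ≥0] ℝ≥0 :=
    { toFun := fun f => ⟨supBelow L f - L f, sub_nonneg.2 (le_supBelow hL le_rfl)⟩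
      map_add' := fun f g => NNReal.eq <| by
        change supBelow L (f + g) - L (f + g) = (supBelow L f - L f) + (supBelow L g - L g)
        rw [supBelow_add hL, map_add]
        ring
      map_smul' := fun c f => NNReal.eq <| by
        change supBelow L (c • f) - L (c • f) = c * (supBelow L f - L f)
        rw [supBelow_smul hL, map_smul, mul_sub]
        rfl }
  refine ⟨NNRealRMK.rieszMeasure P, NNRealRMK.rieszMeasure N, inferInstance, inferInstance, fun f => ?_⟩
  rw [NNRealRMK.integral_rieszMeasure, NNRealRMK.integral_rieszMeasure]
  change L f = supBelow L f - (supBelow L f - L f)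
  ring

end Riesz

/-! ### Real distributions of order zero as local measures -/

section Distributions

open scoped NNReal CompactlySupported

variable {Ω : Opens ℝ}

/-- Order zero means that on functions supported in `K` the distribution is continuous for the
supremum norm. -/
theorem exists_bound_of_compacts (T : 𝓓'^{0}(Ω, ℂ)) (K : Compacts ℝ) (hK : (K : Set ℝ) ⊆ Ω) :
    ∃ C : ℝ, 0 ≤ C ∧ ∀ φ : 𝓓^{0}(Ω, ℝ), tsupport φ ⊆ K → ∀ B : ℝ, (∀ x, |φ x| ≤ B) →
      ‖T φ‖ ≤ C * B := by
  let S : 𝓓^{0}_{K}(ℝ, ℝ) →L[ℝ] ℂ := T.comp (TestFunction.ofSupportedInCLM ℝ hK)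
  let p : Seminorm ℝ 𝓓^{0}_{K}(ℝ, ℝ) := (normSeminorm ℝ ℂ).comp S.toLinearMap
  have hp : Continuous p := by
    change Continuous fun x => ‖S x‖
    exact S.continuous.norm
  obtain ⟨s, C, -, h⟩ := Seminorm.bound_of_continuous
    (ContDiffMapSupportedIn.withSeminorms ℝ ℝ ℝ 0 K) p hp
  refine ⟨C, C.2, fun φ hφ B hB => ?_⟩
  have hB0 : 0 ≤ B := (abs_nonneg _).trans (hB 0)
  let ψ : 𝓓^{0}_{K}(ℝ, ℝ) := ContDiffMapSupportedIn.of_support_subset (f := φ) φ.contDiff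
    ((subset_tsupport _).trans hφ)
  have hψ : T φ = S ψ := by
    change T φ = T _
    congr 1
  have h1 := h ψ
  -- Only derivatives of order `i ≤ 0` contribute, so every seminorm in the finite supremum is
  -- bounded by the sup norm.
  have h2 : (s.sup (ContDiffMapSupportedIn.seminorm ℝ ℝ ℝ 0 K)) ψ ≤ B := by
    refine Seminorm.finset_sup_apply_le hB0 fun i _ => ?_
    rw [ContDiffMapSupportedIn.seminorm_le_iff ℝ hB0]
    intro hi x _
    have hi0 : i = 0 := by simpa using hi
    subst hi0
    rw [norm_iteratedFDeriv_zero]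
    exact hB x
  rw [hψ]
  refine h1.trans ?_
  exact mul_le_mul_of_nonneg_left h2 C.2

/-- A compactly supported continuous function on `Ω`, extended by zero. -/
noncomputable def extendZero (f : C_c(Ω, ℝ≥0)) : 𝓓^{0}(Ω, ℝ) where
  toFun := Function.extend Subtype.val (fun x => (f x : ℝ)) 0
  contDiff' := by
    have h : HasCompactSupport fun x => (f x : ℝ) := f.hasCompactSupport.comp_left rfl
    refine contDiff_zero.2 ?_
    exact h.continuous_extend_zero Ω.isOpen (NNReal.continuous_coe.comp f.continuous)
  hasCompactSupport' := by
    have h : HasCompactSupport fun x => (f x : ℝ) := f.hasCompactSupport.comp_left rfl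
    exact h.extend_zero continuous_subtype_val
  tsupport_subset' := by
    have h : HasCompactSupport fun x => (f x : ℝ) := f.hasCompactSupport.comp_left rfl
    exact (h.tsupport_extend_zero_subset continuous_subtype_val).trans
      (Subtype.coe_image_subset _ _)

theorem extendZero_coe (f : C_c(Ω, ℝ≥0)) (x : Ω) : extendZero f x = f x :=
  Subtype.val_injective.extend_apply (fun x : Ω => (f x : ℝ)) 0 x

theorem extendZero_of_notMem (f : C_c(Ω, ℝ≥0)) {x : ℝ} (hx : x ∉ Ω) : extendZero f x = 0 :=
  Function.extend_apply' (f := (Subtype.val : Ω → ℝ)) (fun x : Ω => (f x : ℝ)) 0 x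
    (by rintro ⟨y, rfl⟩; exact hx y.2)

theorem testFunction_eq_zero {k : ℕ∞} (φ : 𝓓^{k}(Ω, ℝ)) {x : ℝ} (hx : x ∉ Ω) : φ x = 0 := by
  by_contra h
  exact hx (φ.tsupport_subset (subset_tsupport _ h))

theorem extendZero_add (f g : C_c(Ω, ℝ≥0)) :
    extendZero (f + g) = extendZero f + extendZero g := by
  ext x
  change extendZero (f + g) x = extendZero f x + extendZero g x
  by_cases hx : x ∈ Ω
  · have h1 := extendZero_coe f ⟨x, hx⟩
    have h2 := extendZero_coe g ⟨x, hx⟩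
    have h3 := extendZero_coe (f + g) ⟨x, hx⟩
    simp only at h1 h2 h3
    rw [h1, h2, h3]
    rfl
  · rw [extendZero_of_notMem _ hx, extendZero_of_notMem _ hx, extendZero_of_notMem _ hx,
      add_zero]

theorem extendZero_smul (c : ℝ≥0) (f : C_c(Ω, ℝ≥0)) :
    extendZero (c • f) = (c : ℝ) • extendZero f := by
  ext x
  change extendZero (c • f) x = (c : ℝ) * extendZero f x
  by_cases hx : x ∈ Ω
  · have h1 := extendZero_coe f ⟨x, hx⟩
    have h3 := extendZero_coe (c • f) ⟨x, hx⟩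
    simp only at h1 h3
    rw [h1, h3]
    rfl
  · rw [extendZero_of_notMem _ hx, extendZero_of_notMem _ hx, mul_zero]

theorem extendZero_nonneg (f : C_c(Ω, ℝ≥0)) (x : ℝ) : 0 ≤ extendZero f x := by
  by_cases hx : x ∈ Ω
  · have h1 := extendZero_coe f ⟨x, hx⟩
    simp only at h1
    rw [h1]
    exact NNReal.coe_nonneg _
  · rw [extendZero_of_notMem _ hx]

/-- The functional induced by the real part of `T` on the non-negative functions. -/
noncomputable def reFunctional (T : 𝓓'^{0}(Ω, ℂ)) : C_c(Ω, ℝ≥0) →ₗ[ℝ≥0] ℝ where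
  toFun f := (T (extendZero f)).re
  map_add' f g := by rw [extendZero_add, map_add, Complex.add_re]
  map_smul' c f := by
    rw [extendZero_smul, map_smul, Complex.smul_re]
    rfl

/-- All `g ≤ f` are supported in the support of `f` and bounded by the maximum of `f`, so one
compact set and one constant serve for all of them. -/
theorem bddAbove_reFunctional (T : 𝓓'^{0}(Ω, ℂ)) (f : C_c(Ω, ℝ≥0)) :
    BddAbove (reFunctional T '' Iic f) := by
  have hf : HasCompactSupport fun x => (f x : ℝ) := f.hasCompactSupport.comp_left rfl
  let K : Compacts ℝ := ⟨tsupport (extendZero f), (extendZero f).hasCompactSupport⟩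
  obtain ⟨C, -, h⟩ := exists_bound_of_compacts T K (extendZero f).tsupport_subset
  obtain ⟨B, hB⟩ := (extendZero f).continuous.bounded_above_of_compact_support
    (extendZero f).hasCompactSupport
  have hle : ∀ g ≤ f, ∀ x, 0 ≤ extendZero g x ∧ extendZero g x ≤ extendZero f x := by
    intro g hg x
    by_cases hx : x ∈ Ω
    · have h1 := extendZero_coe f ⟨x, hx⟩
      have h2 := extendZero_coe g ⟨x, hx⟩
      simp only at h1 h2
      rw [h1, h2]
      exact ⟨NNReal.coe_nonneg _, NNReal.coe_le_coe.2 (hg _)⟩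
    · rw [extendZero_of_notMem _ hx, extendZero_of_notMem _ hx]
      exact ⟨le_rfl, le_rfl⟩
  refine ⟨C * B, ?_⟩
  rintro _ ⟨g, hg, rfl⟩
  refine (Complex.re_le_norm _).trans (h _ ?_ B fun x => ?_)
  · refine closure_mono fun x hx => ?_
    have h1 := hle g hg x
    intro h2
    rw [h2] at h1
    exact hx (le_antisymm h1.2 h1.1)
  · rw [abs_of_nonneg (hle g hg x).1]
    exact (hle g hg x).2.trans ((le_abs_self _).trans (hB x))

/-- A measure on `Ω` that is finite on the compact subsets of `Ω`. -/
def LocFin (Ω : Opens ℝ) (μ : Measure ℝ) : Prop :=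
  (∀ K : Set ℝ, IsCompact K → K ⊆ (Ω : Set ℝ) → μ K < ⊤) ∧ μ (Ω : Set ℝ)ᶜ = 0

theorem LocFin.add {μ₁ μ₂ : Measure ℝ} (h₁ : LocFin Ω μ₁) (h₂ : LocFin Ω μ₂) :
    LocFin Ω (μ₁ + μ₂) :=
  ⟨fun K hK hs => by
    rw [Measure.add_apply]
    exact ENNReal.add_lt_top.2 ⟨h₁.1 K hK hs, h₂.1 K hK hs⟩, by
    rw [Measure.add_apply, h₁.2, h₂.2, add_zero]⟩

theorem LocFin.sum {ι : Type*} (s : Finset ι) {μ : ι → Measure ℝ} (h : ∀ i, LocFin Ω (μ i)) :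
    LocFin Ω (∑ i ∈ s, μ i) := by
  classical
  induction s using Finset.induction_on with
  | empty => exact ⟨by simp, by simp⟩
  | insert i s hi ih => rw [Finset.sum_insert hi]; exact (h i).add ih

theorem locallyCompactSpace_opens (Ω : Opens ℝ) : LocallyCompactSpace Ω :=
  Ω.isOpen.locallyCompactSpace

theorem isCompact_preimage_val {K : Set ℝ} (hK : IsCompact K) (hs : K ⊆ (Ω : Set ℝ)) :
    IsCompact ((Subtype.val : Ω → ℝ) ⁻¹' K) := by
  refine Topology.IsInducing.subtypeVal.isCompact_iff.2 ?_
  have h : (Subtype.val : Ω → ℝ) '' ((Subtype.val : Ω → ℝ) ⁻¹' K) = K :=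
    image_preimage_eq_of_subset fun x hx => ⟨⟨x, hs hx⟩, rfl⟩
  exact Eq.mpr (congrArg IsCompact h) hK

theorem LocFin.sigmaFinite {μ : Measure ℝ} (h : LocFin Ω μ) : SigmaFinite μ := by
  have := Ω.isOpen.locallyCompactSpace
  have hS : IsSigmaCompact (Ω : Set ℝ) := isSigmaCompact_iff_sigmaCompactSpace.2 inferInstance
  obtain ⟨K, hK, hU⟩ := hS
  refine ⟨⟨⟨fun n => K n ∪ (Ω : Set ℝ)ᶜ, fun _ => trivial, fun n => ?_, ?_⟩⟩⟩
  · refine (measure_union_le _ _).trans_lt ?_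
    rw [h.2, add_zero]
    exact h.1 _ (hK n) (hU ▸ subset_iUnion K n)
  · rw [← iUnion_union, hU, union_compl_self]

theorem LocFin.locallyIntegrableOn {μ : Measure ℝ} (_h : LocFin Ω μ) {E : Type*}
    [NormedAddCommGroup E] {g : ℝ → E}
    (hg : ∀ K : Set ℝ, IsCompact K → K ⊆ (Ω : Set ℝ) → IntegrableOn g K μ) :
    LocallyIntegrableOn g Ω μ :=
  (locallyIntegrableOn_iff Ω.isOpen.isLocallyClosed).2 fun K hs hK => hg K hK hs

/-- The real density of `σ` with respect to `ν`. -/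
noncomputable def dens (σ ν : Measure ℝ) (x : ℝ) : ℝ := (σ.rnDeriv ν x).toReal

theorem dens_nonneg (σ ν : Measure ℝ) (x : ℝ) : 0 ≤ dens σ ν x := ENNReal.toReal_nonneg

theorem measurable_dens (σ ν : Measure ℝ) : Measurable (dens σ ν) :=
  (Measure.measurable_rnDeriv σ ν).ennreal_toReal

theorem LocFin.locallyIntegrableOn_dens {σ ν : Measure ℝ} (hσ : LocFin Ω σ) (hν : LocFin Ω ν) :
    LocallyIntegrableOn (dens σ ν) Ω ν := by
  refine hν.locallyIntegrableOn fun K hK hs => ?_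
  refine integrable_toReal_of_lintegral_ne_top (Measure.measurable_rnDeriv σ ν).aemeasurable ?_
  exact ((Measure.setLIntegral_rnDeriv_le K).trans_lt (hσ.1 K hK hs)).ne

theorem locallyIntegrableOn_ofReal {ν : Measure ℝ} {g : ℝ → ℝ} {s : Set ℝ}
    (h : LocallyIntegrableOn g s ν) : LocallyIntegrableOn (fun x => (g x : ℂ)) s ν := by
  intro x hx
  obtain ⟨t, ht, hi⟩ := h x hx
  exact ⟨t, ht, hi.ofReal⟩

/-- No integrability of `f` is needed. This is the tool that moves every integral to a common
dominating measure. -/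
theorem integral_dens_mul {σ ν : Measure ℝ} (hσ : LocFin Ω σ) (hν : LocFin Ω ν) (h : σ ≪ ν)
    (f : ℝ → ℂ) : ∫ x, f x * (dens σ ν x : ℂ) ∂ν = ∫ x, f x ∂σ := by
  have := hσ.sigmaFinite
  have := hν.sigmaFinite
  rw [← integral_rnDeriv_smul h]
  refine integral_congr_ae (Eventually.of_forall fun x => ?_)
  change f x * (dens σ ν x : ℂ) = (dens σ ν x) • f x
  rw [Complex.real_smul, mul_comm]

theorem LocFin.locallyIntegrableOn_mul_dens {σ ν : Measure ℝ} (hσ : LocFin Ω σ)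
    (hν : LocFin Ω ν) (h : σ ≪ ν) {f : ℝ → ℂ} (hf : LocallyIntegrableOn f Ω σ) :
    LocallyIntegrableOn (fun x => f x * (dens σ ν x : ℂ)) Ω ν := by
  have := hσ.sigmaFinite
  have := hν.sigmaFinite
  refine hν.locallyIntegrableOn fun K hK hs => ?_
  have h1 := (integrable_indicator_iff hK.measurableSet).2 (hf.integrableOn_compact_subset hs hK)
  rw [← integrable_rnDeriv_smul_iff h] at h1
  rw [← integrable_indicator_iff hK.measurableSet]
  refine h1.congr (Eventually.of_forall fun x => ?_)
  by_cases hx : x ∈ K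
  · simp only [indicator_of_mem hx, Complex.real_smul, mul_comm (f x)]
    rfl
  · simp only [indicator_of_notMem hx, smul_zero]

theorem integrable_testFunction_mul {k : ℕ∞} {ν : Measure ℝ} {h : ℝ → ℂ}
    (hh : LocallyIntegrableOn h Ω ν) (φ : 𝓓^{k}(Ω, ℝ)) :
    Integrable (fun x => (φ x : ℂ) * h x) ν := by
  have h1 := hh.integrableOn_compact_subset φ.tsupport_subset φ.hasCompactSupport
  obtain ⟨C, hC⟩ := φ.continuous.bounded_above_of_compact_support φ.hasCompactSupport
  rw [← integrableOn_iff_integrable_of_support_subset (s := tsupport φ)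
    (fun x hx => subset_tsupport φ (fun h0 => hx (by simp [h0])))]
  exact h1.bdd_mul (c := C) (Complex.continuous_ofReal.comp φ.continuous).aestronglyMeasurable
    (Eventually.of_forall fun x => by simpa using hC x)

theorem LocFin.locallyIntegrableOn_const {μ : Measure ℝ} (h : LocFin Ω μ) (c : ℂ) :
    LocallyIntegrableOn (fun _ => c) Ω μ :=
  h.locallyIntegrableOn fun K hK hs => integrableOn_const (h.1 K hK hs).ne

theorem LocFin.map_val {μ : Measure Ω} [IsFiniteMeasureOnCompacts μ] :
    LocFin Ω (μ.map Subtype.val) := by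
  refine ⟨fun K hK hs => ?_, ?_⟩
  · rw [Measure.map_apply measurable_subtype_coe hK.measurableSet]
    exact (isCompact_preimage_val hK hs).measure_lt_top
  · rw [Measure.map_apply measurable_subtype_coe Ω.isOpen.measurableSet.compl,
      show ((Subtype.val : Ω → ℝ) ⁻¹' (Ω : Set ℝ)ᶜ) = ∅ from
        eq_empty_of_forall_notMem fun x hx => hx x.2]
    exact measure_empty

theorem exists_eq_extendZero_sub (φ : 𝓓^{0}(Ω, ℝ)) :
    ∃ f g : C_c(Ω, ℝ≥0), φ = extendZero f - extendZero g := by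
  have part : ∀ s : ℝ, ∃ f : C_c(Ω, ℝ≥0), ∀ x : Ω, f x = (s * φ x).toNNReal := by
    intro s
    refine ⟨⟨⟨fun x => (s * φ x).toNNReal, ?_⟩, ?_⟩, fun x => rfl⟩
    · exact continuous_real_toNNReal.comp
        (continuous_const.mul (φ.continuous.comp continuous_subtype_val))
    · refine HasCompactSupport.of_support_subset_isCompact
        (K := Subtype.val ⁻¹' (tsupport φ))
        (isCompact_preimage_val φ.hasCompactSupport φ.tsupport_subset) ?_
      · intro x hx
        refine subset_tsupport φ fun h0 => hx ?_
        change (s * φ x).toNNReal = 0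
        rw [h0]
        simp
  obtain ⟨f, hf⟩ := part 1
  obtain ⟨g, hg⟩ := part (-1)
  refine ⟨f, g, ?_⟩
  ext x
  change φ x = extendZero f x - extendZero g x
  by_cases hx : x ∈ Ω
  · have h1 := extendZero_coe f ⟨x, hx⟩
    have h2 := extendZero_coe g ⟨x, hx⟩
    simp only at h1 h2
    rw [h1, h2, hf, hg]
    simp only [one_mul, neg_mul, Real.coe_toNNReal']
    rcases le_total 0 (φ x) with h0 | h0
    · rw [max_eq_left h0, max_eq_right (by linarith), sub_zero]
    · rw [max_eq_right h0, max_eq_left (by linarith)]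
      ring
  · rw [extendZero_of_notMem _ hx, extendZero_of_notMem _ hx, sub_zero,
      testFunction_eq_zero φ hx]

/-- Riesz's theorem is applied on the locally compact space `Ω`, and the two measures are pushed
forward to `ℝ`. Splitting a test function into positive and negative parts extends the formula from
non-negative functions. -/
theorem exists_eq_integral_sub_of_isReal (T : 𝓓'^{0}(Ω, ℂ)) (hT : ∀ φ, conj (T φ) = T φ) :
    ∃ μ₁ μ₂ : Measure ℝ, LocFin Ω μ₁ ∧ LocFin Ω μ₂ ∧
      ∀ φ : 𝓓^{0}(Ω, ℝ), T φ = ∫ x, (φ x : ℂ) ∂μ₁ - ∫ x, (φ x : ℂ) ∂μ₂ := by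
  have := locallyCompactSpace_opens Ω
  obtain ⟨μ₁, μ₂, h₁, h₂, h⟩ :=
    exists_eq_integral_sub_integral (reFunctional T) (bddAbove_reFunctional T)
  have key : ∀ f : C_c(Ω, ℝ≥0), T (extendZero f) =
      ∫ x, (extendZero f x : ℂ) ∂(μ₁.map Subtype.val) -
        ∫ x, (extendZero f x : ℂ) ∂(μ₂.map Subtype.val) := by
    intro f
    have hm : ∀ μ : Measure Ω, ∫ x, (extendZero f x : ℂ) ∂(μ.map Subtype.val) =
        ((∫ x, (f x : ℝ) ∂μ : ℝ) : ℂ) := by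
      intro μ
      refine (integral_map measurable_subtype_coe.aemeasurable
        (Complex.continuous_ofReal.comp (extendZero f).continuous).aestronglyMeasurable).trans ?_
      rw [← integral_complex_ofReal]
      exact integral_congr_ae (Eventually.of_forall fun x => by
        simp only [Function.comp, extendZero_coe])
    rw [hm, hm, ← Complex.ofReal_sub, ← h f]
    exact (Complex.conj_eq_iff_re.1 (hT _)).symm
  refine ⟨μ₁.map Subtype.val, μ₂.map Subtype.val, LocFin.map_val, LocFin.map_val, fun φ => ?_⟩
  obtain ⟨f, g, hφ⟩ := exists_eq_extendZero_sub φ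
  have hint : ∀ (μ : Measure Ω) [IsFiniteMeasureOnCompacts μ],
      ∫ x, (φ x : ℂ) ∂(μ.map Subtype.val) = ∫ x, (extendZero f x : ℂ) ∂(μ.map Subtype.val) -
        ∫ x, (extendZero g x : ℂ) ∂(μ.map Subtype.val) := by
    intro μ _
    have h1 : ∀ ψ : 𝓓^{0}(Ω, ℝ), Integrable (fun x => (ψ x : ℂ)) (μ.map Subtype.val) := by
      intro ψ
      simpa using integrable_testFunction_mul
        ((LocFin.map_val (μ := μ)).locallyIntegrableOn_const 1) ψ
    rw [← integral_sub (h1 _) (h1 _), hφ]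
    refine integral_congr_ae (Eventually.of_forall fun x => ?_)
    exact Complex.ofReal_sub _ _
  rw [hint, hint]
  nth_rewrite 1 [hφ]
  rw [map_sub, key, key]
  ring

/-- The defining property of `toMeasure q`. -/
theorem toMeasure_spec (q : 𝓓'^{0}(Ω, ℂ)) (hq : ∀ φ, conj (q φ) = q φ) (φ : 𝓓^{0}(Ω, ℝ)) :
    q φ = (toMeasure q).integral fun x => (φ x : ℂ) := by
  have hex : ∃ m : LocalMeasure Ω, ∀ φ : 𝓓^{0}(Ω, ℝ), q φ = m.integral fun x => (φ x : ℂ) := by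
    obtain ⟨μ₁, μ₂, h₁, h₂, h⟩ := exists_eq_integral_sub_of_isReal q hq
    have hσ := h₁.add h₂
    have := hσ.sigmaFinite
    -- The signed measure `μ₁ - μ₂` has density `d` with respect to `μ₁ + μ₂`, so `|d|` and the sign
    -- of `d` form its polar decomposition. The phase is set to `1` where `d = 0` because it must
    -- have modulus one everywhere.
    let d : ℝ → ℝ := fun x => dens μ₁ (μ₁ + μ₂) x - dens μ₂ (μ₁ + μ₂) x
    have hd : Measurable d := (measurable_dens _ _).sub (measurable_dens _ _)
    have hdi : LocallyIntegrableOn d Ω (μ₁ + μ₂) :=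
      (h₁.locallyIntegrableOn_dens hσ).sub (h₂.locallyIntegrableOn_dens hσ)
    have hm : Measurable fun x => ENNReal.ofReal |d x| :=
      (measurable_norm.comp hd).ennreal_ofReal
    refine ⟨⟨(μ₁ + μ₂).withDensity fun x => ENNReal.ofReal |d x|, fun x => if d x < 0 then -1 else 1,
      fun K hK hs => ?_, ?_, ?_, fun x => by split_ifs <;> simp⟩, fun φ => ?_⟩
    · rw [withDensity_apply _ hK.measurableSet]
      have := hdi.integrableOn_compact_subset hs hK
      have h3 := this.2
      rw [hasFiniteIntegral_iff_norm] at h3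
      exact h3
    · exact withDensity_absolutelyContinuous _ _ hσ.2
    · exact Measurable.ite (measurableSet_lt hd measurable_const) measurable_const measurable_const
    · change q φ = ∫ x, (φ x : ℂ) * (if d x < 0 then -1 else 1) ∂_
      rw [integral_withDensity_eq_integral_toReal_smul hm
        (Eventually.of_forall fun x => ENNReal.ofReal_lt_top), h,
        ← integral_dens_mul h₁ hσ (Measure.AbsolutelyContinuous.rfl.add_right _),
        ← integral_dens_mul h₂ hσ (add_comm μ₁ μ₂ ▸ Measure.AbsolutelyContinuous.rfl.add_right _),
        ← integral_sub]
      · refine integral_congr_ae (Eventually.of_forall fun x => ?_)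
        simp only [ENNReal.toReal_ofReal (abs_nonneg _), Complex.real_smul]
        rw [← mul_sub, ← Complex.ofReal_sub]
        change (φ x : ℂ) * (d x : ℂ) = _
        split_ifs with h0
        · rw [abs_of_neg h0]
          push_cast
          ring
        · rw [abs_of_nonneg (not_lt.1 h0)]
          ring
      · exact integrable_testFunction_mul
          (locallyIntegrableOn_ofReal (h₁.locallyIntegrableOn_dens hσ)) φ
      · exact integrable_testFunction_mul
          (locallyIntegrableOn_ofReal (h₂.locallyIntegrableOn_dens hσ)) φ
  exact Classical.epsilon_spec hex φ

end Distributions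

end FirstOrderSystem

/-! ### Positivity of densities and the matrix measure of a non-negative distribution -/

namespace FirstOrderSystem

open scoped NNReal CompactlySupported

variable {Ω : Opens ℝ} {n : ℕ}

theorem LocFin.ae_mem {ν : Measure ℝ} (hν : LocFin Ω ν) : ∀ᵐ x ∂ν, x ∈ Ω := hν.2

/-- A test function is in particular a continuous test function. -/
noncomputable def testFunctionToContinuous (φ : 𝓓(Ω, ℝ)) : 𝓓^{0}(Ω, ℝ) :=
  ⟨φ, contDiff_zero.2 φ.continuous, φ.hasCompactSupport, φ.tsupport_subset⟩

/-- The fundamental lemma of the calculus of variations with respect to `ν`; the complement of `Ω`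
is null. -/
theorem LocFin.ae_eq_zero {ν : Measure ℝ} (hν : LocFin Ω ν) {h : ℝ → ℂ}
    (hh : LocallyIntegrableOn h Ω ν) (h0 : ∀ φ : 𝓓(Ω, ℝ), ∫ x, (φ x : ℂ) * h x ∂ν = 0) :
    ∀ᵐ x ∂ν, h x = 0 := by
  have h1 := Ω.isOpen.ae_eq_zero_of_integral_contDiff_smul_eq_zero hh fun g hg hc hs => by
    have := h0 ⟨g, hg, hc, hs⟩
    rw [← this]
    refine integral_congr_ae (Eventually.of_forall fun x => ?_)
    exact Complex.real_smul
  filter_upwards [h1, hν.ae_mem] with x hx hm using hx hm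

/-- The positive functional `φ ↦ ∫ φ r dσ` comes from a positive measure `μ`. Comparing densities
with respect to `σ + μ` shows that `r` times the density of `σ` equals the density of `μ`, and the
density of `σ` is positive `σ`-almost everywhere. -/
theorem LocFin.ae_nonneg {σ : Measure ℝ} (hσ : LocFin Ω σ) {r : ℝ → ℝ}
    (hr : LocallyIntegrableOn r Ω σ)
    (h0 : ∀ φ : 𝓓^{0}(Ω, ℝ), (∀ x, 0 ≤ φ x) → 0 ≤ ∫ x, φ x * r x ∂σ) :
    ∀ᵐ x ∂σ, 0 ≤ r x := by
  have := locallyCompactSpace_opens Ω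
  have hint : ∀ φ : 𝓓^{0}(Ω, ℝ), Integrable (fun x => φ x * r x) σ := by
    intro φ
    have := (integrable_testFunction_mul (locallyIntegrableOn_ofReal hr) φ).re
    refine this.congr (Eventually.of_forall fun x => ?_)
    simp
  let N : C_c(Ω, ℝ≥0) →ₗ[ℝ≥0] ℝ≥0 :=
    { toFun := fun f => ⟨∫ x, extendZero f x * r x ∂σ, h0 _ (extendZero_nonneg f)⟩
      map_add' := fun f g => NNReal.eq <| by
        change ∫ x, extendZero (f + g) x * r x ∂σ =
          ∫ x, extendZero f x * r x ∂σ + ∫ x, extendZero g x * r x ∂σ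
        rw [← integral_add (hint _) (hint _), extendZero_add]
        refine integral_congr_ae (Eventually.of_forall fun x => ?_)
        exact add_mul _ _ _
      map_smul' := fun c f => NNReal.eq <| by
        change ∫ x, extendZero (c • f) x * r x ∂σ = c * ∫ x, extendZero f x * r x ∂σ
        rw [← integral_const_mul, extendZero_smul]
        refine integral_congr_ae (Eventually.of_forall fun x => ?_)
        exact mul_assoc _ _ _ }
  let μ : Measure ℝ := (NNRealRMK.rieszMeasure N).map Subtype.val
  have hμ : LocFin Ω μ := LocFin.map_val
  have hN : ∀ f : C_c(Ω, ℝ≥0), ∫ x, extendZero f x ∂μ = ∫ x, extendZero f x * r x ∂σ := by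
    intro f
    refine (integral_map measurable_subtype_coe.aemeasurable
      (extendZero f).continuous.aestronglyMeasurable).trans ?_
    simp only [extendZero_coe]
    exact NNRealRMK.integral_rieszMeasure N f
  have hφ : ∀ φ : 𝓓(Ω, ℝ), ∫ x, φ x ∂μ = ∫ x, φ x * r x ∂σ := by
    intro φ
    obtain ⟨f, g, hfg⟩ := exists_eq_extendZero_sub (testFunctionToContinuous φ)
    have e : ∀ x, φ x = extendZero f x - extendZero g x := fun x => congrArg (fun k => k x) hfg
    have hi : ∀ ψ : 𝓓^{0}(Ω, ℝ), Integrable (fun x => ψ x) μ := by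
      intro ψ
      simpa using (integrable_testFunction_mul (hμ.locallyIntegrableOn_const 1) ψ).re
    simp only [e, sub_mul]
    rw [integral_sub (hi _) (hi _), integral_sub (hint _) (hint _), hN, hN]
  have hν := hσ.add hμ
  have hσν : σ ≪ σ + μ := Measure.AbsolutelyContinuous.rfl.add_right _
  have hμν : μ ≪ σ + μ := Measure.AbsolutelyContinuous.rfl.add_right' _
  have h1 := hσ.locallyIntegrableOn_mul_dens hν hσν (locallyIntegrableOn_ofReal hr)
  have h2 := locallyIntegrableOn_ofReal (hμ.locallyIntegrableOn_dens hν)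
  have h3 := hν.ae_eq_zero (h1.sub h2) fun φ => by
    have i1 := integrable_testFunction_mul h1 φ
    have i2 := integrable_testFunction_mul h2 φ
    simp only [Pi.sub_apply, mul_sub]
    rw [integral_sub i1 i2, integral_dens_mul hμ hν hμν]
    simp only [← mul_assoc]
    rw [integral_dens_mul hσ hν hσν, sub_eq_zero]
    simp only [← Complex.ofReal_mul, integral_complex_ofReal]
    rw [hφ φ]
  have := hσ.sigmaFinite
  have := hν.sigmaFinite
  filter_upwards [hσν.ae_le h3, Measure.rnDeriv_pos hσν, hσν.ae_le (Measure.rnDeriv_lt_top σ (σ + μ))]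
    with x hx hp ht
  have h4 : r x * dens σ (σ + μ) x = dens μ (σ + μ) x := by
    have : (r x : ℂ) * (dens σ (σ + μ) x : ℂ) = (dens μ (σ + μ) x : ℂ) := sub_eq_zero.1 hx
    exact_mod_cast this
  have h5 : 0 < dens σ (σ + μ) x := ENNReal.toReal_pos hp.ne' ht.ne
  by_contra h6
  have := mul_neg_of_neg_of_pos (not_le.1 h6) h5
  have := dens_nonneg μ (σ + μ) x
  linarith

theorem LocFin.locallyIntegrableOn_mul_of_norm_le {ν : Measure ℝ} (hν : LocFin Ω ν) {f p : ℝ → ℂ}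
    (hf : LocallyIntegrableOn f Ω ν) (hp : Measurable p) {C : ℝ} (hC : ∀ x, ‖p x‖ ≤ C) :
    LocallyIntegrableOn (fun x => f x * p x) Ω ν :=
  hν.locallyIntegrableOn fun _ hK hs => (hf.integrableOn_compact_subset hs hK).mul_bdd (c := C)
    hp.aestronglyMeasurable (Eventually.of_forall hC)

theorem LocalMeasure.locFin (m : LocalMeasure Ω) : LocFin Ω m.variation :=
  ⟨m.finite_of_isCompact, m.null_compl⟩

theorem MatrixMeasure.locFin (M : MatrixMeasure Ω n) : LocFin Ω M.base :=
  ⟨M.finite_of_isCompact, M.null_compl⟩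

/-- The density of a local measure with respect to a positive measure. -/
noncomputable def LocalMeasure.density (m : LocalMeasure Ω) (ν : Measure ℝ) (x : ℝ) : ℂ :=
  m.phase x * (dens m.variation ν x : ℂ)

theorem LocalMeasure.measurable_density (m : LocalMeasure Ω) (ν : Measure ℝ) :
    Measurable (m.density ν) :=
  m.measurable_phase.mul (Complex.measurable_ofReal.comp (measurable_dens _ _))

theorem LocalMeasure.locallyIntegrableOn_density (m : LocalMeasure Ω) {ν : Measure ℝ}
    (hν : LocFin Ω ν) : LocallyIntegrableOn (m.density ν) Ω ν := by
  have h := hν.locallyIntegrableOn_mul_of_norm_le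
    (locallyIntegrableOn_ofReal (m.locFin.locallyIntegrableOn_dens hν)) m.measurable_phase
    (C := 1) fun x => (m.norm_phase x).le
  simp only [mul_comm _ (m.phase _)] at h
  exact h

theorem LocalMeasure.integral_eq (m : LocalMeasure Ω) {ν : Measure ℝ} (hν : LocFin Ω ν)
    (h : m.variation ≪ ν) (g : ℝ → ℂ) : m.integral g = ∫ x, g x * m.density ν x ∂ν := by
  simp only [LocalMeasure.integral, LocalMeasure.density, ← mul_assoc]
  rw [integral_dens_mul m.locFin hν h]

/-- Integrate the indicator of `{x}` in both representations. This turns `jump q x` into `ν {x}`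
times the density matrix. -/
theorem LocalMeasure.density_singleton (m : LocalMeasure Ω) {ν : Measure ℝ} (hν : LocFin Ω ν)
    (h : m.variation ≪ ν) (x : ℝ) :
    (m.variation.real {x} : ℂ) * m.phase x = (ν.real {x} : ℂ) * m.density ν x := by
  have h1 := m.integral_eq hν h (indicator {x} fun _ => 1)
  have e : ∀ f : ℝ → ℂ, (fun y => indicator {x} (fun _ => (1 : ℂ)) y * f y) = indicator {x} f := by
    intro f
    ext y
    by_cases hy : y ∈ ({x} : Set ℝ)
    · simp only [indicator_of_mem hy, one_mul]
    · simp only [indicator_of_notMem hy, zero_mul]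
  rw [LocalMeasure.integral, e, e, integral_indicator (measurableSet_singleton x),
    integral_indicator (measurableSet_singleton x), integral_singleton, integral_singleton,
    Complex.real_smul, Complex.real_smul] at h1
  exact h1

/-- Over `ℂ` a quadratic form with real values already forces the matrix to be Hermitian, by
polarization. -/
theorem posSemidef_of_forall_nonneg {A : Matrix (Fin n) (Fin n) ℂ}
    (h : ∀ c : Fin n → ℂ, 0 ≤ star c ⬝ᵥ A *ᵥ c) : A.PosSemidef := by
  rw [← Matrix.isPositive_toEuclideanLin_iff, LinearMap.isPositive_iff_complex]
  intro x
  have h1 : inner ℂ (A.toEuclideanLin x) x = star (star x.ofLp ⬝ᵥ A *ᵥ x.ofLp) := by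
    rw [EuclideanSpace.inner_eq_star_dotProduct, Matrix.star_dotProduct, star_star,
      dotProduct_comm]
    rfl
  have h2 := h x.ofLp
  rw [Complex.nonneg_iff] at h2
  rw [h1]
  refine ⟨Complex.ext (by simp) ?_, ?_⟩
  · simpa using h2.2.symm
  · simpa using h2.1

/-- All entries have densities `D` with respect to one measure `σ`; non-negativity of `w` makes `D`
positive semidefinite almost everywhere, and dividing by the trace `t` while multiplying `σ` by `t`
produces the required normalization. -/
theorem toMatrixMeasure_spec (w : Matrix (Fin n) (Fin n) 𝓓'^{0}(Ω, ℂ)) (hw : IsNonnegDist w)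
    (hr : IsRealDist w) (j k : Fin n) (φ : 𝓓^{0}(Ω, ℝ)) :
    w j k φ = ∫ x, (φ x : ℂ) * (toMatrixMeasure w).density x j k ∂(toMatrixMeasure w).base := by
  have hex : ∃ M : MatrixMeasure Ω n, ∀ j k, ∀ φ : 𝓓^{0}(Ω, ℝ),
      w j k φ = ∫ x, (φ x : ℂ) * M.density x j k ∂M.base := by
    let m : Fin n → Fin n → LocalMeasure Ω := fun j k => toMeasure (w j k)
    obtain ⟨σ, hσ, hmσ⟩ : ∃ σ : Measure ℝ, LocFin Ω σ ∧ ∀ j k, (m j k).variation ≪ σ := by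
      refine ⟨∑ p : Fin n × Fin n, (m p.1 p.2).variation,
        LocFin.sum _ fun p => (m p.1 p.2).locFin, fun j k => ?_⟩
      refine Measure.absolutelyContinuous_of_le ?_
      exact Finset.single_le_sum (f := fun p : Fin n × Fin n => (m p.1 p.2).variation)
        (fun _ _ => Measure.zero_le _) (Finset.mem_univ (j, k))
    let D : ℝ → Matrix (Fin n) (Fin n) ℂ := fun x => Matrix.of fun j k => (m j k).density σ x
    have hDm : ∀ j k, Measurable fun x => D x j k := fun j k => (m j k).measurable_density σ
    have hDi : ∀ j k, LocallyIntegrableOn (fun x => D x j k) Ω σ := fun j k =>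
      (m j k).locallyIntegrableOn_density hσ
    have hD : ∀ j k, ∀ φ : 𝓓^{0}(Ω, ℝ), w j k φ = ∫ x, (φ x : ℂ) * D x j k ∂σ := fun j k φ =>
      (toMeasure_spec (w j k) (hr j k) φ).trans ((m j k).integral_eq hσ (hmσ j k) _)
    have hpos : ∀ᵐ x ∂σ, (D x).PosSemidef := by
      have hc : ∀ c : Fin n → ℂ, ∀ᵐ x ∂σ, 0 ≤ star c ⬝ᵥ D x *ᵥ c := by
        intro c
        have hi : LocallyIntegrableOn (fun x => star c ⬝ᵥ D x *ᵥ c) Ω σ := by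
          refine hσ.locallyIntegrableOn fun K hK hs => ?_
          simp only [dotProduct, Matrix.mulVec, Finset.mul_sum]
          refine integrable_finsetSum _ fun j _ => integrable_finsetSum _ fun k _ => ?_
          exact (((hDi j k).integrableOn_compact_subset hs hK).mul_const _).const_mul _
        have hφ : ∀ φ : 𝓓^{0}(Ω, ℝ), ∫ x, (φ x : ℂ) * (star c ⬝ᵥ D x *ᵥ c) ∂σ =
            ∑ j, ∑ k, conj (c j) * w j k φ * c k := by
          intro φ
          have hi' : ∀ j k, Integrable (fun x => (φ x : ℂ) * (star (c j) * (D x j k * c k))) σ := by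
            intro j k
            have := ((integrable_testFunction_mul (hDi j k) φ).mul_const (c k)).const_mul
              (star (c j))
            exact this.congr (Eventually.of_forall fun x => by ring)
          simp only [dotProduct, Matrix.mulVec, Finset.mul_sum, Pi.star_apply]
          rw [integral_finsetSum _ fun j _ => integrable_finsetSum _ fun k _ => hi' j k]
          refine Finset.sum_congr rfl fun j _ => ?_
          rw [integral_finsetSum _ fun k _ => hi' j k]
          refine Finset.sum_congr rfl fun k _ => ?_
          rw [hD, ← integral_const_mul, ← integral_mul_const]
          refine integral_congr_ae (Eventually.of_forall fun x => ?_)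
          simp only [RCLike.star_def]
          ring
        have hre : ∀ φ : 𝓓^{0}(Ω, ℝ), ∫ x, φ x * (star c ⬝ᵥ D x *ᵥ c).re ∂σ =
            (∑ j, ∑ k, conj (c j) * w j k φ * c k).re := by
          intro φ
          have := integral_re (integrable_testFunction_mul hi φ)
          rw [hφ] at this
          refine Eq.trans (integral_congr_ae (Eventually.of_forall fun x => ?_)) this
          simp
        have him : ∀ φ : 𝓓^{0}(Ω, ℝ), ∫ x, φ x * (star c ⬝ᵥ D x *ᵥ c).im ∂σ =
            (∑ j, ∑ k, conj (c j) * w j k φ * c k).im := by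
          intro φ
          have := integral_im (integrable_testFunction_mul hi φ)
          rw [hφ] at this
          refine Eq.trans (integral_congr_ae (Eventually.of_forall fun x => ?_)) this
          simp
        have hire : LocallyIntegrableOn (fun x => (star c ⬝ᵥ D x *ᵥ c).re) Ω σ :=
          hσ.locallyIntegrableOn fun K hK hs => (hi.integrableOn_compact_subset hs hK).re
        have hiim : LocallyIntegrableOn (fun x => (star c ⬝ᵥ D x *ᵥ c).im) Ω σ :=
          hσ.locallyIntegrableOn fun K hK hs => (hi.integrableOn_compact_subset hs hK).im
        have h1 := hσ.ae_nonneg hire fun φ h0 => by rw [hre]; exact (hw c φ h0).1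
        have h2 := hσ.ae_nonneg hiim fun φ h0 => by rw [him, (hw c φ h0).2]
        have h3 := hσ.ae_nonneg hiim.neg fun φ h0 => by
          simp only [Pi.neg_apply, mul_neg]
          rw [integral_neg, him, (hw c φ h0).2, neg_zero]
        filter_upwards [h1, h2, h3] with x hx1 hx2 hx3
        rw [Complex.nonneg_iff]
        exact ⟨hx1, le_antisymm hx2 (by simpa using hx3)⟩
      -- The exceptional null set depends on `c`; a countable dense set of vectors `c` gives a
      -- common one, and continuity in `c` does the rest.
      obtain ⟨S, hSc, hSd⟩ := TopologicalSpace.exists_countable_dense (Fin n → ℂ)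
      have h1 : ∀ᵐ x ∂σ, ∀ c ∈ S, 0 ≤ star c ⬝ᵥ D x *ᵥ c :=
        (ae_ball_iff hSc).2 fun c _ => hc c
      filter_upwards [h1] with x hx
      refine posSemidef_of_forall_nonneg fun c => ?_
      have hcl : IsClosed {c : Fin n → ℂ | 0 ≤ star c ⬝ᵥ D x *ᵥ c} :=
        isClosed_le continuous_const (by
          simp only [dotProduct, Matrix.mulVec, Pi.star_apply]
          fun_prop)
      exact closure_minimal hx hcl (hSd c)
    -- The density must be semidefinite at every point and measurable, so it is set to zero off a
    -- measurable set `S` of full measure.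
    obtain ⟨S, hS, hSm, hSp⟩ : ∃ S : Set ℝ, (∀ᵐ x ∂σ, x ∈ S) ∧ MeasurableSet S ∧
        ∀ x ∈ S, (D x).PosSemidef := by
      refine ⟨(toMeasurable σ {x | (D x).PosSemidef}ᶜ)ᶜ, ?_, (measurableSet_toMeasurable _ _).compl,
        fun x hx => ?_⟩
      · rw [ae_iff]
        simp only [mem_compl_iff, not_not, ofPred_mem_eq]
        rw [measure_toMeasurable]
        exact hpos
      · by_contra h
        exact hx (subset_toMeasurable σ _ h)
    classical
    let t : ℝ → ℝ := fun x => (D x).trace.re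
    have htm : Measurable t := Complex.measurable_re.comp
      (Finset.measurable_sum _ fun j _ => hDm j j)
    have hti : LocallyIntegrableOn t Ω σ := hσ.locallyIntegrableOn fun K hK hs =>
      (integrable_finsetSum _ fun j _ => (hDi j j).integrableOn_compact_subset hs hK).re
    have ht0 : ∀ x ∈ S, 0 ≤ t x ∧ (D x).trace = (t x : ℂ) := by
      intro x hx
      have := (hSp x hx).trace_nonneg
      rw [Complex.nonneg_iff] at this
      exact ⟨this.1, Complex.ext rfl (by simpa using this.2.symm)⟩
    have htm' : Measurable fun x => ENNReal.ofReal (t x) := htm.ennreal_ofReal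
    refine ⟨⟨σ.withDensity fun x => ENNReal.ofReal (t x),
      fun x => if x ∈ S then (t x)⁻¹ • D x else 0, fun K hK hs => ?_, ?_, fun j k => ?_,
      fun x => ?_, ?_⟩, fun j k φ => ?_⟩
    · rw [withDensity_apply _ hK.measurableSet]
      have h1 := (hti.integrableOn_compact_subset hs hK).2
      rw [hasFiniteIntegral_iff_norm] at h1
      refine (lintegral_mono fun x => ?_).trans_lt h1
      exact ENNReal.ofReal_le_ofReal (le_abs_self _)
    · exact withDensity_absolutelyContinuous _ _ hσ.2
    · have : (fun x => (if x ∈ S then (t x)⁻¹ • D x else 0) j k) =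
          fun x => if x ∈ S then ((t x)⁻¹ : ℂ) * D x j k else 0 := by
        ext x
        split_ifs
        · rw [Matrix.smul_apply, Complex.real_smul, Complex.ofReal_inv]
        · rfl
      rw [this]
      exact Measurable.ite hSm
        ((Complex.measurable_ofReal.comp htm).inv.mul (hDm j k)) measurable_const
    · split_ifs with hx
      · exact (hSp x hx).smul (inv_nonneg.2 (ht0 x hx).1)
      · exact Matrix.PosSemidef.zero
    · rw [ae_withDensity_iff htm']
      filter_upwards [hS] with x hx h0
      have hp : 0 < t x := by
        by_contra h
        exact h0 (ENNReal.ofReal_eq_zero.2 (not_lt.1 h))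
      rw [if_pos hx, Matrix.trace_smul, (ht0 x hx).2, Complex.real_smul, ← Complex.ofReal_mul,
        inv_mul_cancel₀ hp.ne', Complex.ofReal_one]
    · rw [hD]
      change _ = ∫ x, (φ x : ℂ) * (if x ∈ S then (t x)⁻¹ • D x else 0) j k ∂_
      rw [integral_withDensity_eq_integral_toReal_smul htm'
        (Eventually.of_forall fun x => ENNReal.ofReal_lt_top)]
      refine integral_congr_ae ?_
      filter_upwards [hS] with x hx
      rw [if_pos hx, ENNReal.toReal_ofReal (ht0 x hx).1, Matrix.smul_apply, Complex.real_smul,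
        Complex.real_smul, Complex.ofReal_inv]
      -- A positive semidefinite matrix of trace zero vanishes, so nothing is lost where `t` cannot
      -- be inverted.
      rcases eq_or_ne (t x) 0 with h0 | h0
      · have h1 : D x = 0 := by
          rw [← (hSp x hx).trace_eq_zero_iff, (ht0 x hx).2, h0, Complex.ofReal_zero]
        simp [h0, h1]
      · have : (t x : ℂ) ≠ 0 := by exact_mod_cast h0
        field_simp
  exact Classical.epsilon_spec hex j k φ

end FirstOrderSystem

/-! ### The entries of the weight against the trace measure -/

namespace FirstOrderSystem

variable {Ω : Opens ℝ} {n : ℕ}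

theorem LocFin.locallyIntegrableOn_balancedBV {ν : Measure ℝ} (hν : LocFin Ω ν)
    {u : ℝ → Fin n → ℂ} (hu : u ∈ balancedBV Ω n) (k : Fin n) :
    LocallyIntegrableOn (fun x => u x k) Ω ν := by
  refine hν.locallyIntegrableOn fun K hK hs => ?_
  obtain ⟨f, hf1, hfc, hfs, -⟩ := exists_continuousMap_one_of_isCompact_subset_isOpen hK
    Ω.isOpen hs
  have h := integrable_mul_balancedBV hu f.continuous hfc hfs hν.1 k
  refine h.integrableOn.congr_fun (fun x hx => ?_) hK.measurableSet
  simp only [hf1 hx, Pi.one_apply, Complex.ofReal_one, one_mul]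

/-- Semidefiniteness bounds an off-diagonal entry by the sum of two diagonal ones, and each of these
is at most the trace `1`. -/
theorem MatrixMeasure.ae_norm_density_le (M : MatrixMeasure Ω n) (j k : Fin n) :
    ∀ᵐ x ∂M.base, ‖M.density x j k‖ ≤ 2 := by
  filter_upwards [M.trace_density] with x hx
  have hs : ∀ i, star (Pi.single i 1 : Fin n → ℂ) = Pi.single i 1 := fun i => by
    rw [← Pi.single_star, star_one]
  have hb := re_dotProduct_bound (M.posSemidef x) (Pi.single j 1) (Pi.single k 1)
  have hd : ∀ i, (M.density x i i).re ≤ 1 := by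
    intro i
    have h1 : (M.density x i i).re ≤ ∑ l, (M.density x l l).re :=
      Finset.single_le_sum (f := fun l => (M.density x l l).re)
        (fun l _ => (Complex.nonneg_iff.1 ((M.posSemidef x).diag_nonneg (i := l))).1)
        (Finset.mem_univ i)
    have h2 : ∑ l, (M.density x l l).re = 1 := by
      rw [← Complex.re_sum]
      exact congrArg Complex.re hx
    exact h1.trans h2.le
  simp only [hs, single_one_dotProduct, Matrix.mulVec_single_one, Matrix.col_apply] at hb
  linarith [hd j, hd k]

theorem MatrixMeasure.locallyIntegrableOn_mul_density (M : MatrixMeasure Ω n) {f : ℝ → ℂ}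
    (hf : LocallyIntegrableOn f Ω M.base) (j k : Fin n) :
    LocallyIntegrableOn (fun x => f x * M.density x j k) Ω M.base :=
  M.locFin.locallyIntegrableOn fun _ hK hs =>
    (hf.integrableOn_compact_subset hs hK).mul_bdd (c := 2)
      (M.measurable_density j k).aestronglyMeasurable
      (ae_restrict_of_ae (M.ae_norm_density_le j k))

section Weight

variable {w : Matrix (Fin n) (Fin n) 𝓓'^{0}(Ω, ℂ)}

/-- The local measure of an entry of `w` has density `W_jk` with respect to the trace measure. -/
theorem ae_density_toMeasure_eq (hw : IsNonnegDist w) (hr : IsRealDist w) (j k : Fin n) :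
    let ν := (toMeasure (w j k)).variation + (toMatrixMeasure w).base
    ∀ᵐ x ∂ν, (toMeasure (w j k)).density ν x =
      (toMatrixMeasure w).density x j k * (dens (toMatrixMeasure w).base ν x : ℂ) := by
  intro ν
  have hν : LocFin Ω ν := (toMeasure (w j k)).locFin.add (toMatrixMeasure w).locFin
  have h1 : (toMeasure (w j k)).variation ≪ ν := Measure.AbsolutelyContinuous.rfl.add_right _
  have h2 : (toMatrixMeasure w).base ≪ ν := Measure.AbsolutelyContinuous.rfl.add_right' _
  have i1 := (toMeasure (w j k)).locallyIntegrableOn_density hν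
  have i2 := (toMatrixMeasure w).locallyIntegrableOn_mul_density
    ((toMatrixMeasure w).locFin.locallyIntegrableOn_const 1) j k
  simp only [one_mul] at i2
  have i3 := (toMatrixMeasure w).locFin.locallyIntegrableOn_mul_dens hν h2 i2
  have h := hν.ae_eq_zero (i1.sub i3) fun φ => by
    have e1 := toMeasure_spec (w j k) (hr j k) (testFunctionToContinuous φ)
    have e2 := toMatrixMeasure_spec w hw hr j k (testFunctionToContinuous φ)
    rw [LocalMeasure.integral_eq _ hν h1, e2, ← integral_dens_mul (toMatrixMeasure w).locFin hν h2]
      at e1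
    simp only [Pi.sub_apply, mul_sub]
    rw [integral_sub (integrable_testFunction_mul i1 φ) (integrable_testFunction_mul i3 φ),
      sub_eq_zero]
    simp only [← mul_assoc]
    exact e1.symm
  filter_upwards [h] with x hx using sub_eq_zero.1 hx

/-- Reconciles the two independently chosen representations of `w`: entrywise, used in `mulDist` and
`jump`, and by `W d(tr w)`, used in `L²(w)`. As densities are compared, `g` may be arbitrary, in
particular the indicator of a point as in `jump_eq`. -/
theorem integral_toMeasure_eq (hw : IsNonnegDist w) (hr : IsRealDist w) (j k : Fin n)
    (g : ℝ → ℂ) : (toMeasure (w j k)).integral g =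
      ∫ x, g x * (toMatrixMeasure w).density x j k ∂(toMatrixMeasure w).base := by
  have h := ae_density_toMeasure_eq hw hr j k
  have hν := (toMeasure (w j k)).locFin.add (toMatrixMeasure w).locFin
  have h1 : (toMeasure (w j k)).variation ≪
      (toMeasure (w j k)).variation + (toMatrixMeasure w).base :=
    Measure.AbsolutelyContinuous.rfl.add_right _
  have h2 : (toMatrixMeasure w).base ≪
      (toMeasure (w j k)).variation + (toMatrixMeasure w).base :=
    Measure.AbsolutelyContinuous.rfl.add_right' _
  rw [LocalMeasure.integral_eq _ hν h1, ← integral_dens_mul (toMatrixMeasure w).locFin hν h2]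
  refine integral_congr_ae ?_
  filter_upwards [h] with x hx
  rw [hx, mul_assoc]

theorem jump_eq (hw : IsNonnegDist w) (hr : IsRealDist w) (x : ℝ) :
    jump w x = ((toMatrixMeasure w).base.real {x} : ℂ) • (toMatrixMeasure w).density x := by
  ext j k
  have h1 := integral_toMeasure_eq hw hr j k (indicator {x} fun _ => 1)
  have e : ∀ f : ℝ → ℂ, (fun y => indicator {x} (fun _ => (1 : ℂ)) y * f y) = indicator {x} f := by
    intro f
    ext y
    by_cases hy : y ∈ ({x} : Set ℝ)
    · simp only [indicator_of_mem hy, one_mul]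
    · simp only [indicator_of_notMem hy, zero_mul]
  rw [LocalMeasure.integral, e, e, integral_indicator (measurableSet_singleton x),
    integral_indicator (measurableSet_singleton x), integral_singleton, integral_singleton,
    Complex.real_smul, Complex.real_smul] at h1
  exact h1

theorem ae_mulVec_eq_zero (hw : IsNonnegDist w) (hr : IsRealDist w) {u : ℝ → Fin n → ℂ}
    (hu : u ∈ balancedBV Ω n) (h0 : ∀ φ : 𝓓(Ω, ℝ), mulDist w u φ = 0) :
    ∀ᵐ x ∂(toMatrixMeasure w).base, (toMatrixMeasure w).density x *ᵥ u x = 0 := by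
  have hM := (toMatrixMeasure w).locFin
  have hi : ∀ j k, LocallyIntegrableOn (fun x => u x k * (toMatrixMeasure w).density x j k) Ω
      (toMatrixMeasure w).base := fun j k =>
    (toMatrixMeasure w).locallyIntegrableOn_mul_density (hM.locallyIntegrableOn_balancedBV hu k) j k
  have h : ∀ j, ∀ᵐ x ∂(toMatrixMeasure w).base, ((toMatrixMeasure w).density x *ᵥ u x) j = 0 := by
    intro j
    refine hM.ae_eq_zero ?_ fun φ => ?_
    · refine hM.locallyIntegrableOn fun K hK hs => ?_
      simp only [dotProduct, Matrix.mulVec]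
      refine integrable_finsetSum _ fun k _ => ?_
      simp only [mul_comm _ (u _ k)]
      exact (hi j k).integrableOn_compact_subset hs hK
    · refine Eq.trans ?_ (congrFun (h0 φ) j)
      simp only [mulDist, Matrix.mulVec, dotProduct, Finset.mul_sum]
      have e : ∀ k x, (φ x : ℂ) * ((toMatrixMeasure w).density x j k * u x k) =
          (φ x : ℂ) * u x k * (toMatrixMeasure w).density x j k := fun k x => by ring
      simp only [e]
      rw [integral_finsetSum]
      · exact Finset.sum_congr rfl fun k _ => (integral_toMeasure_eq hw hr j k _).symm
      · intro k _
        simpa only [mul_assoc] using integrable_testFunction_mul (hi j k) φ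
  filter_upwards [ae_all_iff.2 h] with x hx using funext hx

/-- Hermitian and real gives symmetric; this is what allows the bilinear pairing `uᵀ W f` later on.
-/
theorem ae_density_symm (hw : IsNonnegDist w) (hr : IsRealDist w) :
    ∀ᵐ x ∂(toMatrixMeasure w).base, ((toMatrixMeasure w).density x)ᵀ =
      (toMatrixMeasure w).density x := by
  have hM := (toMatrixMeasure w).locFin
  have hi : ∀ j k, LocallyIntegrableOn (fun x => (toMatrixMeasure w).density x j k) Ω
      (toMatrixMeasure w).base := fun j k => by
    simpa only [one_mul] using (toMatrixMeasure w).locallyIntegrableOn_mul_density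
      (hM.locallyIntegrableOn_const 1) j k
  have h : ∀ j k, ∀ᵐ x ∂(toMatrixMeasure w).base, (toMatrixMeasure w).density x k j =
      (toMatrixMeasure w).density x j k := by
    intro j k
    have h := hM.ae_eq_zero ((hi k j).sub (hi j k)) fun φ => by
      have e1 := toMatrixMeasure_spec w hw hr j k (testFunctionToContinuous φ)
      have e2 := hr j k (testFunctionToContinuous φ)
      rw [e1, ← integral_conj] at e2
      simp only [Pi.sub_apply, mul_sub]
      rw [integral_sub (integrable_testFunction_mul (hi k j) φ)
        (integrable_testFunction_mul (hi j k) φ), sub_eq_zero]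
      refine Eq.trans (integral_congr_ae (Eventually.of_forall fun x => ?_)) e2
      simp only [map_mul, Complex.conj_ofReal]
      rw [← ((toMatrixMeasure w).posSemidef x).1.apply k j]
      rfl
    filter_upwards [h] with x hx using sub_eq_zero.1 hx
  filter_upwards [ae_all_iff.2 fun j => ae_all_iff.2 (h j)] with x hx
  ext j k
  exact hx j k

end Weight

end FirstOrderSystem

/-! ### Balanced antiderivatives of measures -/

namespace FirstOrderSystem

theorem measurable_sign : Measurable Real.sign := by
  unfold Real.sign
  exact Measurable.ite measurableSet_Iio measurable_const
    (Measurable.ite measurableSet_Ioi measurable_const measurable_const)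

theorem abs_sign_le (x : ℝ) : |Real.sign x| ≤ 1 := by
  rcases Real.sign_apply_eq x with h | h | h <;> simp [h]

/-- The kernel of the balanced antiderivative that vanishes at `c`. -/
noncomputable def stepKernel (c t s : ℝ) : ℝ := (Real.sign (t - s) - Real.sign (c - s)) / 2

/-- The cocycle identity that makes changes of base point possible. Since `Real.sign 0 = 0`, an atom
at an endpoint is counted with weight one half. -/
theorem stepKernel_sub (c t t' s : ℝ) :
    stepKernel c t s - stepKernel c t' s = stepKernel t' t s := by
  unfold stepKernel
  ring

theorem abs_stepKernel_le (c t s : ℝ) : |stepKernel c t s| ≤ 1 := by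
  have h1 := abs_le.1 (abs_sign_le (t - s))
  have h2 := abs_le.1 (abs_sign_le (c - s))
  unfold stepKernel
  rw [abs_le]
  constructor <;> linarith

theorem stepKernel_of_notMem {c t s : ℝ} (h : s ∉ uIcc c t) : stepKernel c t s = 0 := by
  unfold stepKernel
  rw [mem_uIcc, not_or, not_and_or, not_and_or] at h
  obtain ⟨h1, h2⟩ := h
  rcases lt_or_ge s c with hc | hc
  · have ht : s < t := by
      rcases h2 with h2 | h2
      · exact not_le.1 h2
      · exact absurd hc.le h2
    rw [Real.sign_of_pos (sub_pos.2 ht), Real.sign_of_pos (sub_pos.2 hc)]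
    simp
  · have ht : t < s := by
      rcases h1 with h1 | h1
      · exact absurd hc h1
      · exact not_le.1 h1
    have hc' : c < s := by
      refine lt_of_le_of_ne hc ?_
      rintro rfl
      rcases h2 with h2 | h2
      · exact h2 ht.le
      · exact h2 le_rfl
    rw [Real.sign_of_neg (sub_neg.2 ht), Real.sign_of_neg (sub_neg.2 hc')]
    simp

theorem stepKernel_nonneg {c t : ℝ} (h : c ≤ t) (s : ℝ) : 0 ≤ stepKernel c t s := by
  have hm : ∀ x y : ℝ, x ≤ y → Real.sign x ≤ Real.sign y := by
    intro x y hxy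
    rcases lt_trichotomy x 0 with hx | hx | hx
    · rw [Real.sign_of_neg hx]
      exact (abs_le.1 (abs_sign_le y)).1
    · rw [hx, Real.sign_zero]
      rcases (hx ▸ hxy : 0 ≤ y).eq_or_lt with hy | hy
      · rw [← hy, Real.sign_zero]
      · rw [Real.sign_of_pos hy]
        exact zero_le_one
    · rw [Real.sign_of_pos hx, Real.sign_of_pos (hx.trans_le hxy)]
  have := hm (c - s) (t - s) (by linarith)
  unfold stepKernel
  linarith

theorem measurable_stepKernel : Measurable fun p : ℝ × ℝ × ℝ => stepKernel p.1 p.2.1 p.2.2 := by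
  unfold stepKernel
  exact ((measurable_sign.comp (by fun_prop)).sub (measurable_sign.comp (by fun_prop))).div_const _

theorem measurable_stepKernel_right (c t : ℝ) : Measurable (stepKernel c t) :=
  measurable_stepKernel.comp (measurable_const.prodMk (measurable_const.prodMk measurable_id))

variable {Ω : Opens ℝ} {n : ℕ} {ν : Measure ℝ} {E : Type*} [NormedAddCommGroup E] [NormedSpace ℝ E]

/-- The balanced antiderivative of `g ν` that vanishes at `c`. -/
noncomputable def primitive (ν : Measure ℝ) (c : ℝ) (g : ℝ → E) (t : ℝ) : E :=
  ∫ s, stepKernel c t s • g s ∂ν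

theorem integrableOn_uIcc {F : Type*} [NormedAddCommGroup F] [hΩ : OrdConnected (Ω : Set ℝ)]
    {g : ℝ → F}
    (hg : LocallyIntegrableOn g Ω ν) {c t : ℝ} (hc : c ∈ Ω) (ht : t ∈ Ω) :
    IntegrableOn g (uIcc c t) ν :=
  hg.integrableOn_compact_subset (hΩ.uIcc_subset hc ht) isCompact_uIcc

theorem integrable_stepKernel_smul [OrdConnected (Ω : Set ℝ)] {g : ℝ → E}
    (hg : LocallyIntegrableOn g Ω ν) {c t : ℝ} (hc : c ∈ Ω) (ht : t ∈ Ω) :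
    Integrable (fun s => stepKernel c t s • g s) ν := by
  rw [← integrableOn_iff_integrable_of_support_subset (s := uIcc c t) (fun s hs => by
    by_contra h
    exact hs (by simp [stepKernel_of_notMem h]))]
  exact (integrableOn_uIcc hg hc ht).bdd_smul 1
    (measurable_stepKernel_right c t).aestronglyMeasurable
    (Eventually.of_forall fun s => abs_stepKernel_le c t s)

theorem primitive_self (ν : Measure ℝ) (c : ℝ) (g : ℝ → E) : primitive ν c g c = 0 := by
  simp [primitive, stepKernel]

theorem primitive_sub_primitive [OrdConnected (Ω : Set ℝ)] {g : ℝ → E}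
    (hg : LocallyIntegrableOn g Ω ν) {c t t' : ℝ} (hc : c ∈ Ω) (ht : t ∈ Ω) (ht' : t' ∈ Ω) :
    primitive ν c g t - primitive ν c g t' = primitive ν t' g t := by
  unfold primitive
  rw [← integral_sub (integrable_stepKernel_smul hg hc ht) (integrable_stepKernel_smul hg hc ht')]
  simp only [← sub_smul, stepKernel_sub]

theorem norm_primitive_le_setIntegral [OrdConnected (Ω : Set ℝ)] {g : ℝ → E}
    (hg : LocallyIntegrableOn g Ω ν) {c t : ℝ} (hc : c ∈ Ω) (ht : t ∈ Ω) :
    ‖primitive ν c g t‖ ≤ ∫ s in uIcc c t, ‖g s‖ ∂ν := by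
  unfold primitive
  rw [← integral_indicator measurableSet_uIcc]
  refine norm_integral_le_of_norm_le
    ((integrable_indicator_iff measurableSet_uIcc).2 (integrableOn_uIcc hg hc ht).norm)
    (Eventually.of_forall fun s => ?_)
  by_cases hs : s ∈ uIcc c t
  · rw [indicator_of_mem hs, norm_smul]
    exact mul_le_of_le_one_left (norm_nonneg _) (abs_stepKernel_le c t s)
  · rw [indicator_of_notMem hs, stepKernel_of_notMem hs, zero_smul, norm_zero]

/-- As the endpoint approaches `t`, the kernel converges pointwise to `e` times the indicator of
`{t}`, where `e = ±1/2` according to the side. Dominated convergence applies with `‖g‖` on a compact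
ball. -/
theorem tendsto_primitive_self [CompleteSpace E] [OrdConnected (Ω : Set ℝ)] {g : ℝ → E} (hg : LocallyIntegrableOn g Ω ν) {t : ℝ} (ht : t ∈ Ω) {l : Filter ℝ}
    [l.IsCountablyGenerated] (hl : l ≤ 𝓝 t) {e : ℝ}
    (he : ∀ s, ∀ᶠ x in l, stepKernel t x s = if s = t then e else 0) :
    Tendsto (primitive ν t g) l (𝓝 (ν.real {t} • e • g t)) := by
  have h1 : ∫ s, indicator {t} (fun s => e • g s) s ∂ν = ν.real {t} • e • g t := by
    rw [integral_indicator (measurableSet_singleton t), integral_singleton]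
  rw [← h1]
  obtain ⟨δ, hδ, hs⟩ := Metric.nhds_basis_closedBall.mem_iff.1 (Ω.isOpen.mem_nhds ht)
  have hi : IntegrableOn g (Metric.closedBall t δ) ν :=
    hg.integrableOn_compact_subset hs (isCompact_closedBall t δ)
  have hev : ∀ᶠ x in l, x ∈ Metric.closedBall t δ := hl (Metric.closedBall_mem_nhds t hδ)
  have hsub : ∀ x ∈ Metric.closedBall t δ, uIcc t x ⊆ Metric.closedBall t δ := by
    intro x hx
    rw [Real.closedBall_eq_Icc] at hx ⊢
    exact uIcc_subset_Icc ⟨by linarith, by linarith⟩ hx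
  refine tendsto_integral_filter_of_dominated_convergence
    (indicator (Metric.closedBall t δ) fun s => ‖g s‖) ?_ ?_
    ((integrable_indicator_iff measurableSet_closedBall).2 hi.norm) ?_
  · filter_upwards [hev] with x hx
    exact (integrable_stepKernel_smul hg ht (hs hx)).aestronglyMeasurable
  · filter_upwards [hev] with x hx
    refine Eventually.of_forall fun s => ?_
    by_cases hsx : s ∈ uIcc t x
    · rw [indicator_of_mem (hsub x hx hsx), norm_smul]
      exact mul_le_of_le_one_left (norm_nonneg _) (abs_stepKernel_le t x s)
    · rw [stepKernel_of_notMem hsx, zero_smul, norm_zero]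
      exact indicator_nonneg (fun _ _ => norm_nonneg _) _
  · refine Eventually.of_forall fun s => tendsto_const_nhds.congr' ?_
    filter_upwards [he s] with x hx
    rw [hx]
    by_cases h : s = t
    · subst h
      simp
    · rw [if_neg h, zero_smul, indicator_of_notMem (by simpa using h)]

theorem tendsto_primitive_right [CompleteSpace E] [OrdConnected (Ω : Set ℝ)] {g : ℝ → E} (hg : LocallyIntegrableOn g Ω ν) {c t : ℝ} (hc : c ∈ Ω) (ht : t ∈ Ω) :
    Tendsto (primitive ν c g) (𝓝[>] t) (𝓝 (primitive ν c g t + ν.real {t} • (1 / 2 : ℝ) • g t)) := by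
  have h := tendsto_primitive_self hg ht (l := 𝓝[>] t) nhdsWithin_le_nhds (e := 1 / 2) fun s => by
    rcases lt_trichotomy s t with h | rfl | h
    · filter_upwards [self_mem_nhdsWithin] with x hx
      rw [if_neg h.ne]
      have hx' : t < x := hx
      unfold stepKernel
      rw [Real.sign_of_pos (by linarith), Real.sign_of_pos (by linarith)]
      simp
    · filter_upwards [self_mem_nhdsWithin] with x hx
      have hx' : s < x := hx
      unfold stepKernel
      rw [if_pos rfl, Real.sign_of_pos (by linarith), sub_self, Real.sign_zero, sub_zero]
    · filter_upwards [nhdsWithin_le_nhds (Iio_mem_nhds h)] with x hx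
      have hx' : x < s := hx
      rw [if_neg h.ne']
      unfold stepKernel
      rw [Real.sign_of_neg (by linarith), Real.sign_of_neg (by linarith)]
      simp
  refine (h.const_add (primitive ν c g t)).congr' ?_
  filter_upwards [nhdsWithin_le_nhds (Ω.isOpen.mem_nhds ht)] with x hx
  rw [← primitive_sub_primitive hg hc hx ht]
  abel

theorem tendsto_primitive_left [CompleteSpace E] [OrdConnected (Ω : Set ℝ)] {g : ℝ → E} (hg : LocallyIntegrableOn g Ω ν) {c t : ℝ} (hc : c ∈ Ω) (ht : t ∈ Ω) :
    Tendsto (primitive ν c g) (𝓝[<] t)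
      (𝓝 (primitive ν c g t + ν.real {t} • (-1 / 2 : ℝ) • g t)) := by
  have h := tendsto_primitive_self hg ht (l := 𝓝[<] t) nhdsWithin_le_nhds (e := -1 / 2)
    fun s => by
    rcases lt_trichotomy s t with h | rfl | h
    · filter_upwards [nhdsWithin_le_nhds (Ioi_mem_nhds h)] with x hx
      have hx' : s < x := hx
      rw [if_neg h.ne]
      unfold stepKernel
      rw [Real.sign_of_pos (by linarith), Real.sign_of_pos (by linarith)]
      simp
    · filter_upwards [self_mem_nhdsWithin] with x hx
      have hx' : x < s := hx
      unfold stepKernel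
      rw [if_pos rfl, Real.sign_of_neg (by linarith), sub_self, Real.sign_zero, sub_zero]
    · filter_upwards [self_mem_nhdsWithin] with x hx
      rw [if_neg h.ne']
      have hx' : x < t := hx
      unfold stepKernel
      rw [Real.sign_of_neg (by linarith), Real.sign_of_neg (by linarith)]
      simp
  refine (h.const_add (primitive ν c g t)).congr' ?_
  filter_upwards [nhdsWithin_le_nhds (Ω.isOpen.mem_nhds ht)] with x hx
  rw [← primitive_sub_primitive hg hc hx ht]
  abel

/-- The balanced antiderivative of a vector measure `g ν`, extended by zero. -/
noncomputable def vecPrimitive (Ω : Opens ℝ) (ν : Measure ℝ) (c : ℝ) (g : ℝ → Fin n → ℂ) :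
    ℝ → Fin n → ℂ :=
  indicator (Ω : Set ℝ) fun t j => primitive ν c (fun s => g s j) t

theorem vecPrimitive_apply {c : ℝ} {g : ℝ → Fin n → ℂ} {t : ℝ} (ht : t ∈ Ω) (j : Fin n) :
    vecPrimitive Ω ν c g t j = primitive ν c (fun s => g s j) t := by
  rw [vecPrimitive, indicator_of_mem (show t ∈ (Ω : Set ℝ) from ht)]

theorem tendsto_vecPrimitive_right [OrdConnected (Ω : Set ℝ)] {g : ℝ → Fin n → ℂ} (hg : ∀ j, LocallyIntegrableOn (fun s => g s j) Ω ν) {c t : ℝ}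
    (hc : c ∈ Ω) (ht : t ∈ Ω) : Tendsto (vecPrimitive Ω ν c g) (𝓝[>] t)
      (𝓝 (vecPrimitive Ω ν c g t + ((ν.real {t} / 2 : ℝ) : ℂ) • g t)) := by
  rw [tendsto_pi_nhds]
  intro j
  have h := tendsto_primitive_right (hg j) hc ht
  have e : (vecPrimitive Ω ν c g t + ((ν.real {t} / 2 : ℝ) : ℂ) • g t) j =
      primitive ν c (fun s => g s j) t + ν.real {t} • (1 / 2 : ℝ) • g t j := by
    rw [Pi.add_apply, vecPrimitive_apply ht, Pi.smul_apply, smul_smul, Complex.real_smul,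
      smul_eq_mul]
    congr 3
    ring
  rw [e]
  refine h.congr' ?_
  filter_upwards [nhdsWithin_le_nhds (Ω.isOpen.mem_nhds ht)] with x hx
  rw [vecPrimitive_apply hx]

theorem tendsto_vecPrimitive_left [OrdConnected (Ω : Set ℝ)] {g : ℝ → Fin n → ℂ} (hg : ∀ j, LocallyIntegrableOn (fun s => g s j) Ω ν) {c t : ℝ}
    (hc : c ∈ Ω) (ht : t ∈ Ω) : Tendsto (vecPrimitive Ω ν c g) (𝓝[<] t)
      (𝓝 (vecPrimitive Ω ν c g t - ((ν.real {t} / 2 : ℝ) : ℂ) • g t)) := by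
  rw [tendsto_pi_nhds]
  intro j
  have h := tendsto_primitive_left (hg j) hc ht
  have e : (vecPrimitive Ω ν c g t - ((ν.real {t} / 2 : ℝ) : ℂ) • g t) j =
      primitive ν c (fun s => g s j) t + ν.real {t} • (-1 / 2 : ℝ) • g t j := by
    rw [Pi.sub_apply, vecPrimitive_apply ht, Pi.smul_apply, smul_smul, Complex.real_smul,
      smul_eq_mul]
    push_cast
    ring
  rw [e]
  refine h.congr' ?_
  filter_upwards [nhdsWithin_le_nhds (Ω.isOpen.mem_nhds ht)] with x hx
  rw [vecPrimitive_apply hx]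

/-- Increments are dominated by those of the antiderivative of `∑ j, ‖g j‖`, which is monotone. -/
theorem locallyBoundedVariationOn_vecPrimitive [OrdConnected (Ω : Set ℝ)]
    {g : ℝ → Fin n → ℂ} (hg : ∀ j, LocallyIntegrableOn (fun s => g s j) Ω ν) {c : ℝ}
    (hc : c ∈ Ω) : LocallyBoundedVariationOn (vecPrimitive Ω ν c g) (Ω : Set ℝ) := by
  let d : ℝ → ℝ := fun s => ∑ j, ‖g s j‖
  have hd : LocallyIntegrableOn d Ω ν :=
    (locallyIntegrableOn_iff Ω.isOpen.isLocallyClosed).2 fun K hs hK =>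
      integrable_finsetSum _ fun j _ => ((hg j).integrableOn_compact_subset hs hK).norm
  have hmono : MonotoneOn (primitive ν c d) (Ω : Set ℝ) := by
    intro x hx y hy hxy
    rw [← sub_nonneg, primitive_sub_primitive hd hc hy hx]
    exact integral_nonneg fun s => mul_nonneg (stepKernel_nonneg hxy s)
      (Finset.sum_nonneg fun _ _ => norm_nonneg _)
  have hle : ∀ x ∈ (Ω : Set ℝ), ∀ y ∈ (Ω : Set ℝ), x ≤ y →
      edist (vecPrimitive Ω ν c g y) (vecPrimitive Ω ν c g x) ≤
        edist (primitive ν c d y) (primitive ν c d x) := by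
    intro x hx y hy hxy
    rw [edist_dist, edist_dist]
    refine ENNReal.ofReal_le_ofReal ?_
    refine (dist_pi_le_iff dist_nonneg).2 fun j => ?_
    rw [vecPrimitive_apply hx, vecPrimitive_apply hy, dist_eq_norm, dist_eq_norm,
      primitive_sub_primitive (hg j) hc hy hx, primitive_sub_primitive hd hc hy hx]
    refine le_trans ?_ (le_abs_self _)
    refine norm_integral_le_of_norm_le (integrable_stepKernel_smul hd hx hy)
      (Eventually.of_forall fun s => ?_)
    rw [norm_smul, Real.norm_of_nonneg (stepKernel_nonneg hxy s)]
    exact mul_le_mul_of_nonneg_left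
      (Finset.single_le_sum (f := fun j => ‖g s j‖) (fun _ _ => norm_nonneg _) (Finset.mem_univ j))
      (stepKernel_nonneg hxy s)
  intro x y hx hy
  refine ne_top_of_le_ne_top (hmono.locallyBoundedVariationOn x y hx hy) ?_
  refine iSup_le fun p => ?_
  refine le_trans (Finset.sum_le_sum fun i _ => ?_) (eVariationOn.sum_le (n := p.1) p.2.2.1 p.2.2.2)
  exact hle _ (p.2.2.2 i).1 _ (p.2.2.2 (i + 1)).1 (p.2.2.1 (Nat.le_succ i))

theorem vecPrimitive_mem_balancedBV [OrdConnected (Ω : Set ℝ)] {g : ℝ → Fin n → ℂ} (hg : ∀ j, LocallyIntegrableOn (fun s => g s j) Ω ν) {c : ℝ}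
    (hc : c ∈ Ω) : vecPrimitive Ω ν c g ∈ balancedBV Ω n := by
  refine ⟨locallyBoundedVariationOn_vecPrimitive hg hc, fun x hx =>
    ⟨_, _, tendsto_vecPrimitive_left hg hc hx, tendsto_vecPrimitive_right hg hc hx, ?_⟩,
    fun x hx => indicator_of_notMem hx _⟩
  rw [sub_add_add_cancel, ← two_smul ℂ, smul_smul]
  norm_num

end FirstOrderSystem

/-! ### Distributional derivatives and the integral equation -/

namespace FirstOrderSystem

variable {Ω : Opens ℝ} {n : ℕ} {ν : Measure ℝ}

/-- As a function of `t` the kernel is a unit step at `s` up to a constant, so its derivative is the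
point mass at `s`; the constant is killed by `∫ φ' = 0`. -/
theorem integral_deriv_mul_stepKernel (φ : 𝓓(Ω, ℝ)) (c s : ℝ) :
    ∫ t, deriv φ t * stepKernel c t s = -φ s := by
  have hφ : ContDiff ℝ 1 φ := φ.contDiff.of_le (by exact_mod_cast le_top)
  have hi : Integrable (deriv φ) :=
    (hφ.continuous_deriv le_rfl).integrable_of_hasCompactSupport φ.hasCompactSupport.deriv
  have h1 := φ.hasCompactSupport.integral_Ioi_deriv_eq hφ s
  have h2 := φ.hasCompactSupport.integral_Iic_deriv_eq hφ s
  have h3 : ∫ t, deriv φ t = 0 := by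
    rw [← integral_add_compl (measurableSet_Iic (a := s)) hi, compl_Iic, h1, h2]
    ring
  have h4 : Integrable fun t => deriv φ t * (Real.sign (t - s) / 2) :=
    hi.mul_bdd (c := 1) ((measurable_sign.comp (by fun_prop)).div_const _).aestronglyMeasurable
      (Eventually.of_forall fun t => by
        have := abs_sign_le (t - s)
        rw [Real.norm_eq_abs, abs_div, abs_two]
        linarith)
  have h5 : ∫ t, deriv φ t * (Real.sign (t - s) / 2) = -φ s := by
    rw [← integral_add_compl (measurableSet_Iic (a := s)) h4, compl_Iic]
    have e1 : ∫ t in Iic s, deriv φ t * (Real.sign (t - s) / 2) = -(1 / 2) * φ s := by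
      rw [← h2, ← integral_const_mul, integral_Iic_eq_integral_Iio, integral_Iic_eq_integral_Iio]
      refine setIntegral_congr_fun measurableSet_Iio fun t ht => ?_
      rw [Real.sign_of_neg (sub_neg.2 ht)]
      ring
    have e2 : ∫ t in Ioi s, deriv φ t * (Real.sign (t - s) / 2) = (1 / 2) * -φ s := by
      rw [← h1, ← integral_const_mul]
      refine setIntegral_congr_fun measurableSet_Ioi fun t ht => ?_
      rw [Real.sign_of_pos (sub_pos.2 ht)]
      ring
    rw [e1, e2]
    ring
  have h6 : ∀ t, deriv φ t * stepKernel c t s =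
      deriv φ t * (Real.sign (t - s) / 2) - deriv φ t * (Real.sign (c - s) / 2) := fun t => by
    unfold stepKernel
    ring
  simp only [h6]
  rw [integral_sub h4 (hi.mul_const _), h5, integral_mul_const, h3]
  ring

theorem exists_Icc_of_isCompact [hΩ : OrdConnected (Ω : Set ℝ)] {K : Set ℝ} (hK : IsCompact K)
    (hs : K ⊆ (Ω : Set ℝ)) {c : ℝ} (hc : c ∈ Ω) :
    ∃ a b : ℝ, K ⊆ Icc a b ∧ c ∈ Icc a b ∧ Icc a b ⊆ (Ω : Set ℝ) := by
  have hK' : IsCompact (insert c K) := hK.insert c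
  have hne : (insert c K).Nonempty := ⟨c, mem_insert _ _⟩
  have hs' : insert c K ⊆ (Ω : Set ℝ) := insert_subset hc hs
  obtain ⟨a, ha, ha'⟩ := hK'.exists_isLeast hne
  obtain ⟨b, hb, hb'⟩ := hK'.exists_isGreatest hne
  exact ⟨a, b, fun x hx => ⟨ha' (mem_insert_of_mem _ hx), hb' (mem_insert_of_mem _ hx)⟩,
    ⟨ha' (mem_insert _ _), hb' (mem_insert _ _)⟩, hΩ.out (hs' ha) (hs' hb)⟩

theorem primitive_eq_setIntegral {E : Type*} [NormedAddCommGroup E] [NormedSpace ℝ E] {g : ℝ → E}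
    {a b c t : ℝ} (hc : c ∈ Icc a b) (ht : t ∈ Icc a b) :
    primitive ν c g t = ∫ s in Icc a b, stepKernel c t s • g s ∂ν := by
  rw [primitive, setIntegral_eq_integral_of_forall_compl_eq_zero]
  intro s hs
  rw [stepKernel_of_notMem fun h => hs (uIcc_subset_Icc hc ht h), zero_smul]

/-- Fubini reduces this to `integral_deriv_mul_stepKernel`. Everything is first confined to a
compact interval containing `c` and the support of `φ`, where `ν` is finite. -/
theorem integral_deriv_mul_primitive [OrdConnected (Ω : Set ℝ)] (hν : LocFin Ω ν) {g : ℝ → ℂ}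
    (hg : LocallyIntegrableOn g Ω ν) {c : ℝ} (hc : c ∈ Ω) (φ : 𝓓(Ω, ℝ)) :
    -∫ t, ((deriv φ t : ℝ) : ℂ) * primitive ν c g t = ∫ s, (φ s : ℂ) * g s ∂ν := by
  obtain ⟨a, b, hφI, hcI, hI⟩ :=
    exists_Icc_of_isCompact φ.hasCompactSupport φ.tsupport_subset hc
  have hφ : ContDiff ℝ 1 φ := φ.contDiff.of_le (by exact_mod_cast le_top)
  have hi : Integrable (deriv φ) :=
    (hφ.continuous_deriv le_rfl).integrable_of_hasCompactSupport φ.hasCompactSupport.deriv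
  have hfin : IsFiniteMeasure (ν.restrict (Icc a b)) :=
    ⟨by simpa using hν.1 _ isCompact_Icc hI⟩
  have hgi : Integrable g (ν.restrict (Icc a b)) := hg.integrableOn_compact_subset hI isCompact_Icc
  have e1 : ∀ t, ((deriv φ t : ℝ) : ℂ) * primitive ν c g t =
      ∫ s in Icc a b, (stepKernel c t s : ℂ) * (((deriv φ t : ℝ) : ℂ) * g s) ∂ν := by
    intro t
    by_cases ht : t ∈ Icc a b
    · rw [primitive_eq_setIntegral hcI ht, ← integral_const_mul]
      refine integral_congr_ae (Eventually.of_forall fun s => ?_)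
      simp only [Complex.real_smul]
      ring
    · have : deriv φ t = 0 := by
        by_contra h
        exact ht (hφI (tsupport_deriv_subset (subset_tsupport _ h)))
      simp [this]
  have hint : Integrable (fun p : ℝ × ℝ => (stepKernel c p.1 p.2 : ℂ) *
      (((deriv φ p.1 : ℝ) : ℂ) * g p.2)) (volume.prod (ν.restrict (Icc a b))) :=
    (hi.ofReal.mul_prod hgi).bdd_mul (c := 1) (by
      refine Measurable.aestronglyMeasurable ?_
      exact Complex.measurable_ofReal.comp (measurable_stepKernel.comp
        (measurable_const.prodMk (measurable_fst.prodMk measurable_snd))))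
      (Eventually.of_forall fun p => by
        rw [Complex.norm_real]
        exact abs_stepKernel_le _ _ _)
  simp only [e1]
  rw [integral_integral_swap hint, ← integral_neg,
    ← setIntegral_eq_integral_of_forall_compl_eq_zero (s := Icc a b) (f := fun s => (φ s : ℂ) * g s)
      fun s hs => by
        have : φ s = 0 := by
          by_contra h
          exact hs (hφI (subset_tsupport _ h))
        simp [this]]
  refine integral_congr_ae (Eventually.of_forall fun s => ?_)
  have e2 : ∀ t, (stepKernel c t s : ℂ) * (((deriv φ t : ℝ) : ℂ) * g s) =
      ((deriv φ t * stepKernel c t s : ℝ) : ℂ) * g s := fun t => by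
    push_cast
    ring
  simp only [e2]
  rw [integral_mul_const, integral_complex_ofReal, integral_deriv_mul_stepKernel]
  push_cast
  ring

theorem derivDist_vecPrimitive [OrdConnected (Ω : Set ℝ)] (hν : LocFin Ω ν)
    {g : ℝ → Fin n → ℂ} (hg : ∀ j, LocallyIntegrableOn (fun s => g s j) Ω ν) {c : ℝ}
    (hc : c ∈ Ω) (φ : 𝓓(Ω, ℝ)) (j : Fin n) :
    derivDist (vecPrimitive Ω ν c g) φ j = ∫ s, (φ s : ℂ) * g s j ∂ν := by
  rw [← integral_deriv_mul_primitive hν (hg j) hc φ, derivDist]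
  congr 1
  refine integral_congr_ae (Eventually.of_forall fun t => ?_)
  by_cases ht : t ∈ Ω
  · simp only [vecPrimitive_apply ht]
  · have : deriv φ t = 0 := by
      by_contra h
      exact ht (φ.tsupport_subset (tsupport_deriv_subset (subset_tsupport _ h)))
    simp [this]

/-- A test function with vanishing integral is the derivative of a test function. -/
theorem exists_deriv_eq_of_integral_eq_zero [OrdConnected (Ω : Set ℝ)] {c : ℝ} (hc : c ∈ Ω)
    (φ : 𝓓(Ω, ℝ)) (h0 : ∫ t, φ t = 0) : ∃ χ : 𝓓(Ω, ℝ), ∀ t, deriv χ t = φ t := by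
  obtain ⟨a, b, hφI, hcI, hI⟩ :=
    exists_Icc_of_isCompact φ.hasCompactSupport φ.tsupport_subset hc
  have hab : a ≤ b := hcI.1.trans hcI.2
  have hz : ∀ t ∉ Icc a b, φ t = 0 := fun t ht => by
    by_contra h
    exact ht (hφI (subset_tsupport _ h))
  have hint : Integrable φ := φ.continuous.integrable_of_hasCompactSupport φ.hasCompactSupport
  let F : ℝ → ℝ := fun t => ∫ s in Iic t, φ s
  have hF : ∀ t, HasDerivAt F (φ t) t := by
    intro t
    have h1 : HasDerivAt (fun t => (∫ s in (0 : ℝ)..t, φ s) + F 0) (φ t) t :=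
      (intervalIntegral.integral_hasDerivAt_right (φ.continuous.intervalIntegrable _ _)
        φ.continuous.aestronglyMeasurable.stronglyMeasurableAtFilter
        φ.continuous.continuousAt).add_const _
    have h2 : F = fun t => (∫ s in (0 : ℝ)..t, φ s) + F 0 := by
      ext t
      rw [← intervalIntegral.integral_Iic_sub_Iic hint.integrableOn hint.integrableOn]
      exact (sub_add_cancel _ _).symm
    rw [h2]
    exact h1
  have hd : deriv F = φ := funext fun t => (hF t).deriv
  have hsupp : Function.support F ⊆ Icc a b := by
    intro t ht
    by_contra h
    refine ht ?_
    rcases lt_or_ge t a with h1 | h1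
    · exact setIntegral_eq_zero_of_forall_eq_zero fun s hs => hz s fun h2 =>
        absurd (h2.1.trans hs) (not_le.2 h1)
    · have h2 : b < t := by
        by_contra h2
        exact h ⟨h1, not_lt.1 h2⟩
      have h3 : ∫ s in Ioi t, φ s = 0 := setIntegral_eq_zero_of_forall_eq_zero fun s hs =>
        hz s fun h4 => absurd (h2.trans hs) (not_lt.2 h4.2)
      have h4 := integral_add_compl (measurableSet_Iic (a := t)) hint
      rw [compl_Iic, h3, h0, add_zero] at h4
      exact h4
  refine ⟨⟨F, ?_, HasCompactSupport.of_support_subset_isCompact isCompact_Icc hsupp,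
    (closure_minimal hsupp isClosed_Icc).trans hI⟩, fun t => congrFun hd t⟩
  have hdF : Differentiable ℝ F := fun t => (hF t).differentiableAt
  have : ContDiff ℝ ((⊤ : ℕ∞) : WithTop ℕ∞) F := by
    rw [contDiff_infty_iff_deriv]
    refine ⟨hdF, ?_⟩
    rw [hd]
    exact φ.contDiff
  exact this

/-- Allows one-sided limits to be computed along points that have an almost everywhere property. -/
theorem frequently_nhdsGT_of_ae {t : ℝ} (ht : t ∈ Ω) {P : ℝ → Prop}
    (h : ∀ᵐ x ∂volume.restrict (Ω : Set ℝ), P x) : ∃ᶠ x in 𝓝[>] t, P x := by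
  intro hn
  have h1 : ∀ᶠ x in 𝓝[>] t, ¬P x ∧ x ∈ Ω :=
    hn.and (nhdsWithin_le_nhds (Ω.isOpen.mem_nhds ht))
  obtain ⟨b, hb, hs⟩ := (mem_nhdsGT_iff_exists_Ioo_subset).1 h1
  rw [ae_restrict_iff' Ω.isOpen.measurableSet, ae_iff] at h
  have h2 : volume (Ioo t b) = 0 := measure_mono_null (fun x hx => by
    have := hs hx
    simpa [this.2] using this.1) h
  rw [Real.volume_Ioo, ENNReal.ofReal_eq_zero] at h2
  exact absurd hb (not_lt.2 (sub_nonpos.1 h2))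

theorem frequently_nhdsLT_of_ae {t : ℝ} (ht : t ∈ Ω) {P : ℝ → Prop}
    (h : ∀ᵐ x ∂volume.restrict (Ω : Set ℝ), P x) : ∃ᶠ x in 𝓝[<] t, P x := by
  intro hn
  have h1 : ∀ᶠ x in 𝓝[<] t, ¬P x ∧ x ∈ Ω :=
    hn.and (nhdsWithin_le_nhds (Ω.isOpen.mem_nhds ht))
  obtain ⟨b, hb, hs⟩ := (mem_nhdsLT_iff_exists_Ioo_subset).1 h1
  rw [ae_restrict_iff' Ω.isOpen.measurableSet, ae_iff] at h
  have h2 : volume (Ioo b t) = 0 := measure_mono_null (fun x hx => by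
    have := hs hx
    simpa [this.2] using this.1) h
  rw [Real.volume_Ioo, ENNReal.ofReal_eq_zero] at h2
  exact absurd hb (not_lt.2 (sub_nonpos.1 h2))

/-- Du Bois-Reymond: with `∫ ψ = 1`, the function `φ - (∫ φ) ψ` is the derivative of a test
function, so `v` equals the constant `∫ ψ v` almost everywhere. Both one-sided limits then equal
this constant, and hence so does the balanced value. -/
theorem eq_of_derivDist_eq_zero [OrdConnected (Ω : Set ℝ)] {v : ℝ → Fin n → ℂ}
    (hv : v ∈ balancedBV Ω n) (h0 : ∀ φ : 𝓓(Ω, ℝ), derivDist v φ = 0) {c t : ℝ} (hc : c ∈ Ω)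
    (ht : t ∈ Ω) : v t = v c := by
  obtain ⟨ψ, hψ⟩ : ∃ ψ : 𝓓(Ω, ℝ), ∫ t, ψ t = 1 := by
    obtain ⟨δ, hδ, hs⟩ := Metric.nhds_basis_closedBall.mem_iff.1 (Ω.isOpen.mem_nhds hc)
    let f : ContDiffBump c := ⟨δ / 2, δ, half_pos hδ, half_lt_self hδ⟩
    refine ⟨⟨f.normed volume, f.contDiff_normed, f.hasCompactSupport_normed, ?_⟩,
      f.integral_normed⟩
    rw [f.tsupport_normed_eq]
    exact hs
  have hvol : LocFin Ω (volume.restrict (Ω : Set ℝ)) :=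
    ⟨fun K hK _ => (Measure.restrict_apply_le _ _).trans_lt hK.measure_lt_top, by
      rw [Measure.restrict_apply Ω.isOpen.measurableSet.compl]
      simp⟩
  have hres : ∀ (φ : 𝓓(Ω, ℝ)) (f : ℝ → ℂ),
      ∫ x in (Ω : Set ℝ), (φ x : ℂ) * f x = ∫ x, (φ x : ℂ) * f x := fun φ f =>
    setIntegral_eq_integral_of_forall_compl_eq_zero fun x hx => by
      rw [testFunction_eq_zero φ hx, Complex.ofReal_zero, zero_mul]
  have key : ∀ j, ∃ C : ℂ, ∀ᵐ x ∂volume.restrict (Ω : Set ℝ), v x j = C := by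
    intro j
    have hvi := hvol.locallyIntegrableOn_balancedBV hv j
    refine ⟨∫ x, (ψ x : ℂ) * v x j, ?_⟩
    have hci := hvol.locallyIntegrableOn_const (∫ x, (ψ x : ℂ) * v x j)
    have h := hvol.ae_eq_zero (hvi.sub hci) fun φ => ?_
    · filter_upwards [h] with x hx using sub_eq_zero.1 hx
    · have hφi : Integrable φ :=
        φ.continuous.integrable_of_hasCompactSupport φ.hasCompactSupport
      have hψi : Integrable ψ :=
        ψ.continuous.integrable_of_hasCompactSupport ψ.hasCompactSupport
      obtain ⟨χ, hχ⟩ := exists_deriv_eq_of_integral_eq_zero hc (φ - (∫ t, φ t) • ψ) (by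
        change ∫ t, (φ t - (∫ t, φ t) * ψ t) = 0
        rw [integral_sub hφi (hψi.const_mul _), integral_const_mul, hψ]
        ring)
      have i1 := integrable_testFunction_mul hvi φ
      have i2 := integrable_testFunction_mul hvi ψ
      have i3 := integrable_testFunction_mul hci φ
      have h1 := congrFun (h0 χ) j
      rw [derivDist, Pi.zero_apply, neg_eq_zero] at h1
      simp only [hχ] at h1
      have e : ∀ x, (((φ - (∫ t, φ t) • ψ) x : ℝ) : ℂ) * v x j =
          (φ x : ℂ) * v x j - ((∫ t, φ t : ℝ) : ℂ) * ((ψ x : ℂ) * v x j) := by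
        intro x
        change ((φ x - (∫ t, φ t) * ψ x : ℝ) : ℂ) * v x j = _
        push_cast
        ring
      rw [← hres] at h1
      simp only [e] at h1
      rw [integral_sub i1 (i2.const_mul _), integral_const_mul, sub_eq_zero, hres, hres] at h1
      simp only [Pi.sub_apply, mul_sub]
      rw [integral_sub i1 i3, hres, h1, integral_mul_const, sub_eq_zero]
      congr 1
      rw [← integral_complex_ofReal]
      have := hres φ fun _ => 1
      simpa using this.symm
  choose C hC using key
  have hconst : ∀ x ∈ Ω, ∀ j, v x j = C j := by
    intro x hx j
    obtain ⟨l, r, hl, hr, he⟩ := hv.2.1 x hx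
    have h1 := frequently_nhdsGT_of_ae hx (hC j)
    have h2 := frequently_nhdsLT_of_ae hx (hC j)
    have e1 : r j = C j := tendsto_nhds_unique_of_frequently_eq ((tendsto_pi_nhds.1 hr) j)
      tendsto_const_nhds h1
    have e2 : l j = C j := tendsto_nhds_unique_of_frequently_eq ((tendsto_pi_nhds.1 hl) j)
      tendsto_const_nhds h2
    rw [he, Pi.smul_apply, Pi.add_apply, e1, e2, smul_eq_mul]
    ring
  ext j
  rw [hconst t ht, hconst c hc]

theorem eq_add_vecPrimitive [OrdConnected (Ω : Set ℝ)] (hν : LocFin Ω ν) {u : ℝ → Fin n → ℂ}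
    (hu : u ∈ balancedBV Ω n) {g : ℝ → Fin n → ℂ}
    (hg : ∀ j, LocallyIntegrableOn (fun s => g s j) Ω ν)
    (h : ∀ (φ : 𝓓(Ω, ℝ)) j, derivDist u φ j = ∫ s, (φ s : ℂ) * g s j ∂ν) {c t : ℝ} (hc : c ∈ Ω)
    (ht : t ∈ Ω) : u t = u c + vecPrimitive Ω ν c g t := by
  have hp := vecPrimitive_mem_balancedBV hg hc
  have h1 := eq_of_derivDist_eq_zero (sub_mem hu hp) (fun φ => ?_) hc ht
  · have h2 : vecPrimitive Ω ν c g c = 0 := by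
      ext j
      rw [vecPrimitive_apply hc, primitive_self]
      rfl
    rw [Pi.sub_apply, Pi.sub_apply, h2, sub_zero] at h1
    rw [← h1, sub_add_cancel]
  · have e : u - vecPrimitive Ω ν c g = u + (-1 : ℂ) • vecPrimitive Ω ν c g := by
      rw [neg_one_smul, sub_eq_add_neg]
    rw [e, derivDist_add hu (Submodule.smul_mem _ _ hp), derivDist_smul]
    ext j
    rw [Pi.add_apply, Pi.smul_apply, h φ j, derivDist_vecPrimitive hν hg hc φ j]
    simp

end FirstOrderSystem

/-! ### Integration by parts for balanced functions -/

namespace FirstOrderSystem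

variable {Ω : Opens ℝ} {n : ℕ} {ν : Measure ℝ}

theorem exists_norm_le_of_balancedBV {u : ℝ → Fin n → ℂ} (hu : u ∈ balancedBV Ω n) {K : Set ℝ}
    (hK : IsCompact K) (hs : K ⊆ (Ω : Set ℝ)) : ∃ B : ℝ, ∀ x ∈ K, ‖u x‖ ≤ B := by
  rcases K.eq_empty_or_nonempty with h0 | h0
  · exact ⟨0, fun x hx => by simp [h0] at hx⟩
  · obtain ⟨c, hcK, hcle⟩ := hK.exists_isLeast h0
    obtain ⟨d, hdK, hdle⟩ := hK.exists_isGreatest h0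
    have hbv := hu.1 c d (hs hcK) (hs hdK)
    refine ⟨‖u c‖ + (eVariationOn u ((Ω : Set ℝ) ∩ Icc c d)).toReal, fun x hx => ?_⟩
    have h1 : dist (u x) (u c) ≤ _ := hbv.dist_le
      ⟨hs hx, hcle hx, hdle hx⟩ ⟨hs hcK, le_rfl, hcle hdK⟩
    have h3 : ‖u x‖ ≤ ‖u c‖ + dist (u x) (u c) := by
      rw [dist_eq_norm]
      exact norm_le_norm_add_norm_sub' (u x) (u c)
    linarith

theorem LocFin.locallyIntegrableOn_mul_balancedBV (hν : LocFin Ω ν) {u : ℝ → Fin n → ℂ}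
    (hu : u ∈ balancedBV Ω n) {f : ℝ → ℂ} (hf : LocallyIntegrableOn f Ω ν) (k : Fin n) :
    LocallyIntegrableOn (fun x => f x * u x k) Ω ν := by
  refine hν.locallyIntegrableOn fun K hK hs => ?_
  obtain ⟨B, hB⟩ := exists_norm_le_of_balancedBV hu hK hs
  refine (hf.integrableOn_compact_subset hs hK).mul_bdd (c := B)
    ((hν.locallyIntegrableOn_balancedBV hu k).integrableOn_compact_subset hs hK).1 ?_
  filter_upwards [ae_restrict_mem hK.measurableSet] with x hx
  exact (norm_le_pi_norm (u x) k).trans (hB x hx)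

/-- The two triangles `r < s` and `s < r` fill the square, and the diagonal is shared half and half,
so interior atoms cause no error. At the endpoints the weights `1/2` would break the identity. -/
theorem stepKernel_mul_stepKernel {c t s r : ℝ} (hs : s ∈ uIcc c t) (hr : r ∈ uIcc c t)
    (hsc : s ≠ c) (hst : s ≠ t) (hrc : r ≠ c) (hrt : r ≠ t) :
    stepKernel c t s * stepKernel c s r + stepKernel c t r * stepKernel c r s =
      stepKernel c t s * stepKernel c t r := by
  have h1 : Real.sign (s - r) + Real.sign (r - s) = 0 := by
    rw [← neg_sub s r, Real.sign_neg, add_neg_cancel]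
  unfold stepKernel
  rw [mem_uIcc] at hs hr
  rcases le_total c t with hct | hct
  · have hs1 : c < s ∧ s < t := by
      rcases hs with h | h
      · exact ⟨lt_of_le_of_ne h.1 hsc.symm, lt_of_le_of_ne h.2 hst⟩
      · exact absurd (le_antisymm (h.2.trans hct) h.1) hst
    have hr1 : c < r ∧ r < t := by
      rcases hr with h | h
      · exact ⟨lt_of_le_of_ne h.1 hrc.symm, lt_of_le_of_ne h.2 hrt⟩
      · exact absurd (le_antisymm (h.2.trans hct) h.1) hrt
    rw [Real.sign_of_pos (sub_pos.2 hs1.2), Real.sign_of_pos (sub_pos.2 hr1.2),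
      Real.sign_of_neg (sub_neg.2 hs1.1), Real.sign_of_neg (sub_neg.2 hr1.1)]
    linear_combination (1 / 2) * h1
  · have hs1 : t < s ∧ s < c := by
      rcases hs with h | h
      · exact absurd (le_antisymm (h.2.trans hct) h.1) hsc
      · exact ⟨lt_of_le_of_ne h.1 hst.symm, lt_of_le_of_ne h.2 hsc⟩
    have hr1 : t < r ∧ r < c := by
      rcases hr with h | h
      · exact absurd (le_antisymm (h.2.trans hct) h.1) hrc
      · exact ⟨lt_of_le_of_ne h.1 hrt.symm, lt_of_le_of_ne h.2 hrc⟩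
    rw [Real.sign_of_neg (sub_neg.2 hs1.1), Real.sign_of_neg (sub_neg.2 hr1.1),
      Real.sign_of_pos (sub_pos.2 hs1.2), Real.sign_of_pos (sub_pos.2 hr1.2)]
    linear_combination (-1 / 2) * h1

theorem primitive_eq_setIntegral_uIcc {E : Type*} [NormedAddCommGroup E] [NormedSpace ℝ E]
    {g : ℝ → E} {c t s : ℝ} (hs : s ∈ uIcc c t) :
    primitive ν c g s = ∫ r in uIcc c t, stepKernel c s r • g r ∂ν :=
  primitive_eq_setIntegral ⟨inf_le_left, le_sup_left⟩ hs

/-- Integration by parts for balanced antiderivatives, between points that are not atoms. -/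
theorem primitive_mul_primitive [hΩ : OrdConnected (Ω : Set ℝ)] (hν : LocFin Ω ν) {A B : ℝ → ℂ}
    (hA : LocallyIntegrableOn A Ω ν) (hB : LocallyIntegrableOn B Ω ν) {c t : ℝ} (hc : c ∈ Ω)
    (ht : t ∈ Ω) (hc0 : ν {c} = 0) (ht0 : ν {t} = 0) :
    primitive ν c A t * primitive ν c B t =
      primitive ν c (fun s => A s * primitive ν c B s + B s * primitive ν c A s) t := by
  let μ := ν.restrict (uIcc c t)
  have hfin : IsFiniteMeasure μ :=
    ⟨by simpa [μ] using hν.1 _ isCompact_uIcc (hΩ.uIcc_subset hc ht)⟩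
  have hAi : Integrable A μ := integrableOn_uIcc hA hc ht
  have hBi : Integrable B μ := integrableOn_uIcc hB hc ht
  have hk2 : ∀ f : ℝ × ℝ → ℝ × ℝ × ℝ, Measurable f →
      AEStronglyMeasurable (fun p => (stepKernel (f p).1 (f p).2.1 (f p).2.2 : ℂ)) (μ.prod μ) :=
    fun f hf => (Complex.measurable_ofReal.comp
      (measurable_stepKernel.comp hf)).aestronglyMeasurable
  have hbd : ∀ (f g : ℝ × ℝ → ℝ × ℝ × ℝ), Measurable f → Measurable g →
      Integrable (fun p : ℝ × ℝ => (stepKernel (f p).1 (f p).2.1 (f p).2.2 : ℂ) *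
        ((stepKernel (g p).1 (g p).2.1 (g p).2.2 : ℂ) * (A p.1 * B p.2))) (μ.prod μ) := by
    intro f g hf hg
    have hb : ∀ f : ℝ × ℝ → ℝ × ℝ × ℝ, ∀ p,
        ‖(stepKernel (f p).1 (f p).2.1 (f p).2.2 : ℂ)‖ ≤ 1 := fun f p => by
      rw [Complex.norm_real]
      exact abs_stepKernel_le _ _ _
    exact ((hAi.mul_prod hBi).bdd_mul (c := 1) (hk2 g hg) (Eventually.of_forall (hb g))).bdd_mul
      (c := 1) (hk2 f hf) (Eventually.of_forall (hb f))
  have iX := hbd (fun p => (c, t, p.1)) (fun p => (c, p.1, p.2)) (by fun_prop) (by fun_prop)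
  have iY := hbd (fun p => (c, t, p.2)) (fun p => (c, p.2, p.1)) (by fun_prop) (by fun_prop)
  simp only at iX iY
  have hL : primitive ν c A t * primitive ν c B t = ∫ p : ℝ × ℝ, (stepKernel c t p.1 : ℂ) *
      ((stepKernel c t p.2 : ℂ) * (A p.1 * B p.2)) ∂(μ.prod μ) := by
    rw [primitive_eq_setIntegral_uIcc right_mem_uIcc, primitive_eq_setIntegral_uIcc right_mem_uIcc,
      ← integral_prod_mul]
    refine integral_congr_ae (Eventually.of_forall fun p => ?_)
    simp only [Complex.real_smul]
    ring
  have hX : ∫ p : ℝ × ℝ, (stepKernel c t p.1 : ℂ) *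
      ((stepKernel c p.1 p.2 : ℂ) * (A p.1 * B p.2)) ∂(μ.prod μ) =
      ∫ s in uIcc c t, stepKernel c t s • (A s * primitive ν c B s) ∂ν := by
    rw [integral_prod _ iX]
    refine setIntegral_congr_fun measurableSet_uIcc fun s hs => ?_
    simp only
    rw [primitive_eq_setIntegral_uIcc hs, ← integral_const_mul, ← integral_smul]
    refine integral_congr_ae (Eventually.of_forall fun r => ?_)
    simp only [Complex.real_smul]
    ring
  have hY : ∫ p : ℝ × ℝ, (stepKernel c t p.2 : ℂ) *
      ((stepKernel c p.2 p.1 : ℂ) * (A p.1 * B p.2)) ∂(μ.prod μ) =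
      ∫ s in uIcc c t, stepKernel c t s • (B s * primitive ν c A s) ∂ν := by
    rw [integral_prod_symm _ iY]
    refine setIntegral_congr_fun measurableSet_uIcc fun s hs => ?_
    simp only
    rw [primitive_eq_setIntegral_uIcc hs, ← integral_const_mul, ← integral_smul]
    refine integral_congr_ae (Eventually.of_forall fun r => ?_)
    simp only [Complex.real_smul]
    ring
  have jX : Integrable (fun s => stepKernel c t s • (A s * primitive ν c B s)) μ := by
    refine iX.integral_prod_left.congr ?_
    filter_upwards [ae_restrict_mem measurableSet_uIcc] with s hs
    rw [primitive_eq_setIntegral_uIcc hs, ← integral_const_mul, ← integral_smul]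
    refine integral_congr_ae (Eventually.of_forall fun r => ?_)
    simp only [Complex.real_smul]
    ring
  have jY : Integrable (fun s => stepKernel c t s • (B s * primitive ν c A s)) μ := by
    refine iY.integral_prod_right.congr ?_
    filter_upwards [ae_restrict_mem measurableSet_uIcc] with s hs
    rw [primitive_eq_setIntegral_uIcc hs, ← integral_const_mul, ← integral_smul]
    refine integral_congr_ae (Eventually.of_forall fun r => ?_)
    simp only [Complex.real_smul]
    ring
  -- Both sides are now double integrals over the square; by `stepKernel_mul_stepKernel` the
  -- integrands agree off the edges, which are null since `c` and `t` are not atoms.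
  rw [hL, primitive_eq_setIntegral_uIcc right_mem_uIcc]
  simp only [smul_add]
  rw [integral_add jX jY, ← hX, ← hY, ← integral_add iX iY]
  have hae : ∀ᵐ s ∂μ, s ∈ uIcc c t ∧ s ≠ c ∧ s ≠ t := by
    have h1 : ∀ᵐ s ∂ν, s ≠ c := by
      rw [ae_iff]; simpa using hc0
    have h2 : ∀ᵐ s ∂ν, s ≠ t := by
      rw [ae_iff]; simpa using ht0
    filter_upwards [ae_restrict_mem measurableSet_uIcc, ae_restrict_of_ae h1,
      ae_restrict_of_ae h2] with s a1 a2 a3 using ⟨a1, a2, a3⟩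
  refine integral_congr_ae ?_
  filter_upwards [Measure.quasiMeasurePreserving_fst.ae hae,
    Measure.quasiMeasurePreserving_snd.ae hae] with p hp1 hp2
  have h := stepKernel_mul_stepKernel hp1.1 hp2.1 hp1.2.1 hp1.2.2 hp2.2.1 hp2.2.2
  have h' : (stepKernel c t p.1 : ℂ) * stepKernel c p.1 p.2 +
      stepKernel c t p.2 * stepKernel c p.2 p.1 = stepKernel c t p.1 * stepKernel c t p.2 := by
    exact_mod_cast h
  linear_combination (-(A p.1 * B p.2)) * h'

theorem countable_atoms [SigmaFinite ν] : {x | ν {x} ≠ 0}.Countable := by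
  have h := Measure.countable_meas_pos_of_disjoint_iUnion (μ := ν) (As := fun x : ℝ => {x})
    (fun x => measurableSet_singleton x) (fun x y hxy => disjoint_singleton.2 hxy)
  exact h.mono fun x hx => pos_iff_ne_zero.2 hx

end FirstOrderSystem

/-! ### Homogeneous solutions: jumps and absence of zeros -/

namespace FirstOrderSystem

variable {Ω : Opens ℝ} {n : ℕ} {ν : Measure ℝ}

/-- The density of `u'` for a solution `u` of `J u' + Q u ν = 0`. -/
noncomputable def slope (J : Matrix (Fin n) (Fin n) ℂ) (Q : ℝ → Matrix (Fin n) (Fin n) ℂ)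
    (u : ℝ → Fin n → ℂ) (x : ℝ) : Fin n → ℂ :=
  -(J⁻¹ *ᵥ (Q x *ᵥ u x))

/-- `u` solves `J u' + Q u ν = 0` on `Ω`, and `2J ± Q ν{x}` is invertible at each point. -/
structure IsHomogeneousSolution (Ω : Opens ℝ) (ν : Measure ℝ) (J : Matrix (Fin n) (Fin n) ℂ)
    (Q : ℝ → Matrix (Fin n) (Fin n) ℂ) (u : ℝ → Fin n → ℂ) : Prop where
  locFin : LocFin Ω ν
  isUnit : IsUnit J
  locallyIntegrableOn : ∀ j k, LocallyIntegrableOn (fun x => Q x j k) Ω ν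
  isUnit_add : ∀ x ∈ Ω, IsUnit ((2 : ℂ) • J + (ν.real {x} : ℂ) • Q x)
  isUnit_sub : ∀ x ∈ Ω, IsUnit ((2 : ℂ) • J - (ν.real {x} : ℂ) • Q x)
  mem : u ∈ balancedBV Ω n
  derivDist_eq : ∀ (φ : 𝓓(Ω, ℝ)) j, derivDist u φ j = ∫ s, (φ s : ℂ) * slope J Q u s j ∂ν

namespace IsHomogeneousSolution

variable {J : Matrix (Fin n) (Fin n) ℂ} {Q : ℝ → Matrix (Fin n) (Fin n) ℂ} {u : ℝ → Fin n → ℂ}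

theorem mulVec_slope (h : IsHomogeneousSolution Ω ν J Q u) (x : ℝ) :
    J *ᵥ slope J Q u x = -(Q x *ᵥ u x) := by
  rw [slope, Matrix.mulVec_neg, Matrix.mulVec_mulVec,
    Matrix.mul_nonsing_inv _ ((Matrix.isUnit_iff_isUnit_det _).1 h.isUnit), Matrix.one_mulVec]

theorem locallyIntegrableOn_slope (h : IsHomogeneousSolution Ω ν J Q u) (j : Fin n) :
    LocallyIntegrableOn (fun x => slope J Q u x j) Ω ν := by
  refine h.locFin.locallyIntegrableOn fun K hK hs => ?_
  simp only [slope, Matrix.mulVec, dotProduct, Pi.neg_apply]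
  refine (integrable_finsetSum _ fun k _ => ?_).neg
  refine (integrable_finsetSum _ fun l _ => ?_).const_mul _
  exact (h.locFin.locallyIntegrableOn_mul_balancedBV h.mem (h.locallyIntegrableOn k l)
    l).integrableOn_compact_subset hs hK

theorem eq_add [OrdConnected (Ω : Set ℝ)] (h : IsHomogeneousSolution Ω ν J Q u) {c t : ℝ}
    (hc : c ∈ Ω) (ht : t ∈ Ω) : u t = u c + vecPrimitive Ω ν c (slope J Q u) t :=
  eq_add_vecPrimitive h.locFin h.mem h.locallyIntegrableOn_slope h.derivDist_eq hc ht

theorem tendsto_right [OrdConnected (Ω : Set ℝ)] (h : IsHomogeneousSolution Ω ν J Q u) {t : ℝ}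
    (ht : t ∈ Ω) :
    Tendsto u (𝓝[>] t) (𝓝 (u t + ((ν.real {t} / 2 : ℝ) : ℂ) • slope J Q u t)) := by
  have h1 := (tendsto_vecPrimitive_right h.locallyIntegrableOn_slope ht ht).const_add (u t)
  rw [← add_assoc, ← h.eq_add ht ht] at h1
  refine h1.congr' ?_
  filter_upwards [nhdsWithin_le_nhds (Ω.isOpen.mem_nhds ht)] with x hx
  exact (h.eq_add ht hx).symm

theorem tendsto_left [OrdConnected (Ω : Set ℝ)] (h : IsHomogeneousSolution Ω ν J Q u) {t : ℝ}
    (ht : t ∈ Ω) :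
    Tendsto u (𝓝[<] t) (𝓝 (u t - ((ν.real {t} / 2 : ℝ) : ℂ) • slope J Q u t)) := by
  have h1 := (tendsto_vecPrimitive_left h.locallyIntegrableOn_slope ht ht).const_add (u t)
  rw [← add_sub_assoc, ← h.eq_add ht ht] at h1
  refine h1.congr' ?_
  filter_upwards [nhdsWithin_le_nhds (Ω.isOpen.mem_nhds ht)] with x hx
  exact (h.eq_add ht hx).symm

theorem eq_zero_of_isUnit {A : Matrix (Fin n) (Fin n) ℂ} (hA : IsUnit A) {v : Fin n → ℂ}
    (h : A *ᵥ v = 0) : v = 0 := by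
  have := Matrix.mulVec_injective_iff_isUnit.2 hA
  exact this (by rw [h, Matrix.mulVec_zero])

/-- For the right limit `u⁺` one has `2 J u⁺ = (2J - Q ν{t}) u`, an invertible matrix applied to
`u`. The left limit uses the other sign. -/
theorem right_ne_zero (h : IsHomogeneousSolution Ω ν J Q u) {t : ℝ} (ht : t ∈ Ω) (h0 : u t ≠ 0) :
    u t + ((ν.real {t} / 2 : ℝ) : ℂ) • slope J Q u t ≠ 0 := by
  intro h1
  refine h0 (eq_zero_of_isUnit (h.isUnit_sub t ht) ?_)
  have h2 : (2 : ℂ) • J *ᵥ (u t + ((ν.real {t} / 2 : ℝ) : ℂ) • slope J Q u t) = 0 := by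
    rw [h1, Matrix.mulVec_zero, smul_zero]
  rw [Matrix.mulVec_add, Matrix.mulVec_smul, h.mulVec_slope, smul_add, smul_smul] at h2
  rw [Matrix.sub_mulVec, Matrix.smul_mulVec, Matrix.smul_mulVec, ← h2, smul_neg, sub_eq_add_neg]
  congr 3
  push_cast
  ring

theorem left_ne_zero (h : IsHomogeneousSolution Ω ν J Q u) {t : ℝ} (ht : t ∈ Ω) (h0 : u t ≠ 0) :
    u t - ((ν.real {t} / 2 : ℝ) : ℂ) • slope J Q u t ≠ 0 := by
  intro h1
  refine h0 (eq_zero_of_isUnit (h.isUnit_add t ht) ?_)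
  have h2 : (2 : ℂ) • J *ᵥ (u t - ((ν.real {t} / 2 : ℝ) : ℂ) • slope J Q u t) = 0 := by
    rw [h1, Matrix.mulVec_zero, smul_zero]
  rw [Matrix.mulVec_sub, Matrix.mulVec_smul, h.mulVec_slope, smul_sub, smul_smul] at h2
  rw [Matrix.add_mulVec, Matrix.smul_mulVec, Matrix.smul_mulVec, ← h2, smul_neg, sub_neg_eq_add]
  congr 2
  push_cast
  ring

/-- A lower bound `δ` below `‖u‖` and both one-sided norms at `t` persists nearby, and it passes to
the one-sided limits at the nearby points. The uniformity is needed later to bound `atomFactor` over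
infinitely many atoms. -/
theorem eventually_norm_ge [OrdConnected (Ω : Set ℝ)] (h : IsHomogeneousSolution Ω ν J Q u)
    {t : ℝ} (ht : t ∈ Ω) (h0 : u t ≠ 0) : ∃ δ > 0, ∀ᶠ x in 𝓝 t, δ ≤ ‖u x‖ ∧
      δ ≤ ‖u x + ((ν.real {x} / 2 : ℝ) : ℂ) • slope J Q u x‖ ∧
      δ ≤ ‖u x - ((ν.real {x} / 2 : ℝ) : ℂ) • slope J Q u x‖ := by
  have hr := norm_pos_iff.2 (h.right_ne_zero ht h0)
  have hl := norm_pos_iff.2 (h.left_ne_zero ht h0)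
  have hm := norm_pos_iff.2 h0
  obtain ⟨δ, hδ, h1⟩ := exists_between (lt_min hm (lt_min hr hl))
  rw [lt_min_iff, lt_min_iff] at h1
  have hΩ : ∀ᶠ x in 𝓝 t, x ∈ Ω := Ω.isOpen.mem_nhds ht
  have hloc : ∀ x ∈ Ω, (∀ᶠ y in 𝓝 x, δ < ‖u y‖) → δ ≤ ‖u x‖ ∧
      δ ≤ ‖u x + ((ν.real {x} / 2 : ℝ) : ℂ) • slope J Q u x‖ ∧
      δ ≤ ‖u x - ((ν.real {x} / 2 : ℝ) : ℂ) • slope J Q u x‖ := fun x hx he =>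
    ⟨he.self_of_nhds.le,
      ge_of_tendsto (h.tendsto_right hx).norm
        (Eventually.mono (nhdsWithin_le_nhds he) fun _ hy => hy.le),
      ge_of_tendsto (h.tendsto_left hx).norm
        (Eventually.mono (nhdsWithin_le_nhds he) fun _ hy => hy.le)⟩
  refine ⟨δ, hδ, ?_⟩
  rw [← nhdsNE_sup_pure, ← nhdsLT_sup_nhdsGT, eventually_sup, eventually_sup, eventually_pure]
  refine ⟨⟨?_, ?_⟩, h1.1.le, h1.2.1.le, h1.2.2.le⟩
  · have e := (h.tendsto_left ht).norm.eventually (lt_mem_nhds h1.2.2)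
    -- The bound holds on a whole neighbourhood of each nearby point on this side of `t`, so `hloc`
    -- applies there.
    rw [← eventually_eventually_nhdsWithin] at e
    filter_upwards [e, self_mem_nhdsWithin, nhdsWithin_le_nhds hΩ] with x hx hxt hxΩ
    rw [isOpen_Iio.nhdsWithin_eq hxt] at hx
    exact hloc x hxΩ hx
  · have e := (h.tendsto_right ht).norm.eventually (lt_mem_nhds h1.2.1)
    rw [← eventually_eventually_nhdsWithin] at e
    filter_upwards [e, self_mem_nhdsWithin, nhdsWithin_le_nhds hΩ] with x hx hxt hxΩ
    rw [isOpen_Ioi.nhdsWithin_eq hxt] at hx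
    exact hloc x hxΩ hx

/-- A Gronwall argument. Since `u t = 0`, an atom at `t` does not act on `u`, and the remaining
coefficient mass on a small ball is at most `1/2`. The integral equation then halves any bound for
`u` on that ball. -/
theorem eventually_eq_zero [hΩ : OrdConnected (Ω : Set ℝ)] (h : IsHomogeneousSolution Ω ν J Q u)
    {t : ℝ} (ht : t ∈ Ω) (h0 : u t = 0) : ∀ᶠ x in 𝓝 t, u x = 0 := by
  let N : ℝ → ℝ := fun s => ∑ j, ∑ k, ‖(J⁻¹ * Q s) j k‖
  have hN0 : ∀ s, 0 ≤ N s := fun s =>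
    Finset.sum_nonneg fun _ _ => Finset.sum_nonneg fun _ _ => norm_nonneg _
  have hN : LocallyIntegrableOn N Ω ν := by
    refine h.locFin.locallyIntegrableOn fun K hK hs => ?_
    refine integrable_finsetSum _ fun j _ => integrable_finsetSum _ fun k _ => Integrable.norm ?_
    simp only [Matrix.mul_apply]
    exact integrable_finsetSum _ fun l _ =>
      ((h.locallyIntegrableOn l k).integrableOn_compact_subset hs hK).const_mul _
  have hg : ∀ s j, ‖slope J Q u s j‖ ≤ N s * ‖u s‖ := by
    intro s j
    rw [slope, Pi.neg_apply, norm_neg, Matrix.mulVec_mulVec]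
    simp only [Matrix.mulVec, dotProduct]
    refine (norm_sum_le _ _).trans ?_
    have h1 : ∑ k, ‖(J⁻¹ * Q s) j k * u s k‖ ≤ (∑ k, ‖(J⁻¹ * Q s) j k‖) * ‖u s‖ := by
      rw [Finset.sum_mul]
      refine Finset.sum_le_sum fun k _ => ?_
      rw [norm_mul]
      exact mul_le_mul_of_nonneg_left (norm_le_pi_norm _ k) (norm_nonneg _)
    refine h1.trans (mul_le_mul_of_nonneg_right ?_ (norm_nonneg _))
    exact Finset.single_le_sum (f := fun j => ∑ k, ‖(J⁻¹ * Q s) j k‖)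
      (fun _ _ => Finset.sum_nonneg fun _ _ => norm_nonneg _) (Finset.mem_univ j)
  -- Removing the point `t` is essential: the mass of an atom there would not become small on
  -- shrinking balls.
  let N' : ℝ → ℝ := indicator {t}ᶜ N
  have hN'0 : ∀ s, 0 ≤ N' s := fun s => indicator_nonneg (fun s _ => hN0 s) s
  obtain ⟨δ, hδ, hs⟩ := Metric.nhds_basis_closedBall.mem_iff.1 (Ω.isOpen.mem_nhds ht)
  have hN'i : IntegrableOn N' (Metric.closedBall t δ) ν :=
    (hN.integrableOn_compact_subset hs (isCompact_closedBall t δ)).indicator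
      (measurableSet_singleton t).compl
  obtain ⟨ε, hε, hεδ, hsmall⟩ : ∃ ε > 0, ε ≤ δ ∧
      ∫ s in Metric.closedBall t ε, N' s ∂ν ≤ 1 / 2 := by
    let r : ℕ → ℝ := fun m => δ / (m + 1)
    have hr : ∀ m, 0 < r m := fun m => div_pos hδ (by positivity)
    have hrδ : ∀ m, r m ≤ δ := fun m => div_le_self hδ.le (by linarith [m.cast_nonneg (α := ℝ)])
    have hanti : Antitone r := fun a b hab =>
      div_le_div_of_nonneg_left hδ.le (by positivity) (by gcongr)
    have hr0 : Tendsto r atTop (𝓝 0) :=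
      tendsto_const_nhds.div_atTop (tendsto_atTop_add_const_right _ _ tendsto_natCast_atTop_atTop)
    have h1 := tendsto_setIntegral_of_antitone (μ := ν) (f := N')
      (s := fun m => Metric.closedBall t (r m)) (fun m => measurableSet_closedBall)
      (fun a b hab => Metric.closedBall_subset_closedBall (hanti hab))
      ⟨0, hN'i.mono_set (Metric.closedBall_subset_closedBall (hrδ 0))⟩
    have h2 : ⋂ m, Metric.closedBall t (r m) = {t} := by
      ext x
      simp only [mem_iInter, Metric.mem_closedBall, mem_singleton_iff]
      refine ⟨fun hx => ?_, fun hx m => by rw [hx, dist_self]; exact (hr m).le⟩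
      exact dist_le_zero.1 (ge_of_tendsto' hr0 hx)
    rw [h2, integral_singleton] at h1
    have h3 : N' t = 0 := indicator_of_notMem (by simp) _
    rw [h3, smul_zero] at h1
    obtain ⟨m, hm⟩ := (h1.eventually (gt_mem_nhds (by norm_num : (0 : ℝ) < 1 / 2))).exists
    exact ⟨r m, hr m, hrδ m, hm.le⟩
  have hsub : Metric.closedBall t ε ⊆ (Ω : Set ℝ) :=
    (Metric.closedBall_subset_closedBall hεδ).trans hs
  have hstep : ∀ B : ℝ, (∀ x ∈ Metric.closedBall t ε, ‖u x‖ ≤ B) →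
      ∀ x ∈ Metric.closedBall t ε, ‖u x‖ ≤ B / 2 := by
    intro B hB x hx
    have hB0 : 0 ≤ B := (norm_nonneg _).trans (hB x hx)
    refine (pi_norm_le_iff_of_nonneg (by positivity)).2 fun j => ?_
    have hsubx : uIcc t x ⊆ Metric.closedBall t ε := by
      rw [Real.closedBall_eq_Icc] at hx ⊢
      exact uIcc_subset_Icc ⟨by linarith, by linarith⟩ hx
    rw [h.eq_add ht (hsub hx), h0, zero_add, vecPrimitive_apply (hsub hx)]
    refine (norm_primitive_le_setIntegral (h.locallyIntegrableOn_slope j) ht (hsub hx)).trans ?_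
    have hi := hN'i.mono_set (Metric.closedBall_subset_closedBall hεδ)
    calc ∫ s in uIcc t x, ‖slope J Q u s j‖ ∂ν ≤ ∫ s in uIcc t x, N' s * B ∂ν := by
          refine setIntegral_mono_on (integrableOn_uIcc (h.locallyIntegrableOn_slope j) ht
            (hsub hx)).norm ((hi.mono_set hsubx).mul_const B) measurableSet_uIcc fun s hs => ?_
          refine (hg s j).trans ?_
          by_cases hst : s = t
          · rw [hst, h0, norm_zero, mul_zero]
            exact mul_nonneg (hN'0 _) hB0
          · have : N' s = N s := indicator_of_mem (show s ∈ ({t} : Set ℝ)ᶜ from hst) _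
            rw [this]
            exact mul_le_mul_of_nonneg_left (hB s (hsubx hs)) (hN0 s)
      _ ≤ ∫ s in Metric.closedBall t ε, N' s * B ∂ν :=
          setIntegral_mono_set (hi.mul_const B)
            (Eventually.of_forall fun s => mul_nonneg (hN'0 s) hB0) hsubx.eventuallyLE
      _ = (∫ s in Metric.closedBall t ε, N' s ∂ν) * B := integral_mul_const _ _
      _ ≤ 1 / 2 * B := mul_le_mul_of_nonneg_right hsmall hB0
      _ = B / 2 := by ring
  obtain ⟨B, hB⟩ := exists_norm_le_of_balancedBV h.mem (isCompact_closedBall t ε) hsub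
  have hiter : ∀ m : ℕ, ∀ x ∈ Metric.closedBall t ε, ‖u x‖ ≤ B * (1 / 2) ^ m := by
    intro m
    induction m with
    | zero => simpa using hB
    | succ m ih =>
      intro x hx
      have := hstep _ ih x hx
      rw [pow_succ]
      linarith
  filter_upwards [Metric.closedBall_mem_nhds t hε] with x hx
  have hlim : Tendsto (fun m : ℕ => B * (1 / 2 : ℝ) ^ m) atTop (𝓝 (B * 0)) :=
    (tendsto_pow_atTop_nhds_zero_of_lt_one (by norm_num) (by norm_num)).const_mul B
  rw [mul_zero] at hlim
  exact norm_le_zero_iff.1 (ge_of_tendsto' hlim fun m => hiter m x hx)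

/-- The zeros form an open set by `eventually_eq_zero` and the non-zeros by `eventually_norm_ge`;
the interval is connected. -/
theorem ne_zero [hΩ : OrdConnected (Ω : Set ℝ)] (h : IsHomogeneousSolution Ω ν J Q u)
    (hu : u ≠ 0) {x : ℝ} (hx : x ∈ Ω) : u x ≠ 0 := by
  intro hx0
  obtain ⟨y, hy⟩ : ∃ y, u y ≠ 0 := by
    by_contra hn
    push Not at hn
    exact hu (funext hn)
  have hyΩ : y ∈ Ω := by
    by_contra hn
    exact hy (h.mem.2.2 y hn)
  have hU : IsOpen {x | x ∈ Ω ∧ u x = 0} := isOpen_iff_mem_nhds.2 fun z hz =>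
    Filter.inter_mem (Ω.isOpen.mem_nhds hz.1) (h.eventually_eq_zero hz.1 hz.2)
  have hV : IsOpen {x | x ∈ Ω ∧ u x ≠ 0} := isOpen_iff_mem_nhds.2 fun z hz => by
    obtain ⟨δ, hδ, he⟩ := h.eventually_norm_ge hz.1 hz.2
    refine Filter.inter_mem (Ω.isOpen.mem_nhds hz.1) ?_
    filter_upwards [he] with w hw
    exact norm_pos_iff.1 (hδ.trans_le hw.1)
  obtain ⟨z, -, hz1, hz2⟩ := hΩ.isPreconnected _ _ hU hV
    (fun z hz => (em (u z = 0)).imp (fun h1 => ⟨hz, h1⟩) fun h1 => ⟨hz, h1⟩)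
    ⟨x, hx, hx, hx0⟩ ⟨y, hyΩ, hyΩ, hy⟩
  exact hz2.2 hz1.2

end IsHomogeneousSolution

end FirstOrderSystem

/-! ### Reduction of order in dimension two -/

namespace FirstOrderSystem

variable {Ω : Opens ℝ} {n : ℕ} {ν : Measure ℝ}

theorem LocFin.exists_mem_not_atom (hν : LocFin Ω ν) (hne : (Ω : Set ℝ).Nonempty) :
    ∃ c ∈ Ω, ν {c} = 0 := by
  have := hν.sigmaFinite
  obtain ⟨c, hc, hc'⟩ := (countable_atoms (ν := ν)).dense_compl ℝ |>.inter_open_nonempty _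
    Ω.isOpen hne
  exact ⟨c, hc, not_not.1 hc'⟩

theorem frequently_not_atom (hν : LocFin Ω ν) {t : ℝ} (ht : t ∈ Ω) :
    ∃ᶠ x in 𝓝[>] t, ν {x} = 0 := by
  have := hν.sigmaFinite
  refine frequently_nhdsGT_of_ae ht (ae_restrict_of_ae ?_)
  filter_upwards [(countable_atoms (ν := ν)).ae_notMem volume] with x hx
  exact not_not.1 hx

/-- The product rule: `β u` is the balanced antiderivative of `ρ u + β u'` up to a correction at
the atoms. -/
theorem IsHomogeneousSolution.vecPrimitive_eq [hΩ : OrdConnected (Ω : Set ℝ)]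
    {J : Matrix (Fin n) (Fin n) ℂ} {Q : ℝ → Matrix (Fin n) (Fin n) ℂ} {u : ℝ → Fin n → ℂ}
    (h : IsHomogeneousSolution Ω ν J Q u) {ρ : ℝ → ℂ} (hρ : LocallyIntegrableOn ρ Ω ν)
    {G : ℝ → Fin n → ℂ} (hG : ∀ j, LocallyIntegrableOn (fun s => G s j) Ω ν) {c : ℝ} (hc : c ∈ Ω)
    (hc0 : ν {c} = 0)
    (hGe : ∀ s ∈ Ω, G s = ρ s • u s + primitive ν c ρ s • slope J Q u s) {t : ℝ} (ht : t ∈ Ω) :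
    vecPrimitive Ω ν c G t = primitive ν c ρ t • u t +
      ((ν.real {t} : ℂ) ^ 2 / 4 * ρ t) • slope J Q u t := by
  have hg := h.locallyIntegrableOn_slope
  have hu : ∀ s ∈ Ω, ∀ j, u s j = u c j + primitive ν c (fun s => slope J Q u s j) s := by
    intro s hs j
    rw [h.eq_add hc hs, Pi.add_apply, vecPrimitive_apply hs]
  -- Away from atoms the plain product rule holds, by integration by parts applied to `primitive ν c
  -- ρ` and to `u - u c`.
  have hna : ∀ x ∈ Ω, ν {x} = 0 → ∀ j,
      vecPrimitive Ω ν c G x j = primitive ν c ρ x * u x j := by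
    intro x hx hx0 j
    have e : primitive ν c (fun s => G s j) x = u c j * primitive ν c ρ x +
        primitive ν c (fun s => ρ s * primitive ν c (fun s => slope J Q u s j) s +
          slope J Q u s j * primitive ν c ρ s) x := by
      have e1 : ∀ᵐ s ∂ν, stepKernel c x s • (ρ s * primitive ν c (fun s => slope J Q u s j) s +
          slope J Q u s j * primitive ν c ρ s) =
          stepKernel c x s • G s j - u c j * (stepKernel c x s • ρ s) := by
        filter_upwards [h.locFin.ae_mem] with s hs
        rw [hGe s hs, Pi.add_apply, Pi.smul_apply, Pi.smul_apply, hu s hs j]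
        simp only [Complex.real_smul, smul_eq_mul]
        ring
      have e2 : primitive ν c (fun s => ρ s * primitive ν c (fun s => slope J Q u s j) s +
          slope J Q u s j * primitive ν c ρ s) x =
          primitive ν c (fun s => G s j) x - u c j * primitive ν c ρ x := by
        rw [primitive, integral_congr_ae e1,
          integral_sub (integrable_stepKernel_smul (hG j) hc hx)
          ((integrable_stepKernel_smul hρ hc hx).const_mul _), integral_const_mul]
        rfl
      rw [e2]
      ring
    rw [vecPrimitive_apply hx, e, ← primitive_mul_primitive h.locFin hρ (hg j) hc hx hc0 hx0,
      hu x hx j]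
    ring
  ext j
  have l1 := (tendsto_pi_nhds.1 (tendsto_vecPrimitive_right hG hc ht)) j
  have l2 := (tendsto_primitive_right hρ hc ht).mul ((tendsto_pi_nhds.1 (h.tendsto_right ht)) j)
  have hf : ∃ᶠ x in 𝓝[>] t, vecPrimitive Ω ν c G x j = primitive ν c ρ x * u x j := by
    have hΩt : ∀ᶠ x in 𝓝[>] t, x ∈ Ω := nhdsWithin_le_nhds (Ω.isOpen.mem_nhds ht)
    exact ((frequently_not_atom h.locFin ht).and_eventually hΩt).mono
      fun x hx => hna x hx.2 hx.1 j
  -- At an atom the right limits of both sides are compared along non-atoms. Expanding the product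
  -- of right limits leaves the product of the two half jumps, which is the quadratic correction.
  have e := tendsto_nhds_unique_of_frequently_eq l1 l2 hf
  rw [hGe t ht] at e
  simp only [Pi.add_apply, Pi.smul_apply, smul_eq_mul, Complex.real_smul] at e ⊢
  push_cast at e
  linear_combination e

section Planar

variable {J : Matrix (Fin 2) (Fin 2) ℂ} {Q : ℝ → Matrix (Fin 2) (Fin 2) ℂ} {u F : ℝ → Fin 2 → ℂ}

theorem mulVec_of_transpose_eq_neg (hJT : Jᵀ = -J) (v : Fin 2 → ℂ) :
    J *ᵥ v = ![J 0 1 * v 1, -(J 0 1 * v 0)] := by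
  have h : ∀ j k, J k j = -J j k := fun j k => congrFun (congrFun hJT j) k
  have h00 : J 0 0 = 0 := by have := h 0 0; linear_combination this / 2
  have h11 : J 1 1 = 0 := by have := h 1 1; linear_combination this / 2
  ext j
  fin_cases j
  · simp [Matrix.mulVec, dotProduct, Fin.sum_univ_two, h00]
  · simp [Matrix.mulVec, dotProduct, Fin.sum_univ_two, h11, h 0 1]

theorem apply_zero_one_ne_zero (hJ : IsUnit J) (hJT : Jᵀ = -J) : J 0 1 ≠ 0 := by
  intro h0
  have h : ∀ j k, J k j = -J j k := fun j k => congrFun (congrFun hJT j) k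
  have hd := (Matrix.isUnit_iff_isUnit_det _).1 hJ
  rw [Matrix.det_fin_two, h0, h 0 1, h0] at hd
  have h00 : J 0 0 = 0 := by have := h 0 0; linear_combination this / 2
  simp [h00] at hd

/-- The coefficient of `f` with respect to `J v`, if these are collinear. -/
noncomputable def coeffAlong (J : Matrix (Fin 2) (Fin 2) ℂ) (v f : Fin 2 → ℂ) : ℂ :=
  (conj (v 1) * f 0 - conj (v 0) * f 1) / (J 0 1 * (conj (v 0) * v 0 + conj (v 1) * v 1))

theorem sum_conj_mul_self (v : Fin 2 → ℂ) :
    conj (v 0) * v 0 + conj (v 1) * v 1 = ((‖v 0‖ ^ 2 + ‖v 1‖ ^ 2 : ℝ) : ℂ) := by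
  rw [Complex.conj_mul', Complex.conj_mul']
  push_cast
  rfl

theorem sq_norm_le (v : Fin 2 → ℂ) : ‖v‖ ^ 2 ≤ ‖v 0‖ ^ 2 + ‖v 1‖ ^ 2 := by
  have h : ‖v‖ ≤ √(‖v 0‖ ^ 2 + ‖v 1‖ ^ 2) := by
    refine (pi_norm_le_iff_of_nonneg (Real.sqrt_nonneg _)).2 fun j => ?_
    refine Real.le_sqrt_of_sq_le ?_
    fin_cases j
    · exact le_add_of_nonneg_right (sq_nonneg _)
    · exact le_add_of_nonneg_left (sq_nonneg _)
  calc ‖v‖ ^ 2 ≤ √(‖v 0‖ ^ 2 + ‖v 1‖ ^ 2) ^ 2 := by gcongr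
    _ = _ := Real.sq_sqrt (by positivity)

/-- Skew-symmetry gives `vᵀ J v = 0`, and in dimension two the vectors annihilated by `vᵀ` form a
line; so `f` lies on the line of `J v`. -/
theorem coeffAlong_smul (hJ : IsUnit J) (hJT : Jᵀ = -J) {v f : Fin 2 → ℂ} (hv : v ≠ 0)
    (hvf : v ⬝ᵥ f = 0) : coeffAlong J v f • J *ᵥ v = f := by
  have hb := apply_zero_one_ne_zero hJ hJT
  have hs : conj (v 0) * v 0 + conj (v 1) * v 1 ≠ 0 := by
    rw [sum_conj_mul_self, Complex.ofReal_ne_zero]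
    have h2 := norm_pos_iff.2 hv
    exact ((pow_pos h2 2).trans_le (sq_norm_le v)).ne'
  rw [dotProduct, Fin.sum_univ_two] at hvf
  rw [mulVec_of_transpose_eq_neg hJT, coeffAlong]
  ext j
  fin_cases j
  · simp only [Pi.smul_apply, smul_eq_mul, Fin.zero_eta, Matrix.cons_val_zero]
    rw [div_mul_eq_mul_div, div_eq_iff (mul_ne_zero hb hs)]
    linear_combination -(J 0 1 * conj (v 0)) * hvf
  · simp only [Pi.smul_apply, smul_eq_mul, Fin.mk_one, Matrix.cons_val_one, Matrix.cons_val_zero]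
    rw [div_mul_eq_mul_div, div_eq_iff (mul_ne_zero hb hs)]
    linear_combination -(J 0 1 * conj (v 1)) * hvf

theorem norm_coeffAlong_le {v f : Fin 2 → ℂ} {δ B : ℝ} (hδ : 0 < δ) (hv : δ ≤ ‖v‖)
    (hB : ‖v‖ ≤ B) : ‖coeffAlong J v f‖ ≤ B / (‖J 0 1‖ * δ ^ 2) * (‖f 0‖ + ‖f 1‖) := by
  rw [coeffAlong, norm_div, norm_mul, sum_conj_mul_self, Complex.norm_real,
    Real.norm_of_nonneg (by positivity)]
  have hn : ‖conj (v 1) * f 0 - conj (v 0) * f 1‖ ≤ B * (‖f 0‖ + ‖f 1‖) := by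
    refine (norm_sub_le _ _).trans ?_
    rw [norm_mul, norm_mul, RCLike.norm_conj, RCLike.norm_conj, mul_add]
    exact add_le_add (mul_le_mul_of_nonneg_right ((norm_le_pi_norm v 1).trans hB) (norm_nonneg _))
      (mul_le_mul_of_nonneg_right ((norm_le_pi_norm v 0).trans hB) (norm_nonneg _))
  have hB0 : 0 ≤ B := (norm_nonneg _).trans hB
  have hd : δ ^ 2 ≤ ‖v 0‖ ^ 2 + ‖v 1‖ ^ 2 := le_trans (by gcongr) (sq_norm_le v)
  rcases eq_or_ne (J 0 1) 0 with h0 | h0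
  · simp [h0]
  · have hb := norm_pos_iff.2 h0
    rw [div_mul_eq_mul_div]
    gcongr

/-- The factor by which a coefficient has to be changed at an atom where `ν{x} u' = 2κ u`. -/
noncomputable def atomFactor (ν : Measure ℝ) (J : Matrix (Fin 2) (Fin 2) ℂ)
    (Q : ℝ → Matrix (Fin 2) (Fin 2) ℂ) (u : ℝ → Fin 2 → ℂ) (x : ℝ) : ℂ :=
  open Classical in
  if h : ν {x} ≠ 0 ∧ ∃ κ : ℂ, (ν.real {x} : ℂ) • slope J Q u x = (2 * κ) • u x then
    (1 - h.2.choose ^ 2)⁻¹ else 1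

/-- The factor differs from `1` only at atoms, of which there are countably many; so the arbitrary
choice of `κ` does not affect measurability. -/
theorem measurable_atomFactor [SigmaFinite ν] : Measurable (atomFactor ν J Q u) := by
  have h : {x | (fun _ => (1 : ℂ)) x ≠ atomFactor ν J Q u x}.Countable := by
    refine (countable_atoms (ν := ν)).mono fun x hx (h : ν {x} = 0) => hx ?_
    rw [atomFactor, dif_neg fun h' => h'.1 h]
  exact measurable_const.measurable_of_countable_ne h

/-- The one-sided limits of `u` are `(1 ± κ) u`, so lower bounds for them keep `κ` away from `±1`.
-/
theorem norm_atomFactor_le {x δ B : ℝ} (hδ : 0 < δ) (h0 : δ ≤ ‖u x‖) (hB : ‖u x‖ ≤ B)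
    (h1 : δ ≤ ‖u x + ((ν.real {x} / 2 : ℝ) : ℂ) • slope J Q u x‖)
    (h2 : δ ≤ ‖u x - ((ν.real {x} / 2 : ℝ) : ℂ) • slope J Q u x‖) :
    ‖atomFactor ν J Q u x‖ ≤ (B / δ) ^ 2 := by
  have hB0 : 0 < B := hδ.trans_le (h0.trans hB)
  unfold atomFactor
  split_ifs with h
  · have hκ := h.2.choose_spec
    set κ := h.2.choose
    have e : ((ν.real {x} / 2 : ℝ) : ℂ) • slope J Q u x = κ • u x := by
      have : ((ν.real {x} / 2 : ℝ) : ℂ) = (1 / 2 : ℂ) * (ν.real {x} : ℂ) := by push_cast; ring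
      rw [this, mul_smul, hκ, smul_smul]
      congr 1
      ring
    have e1 : u x + κ • u x = (1 + κ) • u x := by rw [add_smul, one_smul]
    have e2 : u x - κ • u x = (1 - κ) • u x := by rw [sub_smul, one_smul]
    rw [e, e1, norm_smul] at h1
    rw [e, e2, norm_smul] at h2
    have b1 : δ / B ≤ ‖1 + κ‖ := by
      rw [div_le_iff₀ hB0]
      exact h1.trans (mul_le_mul_of_nonneg_left hB (norm_nonneg _))
    have b2 : δ / B ≤ ‖1 - κ‖ := by
      rw [div_le_iff₀ hB0]
      exact h2.trans (mul_le_mul_of_nonneg_left hB (norm_nonneg _))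
    have e3 : 1 - κ ^ 2 = (1 + κ) * (1 - κ) := by ring
    have hp : 0 < δ / B := div_pos hδ hB0
    rw [e3, norm_inv, norm_mul, ← inv_div, inv_pow, sq]
    exact inv_anti₀ (mul_pos hp hp) (mul_le_mul b1 b2 hp.le (norm_nonneg _))
  · rw [norm_one]
    exact one_le_pow₀ ((one_le_div hδ).2 (h0.trans hB))

theorem IsHomogeneousSolution.locallyIntegrableOn_coeff [OrdConnected (Ω : Set ℝ)]
    (h : IsHomogeneousSolution Ω ν J Q u) (hu : u ≠ 0)
    (hF : ∀ j, LocallyIntegrableOn (fun x => F x j) Ω ν) :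
    LocallyIntegrableOn (fun x => coeffAlong J (u x) (F x) * atomFactor ν J Q u x) Ω ν := by
  have := h.locFin.sigmaFinite
  intro t ht
  obtain ⟨δ, hδ, he⟩ := h.eventually_norm_ge ht (h.ne_zero hu ht)
  obtain ⟨ε, hε, hs⟩ := Metric.nhds_basis_closedBall.mem_iff.1
    (Filter.inter_mem (Ω.isOpen.mem_nhds ht) he)
  have hK := isCompact_closedBall t ε
  have hsΩ : Metric.closedBall t ε ⊆ (Ω : Set ℝ) := hs.trans inter_subset_left
  refine ⟨Metric.closedBall t ε, nhdsWithin_le_nhds (Metric.closedBall_mem_nhds t hε), ?_⟩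
  obtain ⟨B, hB⟩ := exists_norm_le_of_balancedBV h.mem hK hsΩ
  have hum : ∀ j, AEMeasurable (fun x => u x j) (ν.restrict (Metric.closedBall t ε)) := fun j =>
    ((h.locFin.locallyIntegrableOn_balancedBV h.mem j).integrableOn_compact_subset hsΩ
      hK).1.aemeasurable
  have hFi : ∀ j, IntegrableOn (fun x => F x j) (Metric.closedBall t ε) ν := fun j =>
    (hF j).integrableOn_compact_subset hsΩ hK
  have hFm : ∀ j, AEMeasurable (fun x => F x j) (ν.restrict (Metric.closedBall t ε)) := fun j =>
    (hFi j).1.aemeasurable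
  have hcm : ∀ j, AEMeasurable (fun x => conj (u x j)) (ν.restrict (Metric.closedBall t ε)) :=
    fun j => Complex.continuous_conj.measurable.comp_aemeasurable (hum j)
  refine Integrable.mono' (g := fun x => B / (‖J 0 1‖ * δ ^ 2) * (‖F x 0‖ + ‖F x 1‖) * (B / δ) ^ 2)
    ((((hFi 0).norm.add (hFi 1).norm).const_mul _).mul_const _) ?_ ?_
  · refine AEMeasurable.aestronglyMeasurable (AEMeasurable.mul ?_
      measurable_atomFactor.aemeasurable)
    exact (((hcm 1).mul (hFm 0)).sub ((hcm 0).mul (hFm 1))).div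
      ((((hcm 0).mul (hum 0)).add ((hcm 1).mul (hum 1))).const_mul _)
  · filter_upwards [ae_restrict_mem measurableSet_closedBall] with x hx
    have hx1 := (hs hx).2
    rw [norm_mul]
    exact mul_le_mul (norm_coeffAlong_le hδ hx1.1 (hB x hx))
      (norm_atomFactor_le hδ hx1.1 (hB x hx) hx1.2.1 hx1.2.2) (norm_nonneg _)
      (by have := (norm_nonneg _).trans (hB x hx); positivity)

/-- Reduction of order: if `F` is pointwise collinear with `J u`, then `J p' + Q p ν = F ν` has a
solution that is pointwise collinear with `u`. -/
theorem IsHomogeneousSolution.exists_particular [OrdConnected (Ω : Set ℝ)]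
    (h : IsHomogeneousSolution Ω ν J Q u) (hne : (Ω : Set ℝ).Nonempty) (hu : u ≠ 0)
    (hJT : Jᵀ = -J) (hF : ∀ j, LocallyIntegrableOn (fun x => F x j) Ω ν)
    (huF : ∀ᵐ x ∂ν, u x ⬝ᵥ F x = 0)
    (hatom : ∀ x ∈ Ω, ν {x} ≠ 0 → F x ≠ 0 →
      ∃ κ : ℂ, (ν.real {x} : ℂ) • slope J Q u x = (2 * κ) • u x) :
    ∃ p ∈ balancedBV Ω 2, (∀ (φ : 𝓓(Ω, ℝ)) j, (J *ᵥ derivDist p φ) j +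
      ∑ k, ∫ x, (φ x : ℂ) * p x k * Q x j k ∂ν = ∫ x, (φ x : ℂ) * F x j ∂ν) ∧
      ∀ x ∈ Ω, ∃ a : ℂ, p x = a • u x := by
  obtain ⟨c, hc, hc0⟩ := h.locFin.exists_mem_not_atom hne
  -- The density of `β'`. Off the atoms it is determined by `ρ J u = F`; at an atom where `F ≠ 0`
  -- the correction in `vecPrimitive_eq` changes this to `ρ (1 - κ²) J u = F`, which `atomFactor`
  -- solves.
  let ρ : ℝ → ℂ := fun x => coeffAlong J (u x) (F x) * atomFactor ν J Q u x
  have hρ : LocallyIntegrableOn ρ Ω ν := h.locallyIntegrableOn_coeff hu hF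
  let b : ℝ → Fin 1 → ℂ := vecPrimitive Ω ν c fun s _ => ρ s
  have hb : b ∈ balancedBV Ω 1 := vecPrimitive_mem_balancedBV (fun _ => hρ) hc
  have hbe : ∀ s ∈ Ω, b s 0 = primitive ν c ρ s := fun s hs => vecPrimitive_apply hs 0
  let G : ℝ → Fin 2 → ℂ := fun s => ρ s • u s + b s 0 • slope J Q u s
  have hG : ∀ j, LocallyIntegrableOn (fun s => G s j) Ω ν := by
    intro j
    refine (h.locFin.locallyIntegrableOn_mul_balancedBV h.mem hρ j).add ?_
    have := h.locFin.locallyIntegrableOn_mul_balancedBV hb (h.locallyIntegrableOn_slope j) 0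
    simp only [mul_comm _ (b _ 0)] at this
    exact this
  have hGe : ∀ s ∈ Ω, G s = ρ s • u s + primitive ν c ρ s • slope J Q u s := fun s hs => by
    rw [← hbe s hs]
  have hp := vecPrimitive_mem_balancedBV hG hc
  have hpe := fun t ht => h.vecPrimitive_eq hρ hG hc hc0 hGe (t := t) ht
  -- Where `F` vanishes, `β` does not jump and the correction disappears, so no `κ` is needed there.
  have hzero : ∀ x, F x = 0 → ρ x = 0 := fun x hx => by
    simp [ρ, coeffAlong, hx]
  have hsq : ∀ x ∈ Ω, ν {x} ≠ 0 → F x ≠ 0 → ∃ κ : ℂ,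
      (ν.real {x} : ℂ) • slope J Q u x = (2 * κ) • u x ∧
      ρ x * (1 - κ ^ 2) = coeffAlong J (u x) (F x) := by
    intro x hx h1 h2
    have h3 := hatom x hx h1 h2
    have hd : ν {x} ≠ 0 ∧ ∃ κ : ℂ, (ν.real {x} : ℂ) • slope J Q u x = (2 * κ) • u x := ⟨h1, h3⟩
    obtain ⟨κ, hκdef, hκ⟩ : ∃ κ : ℂ, hd.2.choose = κ ∧
        (ν.real {x} : ℂ) • slope J Q u x = (2 * κ) • u x := ⟨_, rfl, hd.2.choose_spec⟩
    refine ⟨κ, hκ, ?_⟩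
    have e : ((ν.real {x} / 2 : ℝ) : ℂ) • slope J Q u x = κ • u x := by
      have : ((ν.real {x} / 2 : ℝ) : ℂ) = (1 / 2 : ℂ) * (ν.real {x} : ℂ) := by push_cast; ring
      rw [this, mul_smul, hκ, smul_smul]
      congr 1
      ring
    have n1 := h.right_ne_zero hx (h.ne_zero hu hx)
    have n2 := h.left_ne_zero hx (h.ne_zero hu hx)
    have e1 : ∀ a : ℂ, u x + a • u x = (1 + a) • u x := fun a => by rw [add_smul, one_smul]
    have e2 : ∀ a : ℂ, u x - a • u x = (1 - a) • u x := fun a => by rw [sub_smul, one_smul]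
    rw [e, e1] at n1
    rw [e, e2] at n2
    have e3 : 1 - κ ^ 2 ≠ 0 := by
      have : 1 - κ ^ 2 = (1 + κ) * (1 - κ) := by ring
      rw [this]
      exact mul_ne_zero (left_ne_zero_of_smul n1) (left_ne_zero_of_smul n2)
    change coeffAlong J (u x) (F x) * atomFactor ν J Q u x * _ = _
    rw [atomFactor, dif_pos hd, hκdef, inv_mul_cancel_right₀ e3]
  refine ⟨vecPrimitive Ω ν c G, hp, fun φ j => ?_, fun x hx => ?_⟩
  · have hkey : ∀ᵐ x ∂ν, (J *ᵥ G x) j + (Q x *ᵥ vecPrimitive Ω ν c G x) j = F x j := by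
      filter_upwards [h.locFin.ae_mem, huF] with x hx hxF
      have hcf := coeffAlong_smul h.isUnit hJT (h.ne_zero hu hx) hxF
      rw [← Pi.add_apply]
      refine congrFun ?_ j
      rw [hpe x hx, hGe x hx, Matrix.mulVec_add, Matrix.mulVec_smul, Matrix.mulVec_smul,
        h.mulVec_slope, Matrix.mulVec_add, Matrix.mulVec_smul, Matrix.mulVec_smul]
      -- The terms containing `β` cancel because `u` solves the homogeneous equation.
      have e0 : ρ x • J *ᵥ u x + primitive ν c ρ x • -(Q x *ᵥ u x) +
          (primitive ν c ρ x • Q x *ᵥ u x +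
            ((ν.real {x} : ℂ) ^ 2 / 4 * ρ x) • Q x *ᵥ slope J Q u x) =
          ρ x • J *ᵥ u x + ((ν.real {x} : ℂ) ^ 2 / 4 * ρ x) • Q x *ᵥ slope J Q u x := by
        rw [smul_neg]
        abel
      rw [e0]
      by_cases hF0 : F x = 0
      · rw [hzero x hF0, mul_zero, zero_smul, zero_smul, add_zero, hF0]
      by_cases ha : ν {x} = 0
      · have h1 : ν.real {x} = 0 := by rw [Measure.real, ha, ENNReal.toReal_zero]
        have h2 : ρ x = coeffAlong J (u x) (F x) := by
          change coeffAlong J (u x) (F x) * atomFactor ν J Q u x = _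
          rw [atomFactor, dif_neg fun h' => h'.1 ha, mul_one]
        rw [h1, h2, hcf]
        simp
      · obtain ⟨κ, hκ, hκ2⟩ := hsq x hx ha hF0
        have h1 : (ν.real {x} : ℂ) • Q x *ᵥ slope J Q u x = (2 * κ) • Q x *ᵥ u x := by
          rw [← Matrix.mulVec_smul, hκ, Matrix.mulVec_smul]
        have h2 : (ν.real {x} : ℂ) • Q x *ᵥ u x = -((2 * κ) • J *ᵥ u x) := by
          rw [← Matrix.mulVec_smul J, ← hκ, Matrix.mulVec_smul, h.mulVec_slope, smul_neg, neg_neg]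
        -- One factor `ν {x}` turns the slope into `2κ u`, the other turns `Q u` into `-2κ J u`; the
        -- factor `4` cancels.
        have h3 : ((ν.real {x} : ℂ) ^ 2 / 4 * ρ x) • Q x *ᵥ slope J Q u x =
            -((ρ x * κ ^ 2) • J *ᵥ u x) := by
          have e1 : (ν.real {x} : ℂ) ^ 2 / 4 * ρ x =
            (ν.real {x} : ℂ) / 4 * ρ x * (ν.real {x} : ℂ) := by ring
          have e2 : (ν.real {x} : ℂ) / 4 * ρ x * (2 * κ) = ρ x * κ / 2 * (ν.real {x} : ℂ) := by
            ring
          rw [e1, mul_smul, h1, smul_smul, e2, mul_smul, h2, smul_neg, smul_smul]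
          congr 2
          ring
        rw [h3, ← sub_eq_add_neg, ← sub_smul, ← hcf, ← hκ2]
        congr 1
        ring
    have hpi : ∀ k, Integrable (fun x => (φ x : ℂ) * vecPrimitive Ω ν c G x k * Q x j k) ν := by
      intro k
      have := integrable_testFunction_mul (h.locFin.locallyIntegrableOn_mul_balancedBV hp
        (h.locallyIntegrableOn j k) k) φ
      refine this.congr (Eventually.of_forall fun x => ?_)
      simp only
      ring
    have hGi : ∀ k, Integrable (fun x => (φ x : ℂ) * G x k) ν := fun k =>
      integrable_testFunction_mul (hG k) φ
    have e1 : (J *ᵥ derivDist (vecPrimitive Ω ν c G) φ) j =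
        ∑ k, ∫ x, J j k * ((φ x : ℂ) * G x k) ∂ν := by
      simp only [Matrix.mulVec, dotProduct]
      refine Finset.sum_congr rfl fun k _ => ?_
      rw [derivDist_vecPrimitive h.locFin hG hc, integral_const_mul]
    rw [e1, ← integral_finsetSum _ fun k _ => (hGi k).const_mul _,
      ← integral_finsetSum _ fun k _ => hpi k, ← integral_add
        (integrable_finsetSum _ fun k _ => (hGi k).const_mul _)
        (integrable_finsetSum _ fun k _ => hpi k)]
    refine integral_congr_ae ?_
    filter_upwards [hkey] with x hx
    rw [← hx]
    simp only [Matrix.mulVec, dotProduct, mul_add, Finset.mul_sum]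
    congr 1 <;> exact Finset.sum_congr rfl fun k _ => by ring
  · rw [hpe x hx]
    by_cases hF0 : F x = 0
    · refine ⟨primitive ν c ρ x, ?_⟩
      rw [hzero x hF0, mul_zero, zero_smul, add_zero]
    by_cases ha : ν {x} = 0
    · refine ⟨primitive ν c ρ x, ?_⟩
      rw [Measure.real, ha]
      simp
    · obtain ⟨κ, hκ, -⟩ := hsq x hx ha hF0
      refine ⟨primitive ν c ρ x + (ν.real {x} : ℂ) / 4 * ρ x * (2 * κ), ?_⟩
      rw [add_smul, mul_smul _ (2 * κ), ← hκ, smul_smul]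
      congr 2
      ring

end Planar

end FirstOrderSystem

/-! ### From a null solution to the maximal relation -/

namespace FirstOrderSystem

variable {Ω : Opens ℝ} {n : ℕ}

instance ordConnected_openInterval (a b : EReal) : OrdConnected (openInterval a b : Set ℝ) :=
  ⟨fun _ hx _ hy _ hz => ⟨hx.1.trans_le (EReal.coe_le_coe_iff.2 hz.1),
    (EReal.coe_le_coe_iff.2 hz.2).trans_lt hy.2⟩⟩

theorem nonempty_openInterval {a b : EReal} (hab : a < b) :
    (openInterval a b : Set ℝ).Nonempty :=
  EReal.lt_iff_exists_real_btwn.1 hab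

theorem of_ae_of_singleton_ne_zero {σ : Measure ℝ} {P : ℝ → Prop} (h : ∀ᵐ x ∂σ, P x) {x : ℝ}
    (hx : σ {x} ≠ 0) : P x := by
  by_contra h0
  exact hx (measure_mono_null (singleton_subset_iff.2 h0) h)

theorem LocFin.singleton_ne_zero {σ ν : Measure ℝ} (hσ : LocFin Ω σ) (hν : LocFin Ω ν) (h : σ ≪ ν)
    {x : ℝ} (hx : ν {x} ≠ 0) (hd : dens σ ν x ≠ 0) : σ {x} ≠ 0 := by
  have := hσ.sigmaFinite
  have := hν.sigmaFinite
  rw [← Measure.setLIntegral_rnDeriv h {x}, lintegral_singleton]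
  exact mul_ne_zero (fun h0 => hd (by rw [dens, h0, ENNReal.toReal_zero])) hx

/-- Facts known almost everywhere for `tr w` are needed for the dominating measure; they survive
where the density of `tr w` is nonzero, and elsewhere `F` vanishes. -/
theorem LocFin.ae_of_dens_ne_zero {σ ν : Measure ℝ} (hσ : LocFin Ω σ) (hν : LocFin Ω ν)
    (h : σ ≪ ν) {P : ℝ → Prop} (hP : ∀ᵐ x ∂σ, P x) : ∀ᵐ x ∂ν, dens σ ν x ≠ 0 → P x := by
  have := hσ.sigmaFinite
  have := hν.sigmaFinite
  rw [← Measure.withDensity_rnDeriv_eq _ _ h,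
    ae_withDensity_iff (Measure.measurable_rnDeriv _ _)] at hP
  filter_upwards [hP] with x hx hd
  exact hx fun h0 => hd (by rw [dens, h0, ENNReal.toReal_zero])

theorem MatrixMeasure.IsSqIntegrable.locallyIntegrableOn_mulVec {M : MatrixMeasure Ω n}
    {f : ℝ → Fin n → ℂ} (hf : M.IsSqIntegrable f) (j : Fin n) :
    LocallyIntegrableOn (fun x => (M.density x *ᵥ f x) j) Ω M.base := by
  refine M.locFin.locallyIntegrableOn fun K hK hs => ?_
  have hfin : IsFiniteMeasure (M.base.restrict K) := ⟨by simpa using M.finite_of_isCompact K hK hs⟩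
  refine Integrable.mono' ((integrable_const (2 : ℝ)).add hf.2.integrableOn.re)
    (M.aestronglyMeasurable_mulVec hf.1 j).restrict (ae_restrict_of_ae ?_)
  filter_upwards [M.ae_norm_density_le j j] with x hx
  have hb := re_dotProduct_bound (M.posSemidef x) (Pi.single j 1) (f x)
  have hs : star (Pi.single j 1 : Fin n → ℂ) = Pi.single j 1 := by
    rw [← Pi.single_star, star_one]
  rw [hs, single_one_dotProduct, single_one_dotProduct, Matrix.mulVec_single_one,
    Matrix.col_apply] at hb
  change _ ≤ 2 + (star (f x) ⬝ᵥ M.density x *ᵥ f x).re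
  linarith [(Complex.re_le_norm _).trans hx]

theorem exists_dominating (q : Matrix (Fin n) (Fin n) 𝓓'^{0}(Ω, ℂ)) (M : MatrixMeasure Ω n) :
    ∃ ν : Measure ℝ, LocFin Ω ν ∧ (∀ j k, (toMeasure (q j k)).variation ≪ ν) ∧ M.base ≪ ν := by
  obtain ⟨σ, hσ, hqσ⟩ : ∃ σ : Measure ℝ, LocFin Ω σ ∧
      ∀ j k, (toMeasure (q j k)).variation ≪ σ := by
    refine ⟨∑ p : Fin n × Fin n, (toMeasure (q p.1 p.2)).variation,
      LocFin.sum _ fun p => (toMeasure (q p.1 p.2)).locFin, fun j k => ?_⟩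
    refine Measure.absolutelyContinuous_of_le ?_
    exact Finset.single_le_sum (f := fun p : Fin n × Fin n => (toMeasure (q p.1 p.2)).variation)
      (fun _ _ => Measure.zero_le _) (Finset.mem_univ (j, k))
  exact ⟨σ + M.base, hσ.add M.locFin, fun j k => (hqσ j k).add_right _,
    Measure.AbsolutelyContinuous.rfl.add_right' _⟩

/-- Two vectors in the kernel of a nonzero `2 × 2` matrix are collinear. -/
theorem exists_smul_eq_of_mulVec_eq_zero {A : Matrix (Fin 2) (Fin 2) ℂ} (hA : A ≠ 0)
    {v s : Fin 2 → ℂ} (hv : v ≠ 0) (hAv : A *ᵥ v = 0) (hAs : A *ᵥ s = 0) :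
    ∃ κ : ℂ, s = κ • v := by
  have hd : v 0 * s 1 = v 1 * s 0 := by
    by_contra h
    have h' := sub_ne_zero.2 h
    refine hA (Matrix.ext fun i j => ?_)
    have h1 := congrFun hAv i
    have h2 := congrFun hAs i
    simp only [Matrix.mulVec, dotProduct, Fin.sum_univ_two, Pi.zero_apply] at h1 h2
    fin_cases j
    · refine (mul_eq_zero.1 (?_ : A i 0 * (v 0 * s 1 - v 1 * s 0) = 0)).resolve_right h'
      linear_combination s 1 * h1 - v 1 * h2
    · refine (mul_eq_zero.1 (?_ : A i 1 * (v 0 * s 1 - v 1 * s 0) = 0)).resolve_right h'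
      linear_combination v 0 * h2 - s 0 * h1
  by_cases h0 : v 0 = 0
  · have h1 : v 1 ≠ 0 := fun h1 => hv (funext fun j => by fin_cases j <;> assumption)
    refine ⟨s 1 / v 1, funext fun j => ?_⟩
    fin_cases j
    · have : v 1 * s 0 = 0 := by rw [← hd, h0, zero_mul]
      simp [h0, (mul_eq_zero.1 this).resolve_left h1]
    · simp [h1]
  · refine ⟨s 0 / v 0, funext fun j => ?_⟩
    fin_cases j
    · simp [h0]
    · simp only [Fin.mk_one, Pi.smul_apply, smul_eq_mul]
      rw [div_mul_eq_mul_div, eq_div_iff h0]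
      linear_combination hd

theorem transpose_eq_neg_of_real {J : Matrix (Fin n) (Fin n) ℂ} (hJskew : Jᴴ = -J)
    (hJreal : ∀ j k, conj (J j k) = J j k) : Jᵀ = -J := by
  rw [← hJskew]
  ext j k
  exact (hJreal k j).symm

/-- If a nonzero solution `u` of `J u' + q u = 0` satisfies `w u = 0`, then `J p' + q p = w f` has
a solution with `w p = 0` for each square-integrable `f`. -/
theorem exists_solution_of_nullSolution [OrdConnected (Ω : Set ℝ)] (hne : (Ω : Set ℝ).Nonempty)
    {J : Matrix (Fin 2) (Fin 2) ℂ} {q w : Matrix (Fin 2) (Fin 2) 𝓓'^{0}(Ω, ℂ)}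
    (hJ : IsUnit J) (hJT : Jᵀ = -J) (hw : IsNonnegDist w) (hwreal : IsRealDist w)
    (hinv : ∀ x ∈ Ω, IsUnit ((2 : ℂ) • J + jump q x) ∧ IsUnit ((2 : ℂ) • J - jump q x))
    (hker : ∀ x ∈ Ω,
      LinearMap.ker (jump w x).mulVecLin ≤ LinearMap.ker (jump w x * J⁻¹ * jump q x).mulVecLin)
    {u : ℝ → Fin 2 → ℂ} (hu : u ∈ nullSolutions J q w) (hu0 : u ≠ 0)
    {f : ℝ → Fin 2 → ℂ} (hf : (toMatrixMeasure w).IsSqIntegrable f) :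
    ∃ p ∈ balancedBV Ω 2,
      (∀ φ : 𝓓(Ω, ℝ), J *ᵥ derivDist p φ + mulDist q p φ = weightDist w f φ) ∧
      ∀ᵐ x ∂(toMatrixMeasure w).base, (toMatrixMeasure w).density x *ᵥ p x = 0 := by
  obtain ⟨hu1, hu2, hu3⟩ := hu
  set M := toMatrixMeasure w with hM
  obtain ⟨ν, hν, hqν, hMν⟩ := exists_dominating q M
  let Q : ℝ → Matrix (Fin 2) (Fin 2) ℂ := fun x =>
    Matrix.of fun j k => (toMeasure (q j k)).density ν x
  have hjump : ∀ x, jump q x = (ν.real {x} : ℂ) • Q x := fun x => by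
    ext j k
    exact (toMeasure (q j k)).density_singleton hν (hqν j k) x
  have hQi : ∀ j k, LocallyIntegrableOn (fun x => Q x j k) Ω ν := fun j k =>
    (toMeasure (q j k)).locallyIntegrableOn_density hν
  have hmul : ∀ (p : ℝ → Fin 2 → ℂ) (φ : 𝓓(Ω, ℝ)) j, mulDist q p φ j =
      ∑ k, ∫ x, (φ x : ℂ) * p x k * Q x j k ∂ν := fun p φ j =>
    Finset.sum_congr rfl fun k _ => (toMeasure (q j k)).integral_eq hν (hqν j k) _
  have hJd := (Matrix.isUnit_iff_isUnit_det _).1 hJ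
  have hQu : ∀ (φ : 𝓓(Ω, ℝ)) j k, Integrable (fun x => (φ x : ℂ) * u x k * Q x j k) ν := by
    intro φ j k
    refine (integrable_testFunction_mul
      (hν.locallyIntegrableOn_mul_balancedBV hu1 (hQi j k) k) φ).congr
      (Eventually.of_forall fun x => ?_)
    simp only
    ring
  have hhom : IsHomogeneousSolution Ω ν J Q u := by
    refine ⟨hν, hJ, hQi, fun x hx => ?_, fun x hx => ?_, hu1, fun φ j => ?_⟩
    · rw [← hjump]
      exact (hinv x hx).1
    · rw [← hjump]
      exact (hinv x hx).2
    · have h1 : derivDist u φ = -(J⁻¹ *ᵥ mulDist q u φ) := by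
        rw [← Matrix.mulVec_neg, ← eq_neg_of_add_eq_zero_left (hu2 φ), Matrix.mulVec_mulVec,
          Matrix.nonsing_inv_mul _ hJd, Matrix.one_mulVec]
      have h2 : ∀ k, Integrable (fun x => ∑ l, (φ x : ℂ) * u x l * Q x k l) ν := fun k =>
        integrable_finsetSum _ fun l _ => hQu φ k l
      have h3 : ∀ k, mulDist q u φ k = ∫ x, ∑ l, (φ x : ℂ) * u x l * Q x k l ∂ν := fun k => by
        rw [hmul, integral_finsetSum _ fun l _ => hQu φ k l]
      rw [h1]
      simp only [Pi.neg_apply, Matrix.mulVec, dotProduct, slope, h3, ← integral_const_mul]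
      rw [← integral_finsetSum _ fun k _ => (h2 k).const_mul _, ← integral_neg]
      refine integral_congr_ae (Eventually.of_forall fun x => ?_)
      simp only [mul_neg, Finset.mul_sum]
      congr 1
      refine Finset.sum_congr rfl fun k _ => Finset.sum_congr rfl fun l _ => ?_
      ring
  have hWu : ∀ᵐ x ∂M.base, M.density x *ᵥ u x = 0 := ae_mulVec_eq_zero hw hwreal hu1 hu3
  have hsymm : ∀ᵐ x ∂M.base, (M.density x)ᵀ = M.density x := ae_density_symm hw hwreal
  -- The density of `w f` with respect to `ν`.
  let F : ℝ → Fin 2 → ℂ := fun x => (dens M.base ν x : ℂ) • M.density x *ᵥ f x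
  have hF : ∀ j, LocallyIntegrableOn (fun x => F x j) Ω ν := by
    intro j
    have := M.locFin.locallyIntegrableOn_mul_dens hν hMν (hf.locallyIntegrableOn_mulVec j)
    simp only [mul_comm _ (dens _ _ _ : ℂ)] at this
    exact this
  -- By symmetry of `W`, `uᵀ W f = (W u)ᵀ f = 0`.
  have huF : ∀ᵐ x ∂ν, u x ⬝ᵥ F x = 0 := by
    filter_upwards [M.locFin.ae_of_dens_ne_zero hν hMν (hWu.and hsymm)] with x hx
    by_cases hd : dens M.base ν x = 0
    · simp only [F, hd, Complex.ofReal_zero, zero_smul, dotProduct_zero]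
    · obtain ⟨h1, h2⟩ := hx hd
      simp only [F]
      rw [dotProduct_smul, Matrix.dotProduct_mulVec, ← h2, Matrix.vecMul_transpose, h1,
        zero_dotProduct, smul_zero]
  have hatom : ∀ x ∈ Ω, ν {x} ≠ 0 → F x ≠ 0 →
      ∃ κ : ℂ, (ν.real {x} : ℂ) • slope J Q u x = (2 * κ) • u x := by
    intro x hx hνx hFx
    have hd : dens M.base ν x ≠ 0 := fun h0 => hFx (by
      simp only [F, h0, Complex.ofReal_zero, zero_smul])
    have hbx := M.locFin.singleton_ne_zero hν hMν hνx hd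
    have hW0 : M.density x ≠ 0 := fun h0 => hFx (by
      simp only [F, h0, Matrix.zero_mulVec, smul_zero])
    have hWux := of_ae_of_singleton_ne_zero hWu hbx
    have hr : (M.base.real {x} : ℂ) ≠ 0 := by
      rw [Complex.ofReal_ne_zero]
      exact (ENNReal.toReal_pos hbx (M.finite_of_isCompact {x} isCompact_singleton
        (singleton_subset_iff.2 hx)).ne).ne'
    have hjw : jump w x = (M.base.real {x} : ℂ) • M.density x := jump_eq hw hwreal x
    have h1 : u x ∈ LinearMap.ker (jump w x).mulVecLin := by
      rw [LinearMap.mem_ker, Matrix.mulVecLin_apply, hjw, Matrix.smul_mulVec, hWux, smul_zero]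
    have h2 := hker x hx h1
    rw [LinearMap.mem_ker, Matrix.mulVecLin_apply, hjw, hjump, ← Matrix.mulVec_mulVec,
      ← Matrix.mulVec_mulVec, Matrix.smul_mulVec, smul_eq_zero] at h2
    have h3 := h2.resolve_left hr
    -- The jump of `u` at `x` is `-J⁻¹ Δ_q u`, so the kernel condition applied to `u x` says that
    -- `W` annihilates it. As `W ≠ 0` also annihilates `u x ≠ 0`, its kernel is the line spanned by
    -- `u x`.
    have h4 : M.density x *ᵥ ((ν.real {x} : ℂ) • slope J Q u x) = 0 := by
      rw [slope, smul_neg, Matrix.mulVec_neg, ← Matrix.mulVec_smul, ← Matrix.smul_mulVec, h3,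
        neg_zero]
    obtain ⟨κ, hκ⟩ := exists_smul_eq_of_mulVec_eq_zero hW0 (hhom.ne_zero hu0 hx) hWux h4
    exact ⟨κ / 2, by rw [hκ, mul_div_cancel₀ _ two_ne_zero]⟩
  obtain ⟨p, hp, hp1, hp2⟩ := hhom.exists_particular hne hu0 hJT hF huF hatom
  refine ⟨p, hp, fun φ => funext fun j => ?_, ?_⟩
  · rw [Pi.add_apply, hmul, hp1]
    refine Eq.trans ?_ (integral_dens_mul M.locFin hν hMν _)
    refine integral_congr_ae (Eventually.of_forall fun x => ?_)
    simp only [F, Pi.smul_apply, smul_eq_mul]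
    ring
  · filter_upwards [hWu, M.locFin.ae_mem] with x hx hm
    obtain ⟨a, ha⟩ := hp2 x hm
    rw [ha, Matrix.mulVec_smul, hx, smul_zero]

theorem aestronglyMeasurable_balancedBV {ν : Measure ℝ} (hν : LocFin Ω ν) {u : ℝ → Fin n → ℂ}
    (hu : u ∈ balancedBV Ω n) (k : Fin n) : AEStronglyMeasurable (fun x => u x k) ν := by
  have h := (hν.locallyIntegrableOn_balancedBV hu k).aestronglyMeasurable
  rwa [Measure.restrict_eq_self_of_ae_mem hν.ae_mem] at h

/-- Solutions with `w p = 0` exhibit `(0, [f])` as an element of the maximal relation. -/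
theorem zero_mk_mem_maxRelation {J : Matrix (Fin n) (Fin n) ℂ}
    {q w : Matrix (Fin n) (Fin n) 𝓓'^{0}(Ω, ℂ)} (f : PreLTwo w) {p : ℝ → Fin n → ℂ}
    (hp : p ∈ balancedBV Ω n)
    (heq : ∀ φ : 𝓓(Ω, ℝ), J *ᵥ derivDist p φ + mulDist q p φ = weightDist w f.1 φ)
    (h0 : ∀ᵐ x ∂(toMatrixMeasure w).base, (toMatrixMeasure w).density x *ᵥ p x = 0) :
    ((0, SeparationQuotient.mk f) : LTwo w × LTwo w) ∈ maxRelation J q w := by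
  have hae : (fun x => star (p x) ⬝ᵥ (toMatrixMeasure w).density x *ᵥ p x)
      =ᵐ[(toMatrixMeasure w).base] 0 := by
    filter_upwards [h0] with x hx
    rw [hx, dotProduct_zero, Pi.zero_apply]
  let P : PreLTwo w := ⟨p, fun j => aestronglyMeasurable_balancedBV (toMatrixMeasure w).locFin hp j,
    (integrable_congr hae).2 (integrable_zero _ _ _)⟩
  have hin : inner ℂ P P = 0 := (integral_congr_ae hae).trans (integral_zero _ _)
  have hP : (SeparationQuotient.mk P : LTwo w) = 0 := by
    rw [← norm_eq_zero, SeparationQuotient.norm_mk, ← sq_eq_zero_iff (a := ‖P‖),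
      ← @inner_self_eq_norm_sq ℂ, hin]
    simp
  exact ⟨P, f, hp, heq, by rw [hP]⟩

/-- Subtracting `(0, f - i u)` from `(u, f)` leaves `(u, i u)`, an element of the trivial deficiency
space. -/
theorem maxRelation_eq_prod {J : Matrix (Fin n) (Fin n) ℂ}
    {q w : Matrix (Fin n) (Fin n) 𝓓'^{0}(Ω, ℂ)} (hdef : deficiencyIndex J q w Complex.I = 0)
    (h : ∀ f : LTwo w, ((0, f) : LTwo w × LTwo w) ∈ maxRelation J q w) :
    maxRelation J q w = Submodule.prod ⊥ ⊤ := by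
  have hbot : deficiencySpace J q w Complex.I = ⊥ := Submodule.rank_eq_zero.1 hdef
  ext ⟨u, f⟩
  simp only [Submodule.mem_prod, Submodule.mem_bot, Submodule.mem_top, and_true]
  constructor
  · intro hm
    have h1 : (u, Complex.I • u) ∈ deficiencySpace J q w Complex.I := by
      refine ⟨?_, rfl⟩
      have := (maxRelation J q w).sub_mem hm (h (f - Complex.I • u))
      simpa using this
    rw [hbot, Submodule.mem_bot] at h1
    exact congrArg Prod.fst h1
  · rintro rfl
    exact h f

/-- Testing `(v, g)` against `(0, v)` gives `⟨v, v⟩ = 0`, while `g` is only ever paired with `0`. -/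
theorem adjoint_bot_prod_top {E : Type*} [NormedAddCommGroup E] [InnerProductSpace ℂ E] :
    (Submodule.prod ⊥ ⊤ : Submodule ℂ (E × E)).adjoint = Submodule.prod ⊥ ⊤ := by
  ext ⟨v, g⟩
  simp only [Submodule.mem_adjoint_iff, Submodule.mem_prod, Submodule.mem_bot, Submodule.mem_top,
    and_true]
  constructor
  · intro h
    simpa using h 0 v rfl
  · rintro rfl a b rfl
    simp

end FirstOrderSystem

open FirstOrderSystem in
theorem mainTheorem11 (a b : EReal) (hab : a < b)
    (J : Matrix (Fin 2) (Fin 2) ℂ)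
    (q w : Matrix (Fin 2) (Fin 2) 𝓓'^{0}(openInterval a b, ℂ))
    (hJ : IsUnit J) (hJskew : Jᴴ = -J)
    (hq : IsHermitianDist q) (hw : IsNonnegDist w)
    (hinv : ∀ x ∈ openInterval a b,
      IsUnit ((2 : ℂ) • J + jump q x) ∧ IsUnit ((2 : ℂ) • J - jump q x))
    (hJreal : ∀ j k, conj (J j k) = J j k) (hqreal : IsRealDist q) (hwreal : IsRealDist w)
    (hL0 : Module.rank ℂ (nullSolutions J q w) = 1)
    (hplus : deficiencyIndex J q w Complex.I = 0)
    (hminus : deficiencyIndex J q w (-Complex.I) = 0)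
    (hker : ∀ x ∈ openInterval a b,
      LinearMap.ker (jump w x).mulVecLin ≤ LinearMap.ker (jump w x * J⁻¹ * jump q x).mulVecLin) :
    maxRelation J q w = (maxRelation J q w).adjoint ∧
      (maxRelation J q w).adjoint = Submodule.prod ⊥ ⊤ := by
  have hbot : nullSolutions J q w ≠ ⊥ := fun h => by
    rw [Submodule.rank_eq_zero.2 h] at hL0
    exact zero_ne_one hL0
  obtain ⟨u, hu, hu0⟩ := Submodule.exists_mem_ne_zero_of_ne_bot hbot
  have h : maxRelation J q w = Submodule.prod ⊥ ⊤ := by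
    refine maxRelation_eq_prod hplus fun f => ?_
    obtain ⟨f, rfl⟩ := SeparationQuotient.surjective_mk f
    obtain ⟨p, hp, hp1, hp2⟩ := exists_solution_of_nullSolution (nonempty_openInterval hab) hJ
      (transpose_eq_neg_of_real hJskew hJreal) hw hwreal hinv hker hu hu0 f.2
    exact zero_mk_mem_maxRelation f hp hp1 hp2
  rw [h, adjoint_bot_prod_top]
  exact ⟨rfl, rfl⟩
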